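/- **Conventions.** Let $(M,g)$ and $(N,h)$ be smooth Riemannian manifolds without boundary of arbitrary dimensions, and let $E_2(\varphi)=\frac12\int_M|\mathrm d\varphi|^2\,\mathrm{vol}_g$ be the Dirichlet energy of a smooth map $\varphi:M\to N$. Let $\mathrm{SDiff}(M,g)$ be the group of volume preserving diffeomorphisms of $M$ with compact support, and $\Gamma_0(TM)$ the space of smooth divergenceless vector fields of compact support. A smooth family in $\mathrm{SDiff}(M,g)$ is a jointly smooth one whose supports lie, locally in the parameter, in a fixed compact set. The map $\varphi$ is *restricted harmonic* if $E_2(\varphi)<\infty$ and $\frac{d}{dt}\big|_{t=0}E_2(\varphi\circ\psi_t)=0$ for every smooth curve $\psi_t$ in $\mathrm{SDiff}(M,g)$ with $\psi_0=\mathrm{id}_M$. For such $\varphi$ and $X,Y\in\Gamma_0(TM)$, $$\mathsf{Hess}(X,Y)=\frac{\partial^2E_2(\varphi\circ\psi_{s,t})}{\partial s\,\partial t}\Big|_{s=t=0},$$ where $\psi_{s,t}$ is any smooth two-parameter family in $\mathrm{SDiff}(M,g)$ with $\psi_{0,0}=\mathrm{id}_M$, $\partial_s\psi_{s,t}|_{s=t=0}=X$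 and $\partial_t\psi_{s,t}|_{s=t=0}=Y$; $\varphi$ is *stable* if $\mathsf{Hess}(X,X)\ge0$ for all $X\in\Gamma_0(TM)$. The map $\varphi$ is *weakly conformal* if $\varphi^*h=\lambda g$ for some function $\lambda:M\to\mathbb R$. **Corollary 3.3.** Let $\varphi:(M,g)\to(N,h)$ be smooth and weakly conformal with $E_2(\varphi)<\infty$. Then $\varphi$ is a stable restricted harmonic map. Moreover $\varphi^*h=f^2g$ for some $f:M\to\mathbb R$, and for every such $f$ and every $X\in\Gamma_0(TM)$ the tensor $f\mathcal L_Xg$ is square integrable and $$\mathsf{Hess}(X,X)=\tfrac12\,\|f\,\mathcal L_Xg\|_{L^2}^2\ \ge 0 ,$$ independently of the choice of the variation $\psi_{s,t}$ tangent to $(X,X)$. This vanishes if and only if $\mathcal L_Xg=0$ at every point where $\mathrm d\varphi\neq0$. In particular, if the set of critical points $\{x\in M:\mathrm d\varphi_x=0\}$ has empty interior (for instance, if $\dim M\ge1$ and critical points are isolated), then $\mathsf{Hess}(X,X)>0$ unless $X$ is a Killing field, that is, $\mathcal L_Xg=0$. For example, inverse stereographic projection $\mathbb R^3\to S^3$,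 $x\mapsto(|x|^2-1,\,2x)/(|x|^2+1)$, with the Euclidean metric on $\mathbb R^3$ and the round metric on the unit sphere $S^3$, is a stable restricted harmonic map. -/

import Mathlib

open MeasureTheory Filter Topology Set
open scoped Manifold ContDiff ENNReal

noncomputable section

/-! ### Riemannian metrics and coordinates

Manifolds are smooth, without boundary, and modelled on `EuclideanSpace ℝ (Fin m)`. -/

/-- Smooth Riemannian metrics on the `m`-manifold `M`. -/
abbrev SmoothMetric (m : ℕ) (M : Type*) [TopologicalSpace M]
    [ChartedSpace (EuclideanSpace ℝ (Fin m)) M] [IsManifold (𝓡 m) ∞ M] :=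
  Bundle.ContMDiffRiemannianMetric (𝓡 m) ∞ (EuclideanSpace ℝ (Fin m))
    (fun x : M => TangentSpace (𝓡 m) x)

/-- A `(0,2)` tensor at the point `x`, as a function of two tangent vectors. -/
abbrev Tensor02 (m : ℕ) {M : Type*} [TopologicalSpace M]
    [ChartedSpace (EuclideanSpace ℝ (Fin m)) M] (x : M) :=
  TangentSpace (𝓡 m) x → TangentSpace (𝓡 m) x → ℝ

section Riemannian

variable {m : ℕ} {M : Type*} [TopologicalSpace M] [ChartedSpace (EuclideanSpace ℝ (Fin m)) M]

/-- The matrix of a `(0,2)` tensor at `x` in the standard basis of the tangent space. -/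
def tensorMatrix {x : M} (A : Tensor02 m x) : Matrix (Fin m) (Fin m) ℝ :=
  Matrix.of fun i j => A (EuclideanSpace.single i (1 : ℝ)) (EuclideanSpace.single j (1 : ℝ))

/-- The coordinate expression of a vector field `X` in the chart centred at `x₀`. -/
def chartField (X : ∀ x : M, TangentSpace (𝓡 m) x) (x₀ : M) (z : EuclideanSpace ℝ (Fin m)) :
    EuclideanSpace ℝ (Fin m) :=
  mfderiv (𝓡 m) 𝓘(ℝ, EuclideanSpace ℝ (Fin m)) (extChartAt (𝓡 m) x₀)
    ((extChartAt (𝓡 m) x₀).symm z) (X ((extChartAt (𝓡 m) x₀).symm z))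

variable [IsManifold (𝓡 m) ∞ M] (g : SmoothMetric m M)

/-- The Gram matrix `(g_ij)` of the metric at `x`, in the standard basis of the tangent space. -/
def gramMatrix (x : M) : Matrix (Fin m) (Fin m) ℝ :=
  tensorMatrix (x := x) fun u v => g.inner x u v

/-- The metric trace `∑ A(e_i, e_i) = g^{ij} A_{ij}` of a `(0,2)` tensor, where `(e_i)` is any
`g`-orthonormal basis of the tangent space. -/
def metricTrace (x : M) (A : Tensor02 m x) : ℝ :=
  ((gramMatrix g x)⁻¹ * tensorMatrix A).trace

/-- The inner product `⟨A, B⟩_g = ∑ A(e_i, e_j) B(e_i, e_j) = g^{ik} g^{jl} A_{ij} B_{kl}` of two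
`(0,2)` tensors, where `(e_i)` is any `g`-orthonormal basis of the tangent space. -/
def tensorInner (x : M) (A B : Tensor02 m x) : ℝ :=
  ((gramMatrix g x)⁻¹ * tensorMatrix A * (gramMatrix g x)⁻¹ * (tensorMatrix B).transpose).trace

/-- The coordinate expression of the metric in the chart centred at `x₀`: the inner product, at the
point with coordinates `z`, of the tangent vectors with coordinates `u` and `v`. -/
def chartMetric (x₀ : M) (z u v : EuclideanSpace ℝ (Fin m)) : ℝ :=
  g.inner ((extChartAt (𝓡 m) x₀).symm z)
    (mfderiv 𝓘(ℝ, EuclideanSpace ℝ (Fin m)) (𝓡 m) (extChartAt (𝓡 m) x₀).symm z u)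
    (mfderiv 𝓘(ℝ, EuclideanSpace ℝ (Fin m)) (𝓡 m) (extChartAt (𝓡 m) x₀).symm z v)

/-- The volume density `√det (g_ij)` in the chart centred at `x₀`. -/
def chartDensity (x₀ : M) (z : EuclideanSpace ℝ (Fin m)) : ℝ :=
  Real.sqrt (Matrix.of fun i j => chartMetric g x₀ z
    (EuclideanSpace.single i (1 : ℝ)) (EuclideanSpace.single j (1 : ℝ))).det

/-- The Riemannian volume of the domain of the chart centred at `x₀`, as a measure on `M` vanishing
outside this domain: the image of `√det (g_ij) dz` under the inverse of the chart. -/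
def chartVolume [MeasurableSpace M] (x₀ : M) : Measure M :=
  (((volume : Measure (EuclideanSpace ℝ (Fin m))).restrict (extChartAt (𝓡 m) x₀).target).withDensity
    fun z => ENNReal.ofReal (chartDensity g x₀ z)).map (extChartAt (𝓡 m) x₀).symm

/-- The Riemannian volume measure of `(M, g)`. The volumes of the chart domains agree on overlaps;
the volume measure, which restricts to each of them, is their supremum, the least measure that
dominates all of them. -/
def riemannianVolume [MeasurableSpace M] : Measure M :=
  ⨆ x₀ : M, chartVolume g x₀

/-- The divergence of a vector field, `(1/√|g|) ∂_i (√|g| X^i)` in local coordinates. -/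
def divergence (X : ∀ x : M, TangentSpace (𝓡 m) x) (x : M) : ℝ :=
  (chartDensity g x (extChartAt (𝓡 m) x x))⁻¹ *
    ∑ i : Fin m, fderiv ℝ (fun z => chartDensity g x z * chartField X x z i)
      (extChartAt (𝓡 m) x x) (EuclideanSpace.single i (1 : ℝ))

/-- The Lie derivative `L_X g`, in local coordinates
`(L_X g)_ij = X^k ∂_k g_ij + g_kj ∂_i X^k + g_ik ∂_j X^k`. -/
def lieDerivMetric (X : ∀ x : M, TangentSpace (𝓡 m) x) (x : M) : Tensor02 m x := fun u v =>
  let e := extChartAt (𝓡 m) x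
  let z₀ : EuclideanSpace ℝ (Fin m) := e x
  let u' : EuclideanSpace ℝ (Fin m) := mfderiv (𝓡 m) 𝓘(ℝ, EuclideanSpace ℝ (Fin m)) e x u
  let v' : EuclideanSpace ℝ (Fin m) := mfderiv (𝓡 m) 𝓘(ℝ, EuclideanSpace ℝ (Fin m)) e x v
  fderiv ℝ (fun z => chartMetric g x z u' v') z₀ (chartField X x z₀)
    + chartMetric g x z₀ (fderiv ℝ (chartField X x) z₀ u') v'
    + chartMetric g x z₀ u' (fderiv ℝ (chartField X x) z₀ v')

/-- The vector field `X` is Killing: `L_X g = 0`. -/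
def IsKilling (X : ∀ x : M, TangentSpace (𝓡 m) x) : Prop :=
  ∀ (x : M) (u v : TangentSpace (𝓡 m) x), lieDerivMetric g X x u v = 0

/-- The space `Γ₀(TM)` of smooth divergenceless vector fields with compact support. -/
structure IsSolenoidal (X : ∀ x : M, TangentSpace (𝓡 m) x) : Prop where
  smooth : ContMDiff (𝓡 m) (𝓡 m).tangent ∞
    (fun x => (⟨x, X x⟩ : TangentBundle (𝓡 m) M))
  compact_support : IsCompact (closure {x | X x ≠ 0})
  divergence_eq_zero : ∀ x, divergence g X x = 0

/-- The squared `L²` norm `∫ ⟨A, A⟩_g vol_g` of a field of `(0,2)` tensors. -/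
def tensorNormSq [MeasurableSpace M] (A : ∀ x : M, Tensor02 m x) : ℝ :=
  ∫ x, tensorInner g x (A x) (A x) ∂(riemannianVolume g)

/-! ### Volume preserving diffeomorphisms -/

/-- `SDiff(M, g)`: the volume preserving diffeomorphisms of `M` with compact support. -/
structure IsSDiff [MeasurableSpace M] (ψ : M → M) : Prop where
  diffeo : ∃ Φ : M ≃ₘ^∞⟮𝓡 m, 𝓡 m⟯ M, (Φ : M → M) = ψ
  compact_support : IsCompact (closure {x | ψ x ≠ x})
  volume_preserving : MeasurePreserving ψ (riemannianVolume g) (riemannianVolume g)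

/-- Smooth families in `SDiff(M, g)` parametrized by a vector space `P`, passing through the
identity at the parameter `0`. Smoothness in this group of compactly supported diffeomorphisms
means joint smoothness, with supports contained, locally in the parameter, in a fixed compact
set. For `P = ℝ` these are the smooth curves through the identity, for `P = ℝ × ℝ` the
two-parameter variations of the identity. -/
structure IsSDiffVariation [MeasurableSpace M] {P : Type*} [NormedAddCommGroup P]
    [NormedSpace ℝ P] (ψ : P → M → M) : Prop where
  mem_sdiff : ∀ p, IsSDiff g (ψ p)
  at_zero : ∀ x, ψ 0 x = x
  smooth : ContMDiff (𝓘(ℝ, P).prod (𝓡 m)) (𝓡 m) ∞ (fun q : P × M => ψ q.1 q.2)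
  locally_compact_support : ∀ p₀ : P, ∃ K : Set M, IsCompact K ∧
    ∀ᶠ p in 𝓝 p₀, ∀ x ∉ K, ψ p x = x

/-- The two-parameter family `ψ` is tangent to `X` and `Y`: at `s = t = 0`, `∂_s ψ_{s,t} = X` and
`∂_t ψ_{s,t} = Y`. -/
def IsTangentTo (ψ : ℝ × ℝ → M → M) (X Y : ∀ x : M, TangentSpace (𝓡 m) x) : Prop :=
  ∀ x : M,
    mfderiv 𝓘(ℝ, ℝ) (𝓡 m) (fun s : ℝ => ψ (s, 0) x) 0 (1 : ℝ) = X (ψ (0, 0) x) ∧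
    mfderiv 𝓘(ℝ, ℝ) (𝓡 m) (fun t : ℝ => ψ (0, t) x) 0 (1 : ℝ) = Y (ψ (0, 0) x)

/-! ### The Dirichlet energy and restricted harmonic maps -/

variable {n : ℕ} {N : Type*} [TopologicalSpace N] [ChartedSpace (EuclideanSpace ℝ (Fin n)) N]
  [IsManifold (𝓡 n) ∞ N] (h : SmoothMetric n N)

/-- The pullback `φ^* h`. -/
def pullbackMetric (φ : M → N) (x : M) : Tensor02 m x := fun u v =>
  h.inner (φ x) (mfderiv (𝓡 m) (𝓡 n) φ x u) (mfderiv (𝓡 m) (𝓡 n) φ x v)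

/-- `φ` is weakly conformal: `φ^* h = λ g` for some real function `λ`. -/
def IsWeaklyConformal (φ : M → N) : Prop :=
  ∃ l : M → ℝ, ∀ (x : M) (u v : TangentSpace (𝓡 m) x),
    pullbackMetric h φ x u v = l x * g.inner x u v

/-- The energy density `|dφ|² = ∑ h(dφ e_i, dφ e_i)`. -/
def normSqDeriv (φ : M → N) (x : M) : ℝ :=
  metricTrace g x (pullbackMetric h φ x)

/-- The Dirichlet energy `E₂(φ)` is finite. -/
def HasFiniteEnergy [MeasurableSpace M] (φ : M → N) : Prop :=
  Integrable (normSqDeriv g h φ) (riemannianVolume g)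

/-- The Dirichlet energy `E₂(φ) = ½ ∫ |dφ|² vol_g`. -/
def dirichletEnergy [MeasurableSpace M] (φ : M → N) : ℝ :=
  (1 / 2) * ∫ x, normSqDeriv g h φ x ∂(riemannianVolume g)

/-- `φ` is restricted harmonic: it is smooth, `E₂(φ)` is finite, and `E₂(φ ∘ ψ_t)` is critical at
`t = 0` for every smooth curve `ψ_t` in `SDiff(M, g)` through the identity. -/
structure IsRestrictedHarmonic [MeasurableSpace M] (φ : M → N) : Prop where
  smooth : ContMDiff (𝓡 m) (𝓡 n) ∞ φ
  finite_energy : HasFiniteEnergy g h φ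
  critical : ∀ ψ : ℝ → M → M, IsSDiffVariation g ψ →
    HasDerivAt (fun t => dirichletEnergy g h (φ ∘ ψ t)) 0 0

/-- The mixed second derivative `∂²F/∂s∂t` at `s = t = 0` exists and equals `c`. -/
def HasMixedDerivAtZero (F : ℝ × ℝ → ℝ) (c : ℝ) : Prop :=
  ∃ G : ℝ → ℝ, (∀ᶠ s in 𝓝 (0 : ℝ), HasDerivAt (fun t => F (s, t)) (G s) 0) ∧ HasDerivAt G c 0

/-- The hessian of `E₂` at `φ` takes the value `c` on `(X, Y)`: the mixed second derivative of
`E₂(φ ∘ ψ_{s,t})` at `s = t = 0` is `c`, for whichever two-parameter variation `ψ_{s,t}` of the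
identity in `SDiff(M, g)` tangent to `X, Y` it is computed with. -/
def HasHessian [MeasurableSpace M] (φ : M → N) (X Y : ∀ x : M, TangentSpace (𝓡 m) x)
    (c : ℝ) : Prop :=
  ∀ ψ : ℝ × ℝ → M → M, IsSDiffVariation g ψ → IsTangentTo ψ X Y →
    HasMixedDerivAtZero (fun p => dirichletEnergy g h (φ ∘ ψ p)) c

/-- `φ` is a stable restricted harmonic map: `Hess(X, X) ≥ 0` for all `X` in `Γ₀(TM)`. -/
def IsStableRestrictedHarmonic [MeasurableSpace M] (φ : M → N) : Prop :=
  IsRestrictedHarmonic g h φ ∧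
    ∀ X : ∀ x : M, TangentSpace (𝓡 m) x, IsSolenoidal g X → ∃ c : ℝ, 0 ≤ c ∧ HasHessian g h φ X X c

/-- The critical points of `φ`: the zeros of `dφ`. -/
def criticalSet (φ : M → N) : Set M :=
  {x | ∀ u : TangentSpace (𝓡 m) x, mfderiv (𝓡 m) (𝓡 n) φ x u = 0}

end Riemannian

/-! ### Inverse stereographic projection -/

section Induced

variable {m : ℕ} {M : Type*} [TopologicalSpace M] [ChartedSpace (EuclideanSpace ℝ (Fin m)) M]
  [IsManifold (𝓡 m) ∞ M] {F : Type*} [NormedAddCommGroup F] [InnerProductSpace ℝ F]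

/-- The derivative at `x` of a map into a vector space, as a linear map into this space. -/
def derivInto (ι : M → F) (x : M) : EuclideanSpace ℝ (Fin m) →L[ℝ] F :=
  mfderiv (𝓡 m) 𝓘(ℝ, F) ι x

theorem isVonNBounded_induced (L : EuclideanSpace ℝ (Fin m) →L[ℝ] F)
    (hL : Function.Injective L) :
    Bornology.IsVonNBounded ℝ {v : EuclideanSpace ℝ (Fin m) | inner ℝ (L v) (L v) < 1} := by
  obtain ⟨K, -, hK⟩ := (L : EuclideanSpace ℝ (Fin m) →ₗ[ℝ] F).exists_antilipschitzWith
    (LinearMap.ker_eq_bot.2 hL)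
  rw [NormedSpace.isVonNBounded_iff']
  refine ⟨K * 1, fun v hv => ?_⟩
  have h1 : ‖L v‖ ≤ 1 := by
    have h2 : ‖L v‖ * ‖L v‖ < 1 := by
      rw [← real_inner_self_eq_norm_mul_norm]; exact hv
    nlinarith [norm_nonneg (L v)]
  have h3 : ‖v‖ ≤ K * ‖L v‖ := by
    have := hK.le_mul_dist v 0
    simpa using this
  exact h3.trans (by gcongr)

/-- The pullback of the inner product of `F` under `ι`. -/
def inducedForm (ι : M → F) (x : M) :
    TangentSpace (𝓡 m) x →L[ℝ] TangentSpace (𝓡 m) x →L[ℝ] ℝ :=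
  ((innerSL ℝ : F →L[ℝ] F →L[ℝ] ℝ).bilinearComp (derivInto ι x) (derivInto ι x) :
    EuclideanSpace ℝ (Fin m) →L[ℝ] EuclideanSpace ℝ (Fin m) →L[ℝ] ℝ)

theorem contMDiff_inducedForm (ι : M → F) (hι : ContMDiff (𝓡 m) 𝓘(ℝ, F) ∞ ι) :
    ContMDiff (𝓡 m) ((𝓡 m).prod 𝓘(ℝ, EuclideanSpace ℝ (Fin m) →L[ℝ]
      EuclideanSpace ℝ (Fin m) →L[ℝ] ℝ)) ∞
      (fun x : M => Bundle.TotalSpace.mk' (EuclideanSpace ℝ (Fin m) →L[ℝ]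
        EuclideanSpace ℝ (Fin m) →L[ℝ] ℝ) (E := fun x : M => TangentSpace (𝓡 m) x →L[ℝ]
          TangentSpace (𝓡 m) x →L[ℝ] ℝ) x (inducedForm ι x)) := by
  intro x₀
  have key : ContMDiffAt (𝓡 m) 𝓘(ℝ, EuclideanSpace ℝ (Fin m) →L[ℝ] F) ∞
      (inTangentCoordinates (𝓡 m) 𝓘(ℝ, F) id ι (derivInto ι) x₀) x₀ :=
    ContMDiffAt.mfderiv_const (hι x₀) (by simp)
  let B : F →L[ℝ] F →L[ℝ] ℝ := innerSL ℝ
  have hB : ContDiff ℝ ∞ (fun L : EuclideanSpace ℝ (Fin m) →L[ℝ] F => B.bilinearComp L L) := by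
    have : (fun L : EuclideanSpace ℝ (Fin m) →L[ℝ] F => B.bilinearComp L L) =
        fun L => ((ContinuousLinearMap.compL ℝ (EuclideanSpace ℝ (Fin m)) F ℝ).flip L).comp
          (B.comp L) := by
      ext; rfl
    rw [this]
    fun_prop
  have h2 := hB.contMDiff.contMDiffAt.comp x₀ key
  refine (Bundle.contMDiffAt_section _).2 (h2.congr_of_eventuallyEq ?_)
  filter_upwards [(trivializationAt (EuclideanSpace ℝ (Fin m))
    (fun x : M => TangentSpace (𝓡 m) x) x₀).open_baseSet.mem_nhds
    (FiberBundle.mem_baseSet_trivializationAt' x₀)] with x hx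
  ext v w
  rw [hom_trivializationAt_apply]
  have e1 : ∀ v, inTangentCoordinates (𝓡 m) 𝓘(ℝ, F) id ι (derivInto ι) x₀ x v =
      derivInto ι x ((trivializationAt (EuclideanSpace ℝ (Fin m))
        (fun x : M => TangentSpace (𝓡 m) x) x₀).symm x v) := by
    intro v
    simp [inTangentCoordinates, ContinuousLinearMap.inCoordinates]
    exact congrArg (derivInto ι x) (Bundle.Trivialization.symmL_apply _ hx v)
  refine (inCoordinates_apply_eq₂ hx hx (Set.mem_univ _)).trans ?_
  simp only [Function.comp_apply, ContinuousLinearMap.bilinearComp_apply, e1]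
  simp
  rfl

/-- The Riemannian metric induced on `M` by an immersion `ι` into an inner product space. -/
def inducedMetric (ι : M → F) (hι : ContMDiff (𝓡 m) 𝓘(ℝ, F) ∞ ι)
    (hinj : ∀ x, Function.Injective (derivInto (m := m) ι x)) : SmoothMetric m M where
  inner := inducedForm ι
  symm _ _ _ := real_inner_comm _ _
  pos x _ hv := real_inner_self_pos.2 fun h0 => hv (hinj x (h0.trans (map_zero _).symm))
  isVonNBounded x := isVonNBounded_induced (derivInto ι x) (hinj x)
  contMDiff := contMDiff_inducedForm ι hι

end Induced

/-- The Euclidean metric of `ℝ^m`. -/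
def euclideanMetric (m : ℕ) : SmoothMetric m (EuclideanSpace ℝ (Fin m)) :=
  inducedMetric (fun x => x) contMDiff_id fun x => by
    have : derivInto (m := m) (fun x : EuclideanSpace ℝ (Fin m) => x) x =
        ContinuousLinearMap.id ℝ _ := mfderiv_id
    rw [this]
    exact Function.injective_id

/-- The round metric of the unit sphere `S^n` in `ℝ^(n+1)`. -/
def roundMetric (n : ℕ) :
    SmoothMetric n (Metric.sphere (0 : EuclideanSpace ℝ (Fin (n + 1))) 1) :=
  haveI : Fact (Module.finrank ℝ (EuclideanSpace ℝ (Fin (n + 1))) = n + 1) := ⟨by simp⟩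
  inducedMetric (fun x => (x : EuclideanSpace ℝ (Fin (n + 1)))) contMDiff_coe_sphere
    injective_mvfderiv_subtypeVal_sphere

/-- Inverse stereographic projection `ℝ³ → S³`,
`x ↦ (|x|² - 1, 2x) / (|x|² + 1)`. -/
def inverseStereographic (x : EuclideanSpace ℝ (Fin 3)) :
    Metric.sphere (0 : EuclideanSpace ℝ (Fin (3 + 1))) 1 :=
  ⟨(‖x‖ ^ 2 + 1)⁻¹ • !₂[‖x‖ ^ 2 - 1, 2 * x 0, 2 * x 1, 2 * x 2], by
    rw [mem_sphere_zero_iff_norm, ← sq_eq_sq₀ (norm_nonneg _) zero_le_one, norm_smul, mul_pow,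
      EuclideanSpace.norm_sq_eq, EuclideanSpace.norm_sq_eq]
    simp [Fin.sum_univ_four, Fin.sum_univ_three]
    have : x 0 ^ 2 + x 1 ^ 2 + x 2 ^ 2 + 1 ≠ 0 := by positivity
    field_simp
    ring⟩

end

/-! ### Determinants and traces along families of matrices -/

section MatrixCalculus

variable {m : ℕ}

/-! Write φ^*h = l g. Tracing gives l = |dφ|²/m when m ≥ 1, so l is smooth; in dimension 0 one may
take l = 0. For a volume preserving ψ the chain rule gives (φ∘ψ)^*h = (l∘ψ) ψ^*g, and therefore
|d(φ∘ψ)|² = (l∘ψ)(tr_g ψ^*g − m) + |dφ|²∘ψ. The last term has the same integral as |dφ|². So E₂(φ∘ψ)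
− E₂(φ) is half the integral of l∘ψ times the strain trace tr_g ψ^*g − m
(`IsSDiffVariation.dirichletEnergy_comp`). This integrand has compact support, so differentiating
under the integral is harmless even if M is not compact.

What remains is linear algebra at each point. Let H(s,t) be the matrix of ψ_{s,t}^*g at a point, and
G = H(0,0). Volume preservation makes det H constant (`IsSDiff.det_pullbackForm`), so Jacobi's
formula gives tr(H⁻¹ ∂_t H) = 0. At the identity this says that the strain trace vanishes to first
order, whence φ is restricted harmonic. Differentiating the same identity in s gives tr(G⁻¹ ∂_s∂_t
H) = tr(G⁻¹ L G⁻¹ L), where L = L_X g is the common first derivative of H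
(`hasDerivAt_trace_of_det_const`, `hasDerivAt_pullbackForm`). The right side is |L_X g|², and the
acceleration of ψ has disappeared, which is why the hessian does not depend on the variation.
Derivatives of l∘ψ multiply terms that vanish, so Hess(X,X) = ½ ∫ l |L_X g|², and l |L_X g|² = f²
|L_X g|² ≥ 0.

The equality case holds because the integrand is continuous and nonnegative and the volume charges
every nonempty open set.

Two foundational points need work. The volume is a supremum of chart measures, so invariance of this
measure has to be turned into a pointwise identity of densities (`abs_det_mul_chartDensity_eq`).
Tangent spaces are identified with the model space through a chart that depends on the point, so
traces, norms and the Lie derivative have to be moved to the frame of one fixed chart before their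
regularity can be seen.

Inverse stereographic projection has conformal factor 4/(1+|x|²)², and the energy density
12/(1+|x|²)² is integrable on ℝ³. -/

theorem contDiff_det_of : ContDiff ℝ ∞
    (fun A : Fin m → Fin m → ℝ => (Matrix.of A).det) := by
  simp only [Matrix.det_apply, Matrix.of_apply]
  fun_prop

theorem contDiff_det_matrix {V : Type*} [NormedAddCommGroup V] [NormedSpace ℝ V]
    {H : V → Matrix (Fin m) (Fin m) ℝ} {s : Set V}
    (hH : ∀ i j, ContDiffOn ℝ ∞ (fun p => H p i j) s) : ContDiffOn ℝ ∞ (fun p => (H p).det) s := by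
  have h1 : ContDiffOn ℝ ∞ (fun p => fun i j => H p i j) s :=
    contDiffOn_pi.2 fun i => contDiffOn_pi.2 fun j => hH i j
  exact contDiff_det_of.comp_contDiffOn h1

/-- Jacobi's formula. The derivative of det along H depends only on the tangent H', so H may be
replaced by the line H t + s H'. There det factors as det (H t) · det(1 + sK) with K = (H t)⁻¹ H',
and det(1 + sK) = 1 + s tr K + O(s²). -/
theorem hasDerivAt_det {H : ℝ → Matrix (Fin m) (Fin m) ℝ} {H' : Matrix (Fin m) (Fin m) ℝ} {t : ℝ}
    (hH : ∀ i j, HasDerivAt (fun s => H s i j) (H' i j) t) (h0 : (H t).det ≠ 0) :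
    HasDerivAt (fun s => (H s).det) ((H t).det * ((H t)⁻¹ * H').trace) t := by
  let D : (Fin m → Fin m → ℝ) → ℝ := fun A => (Matrix.of A).det
  have hD : HasFDerivAt D (fderiv ℝ D (fun i j => H t i j)) (fun i j => H t i j) :=
    (contDiff_det_of.differentiable (by simp)).differentiableAt.hasFDerivAt
  have h1 : HasDerivAt (fun s => fun i j => H s i j) (fun i j => H' i j) t :=
    hasDerivAt_pi.2 fun i => hasDerivAt_pi.2 fun j => hH i j
  have h2 : HasDerivAt (fun s => (H s).det) (fderiv ℝ D (fun i j => H t i j) fun i j => H' i j) t :=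
    hD.comp_hasDerivAt t h1
  let γ : ℝ → Fin m → Fin m → ℝ := fun s i j => H t i j + s * H' i j
  have hγ : HasDerivAt γ (fun i j => H' i j) 0 :=
    hasDerivAt_pi.2 fun i => hasDerivAt_pi.2 fun j => by
      simpa [γ] using ((hasDerivAt_id (0 : ℝ)).mul_const (H' i j)).const_add (H t i j)
  have h3 : HasDerivAt (fun s => D (γ s)) (fderiv ℝ D (fun i j => H t i j) fun i j => H' i j) 0 := by
    have : γ 0 = fun i j => H t i j := by ext; simp [γ]
    rw [← this] at hD ⊢
    exact hD.comp_hasDerivAt 0 hγ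
  have hu : IsUnit (H t).det := isUnit_iff_ne_zero.2 h0
  have h4 : (fun s => D (γ s)) = fun s => (H t).det * (1 + s • ((H t)⁻¹ * H')).det := by
    ext s
    rw [← Matrix.det_mul, mul_add, mul_one, mul_smul_comm, Matrix.mul_nonsing_inv_cancel_left _ _ hu]
    rfl
  rw [h4] at h3
  have h5 : HasDerivAt (fun s : ℝ => (1 + s • ((H t)⁻¹ * H')).det) ((H t)⁻¹ * H').trace 0 := by
    rw [funext fun s : ℝ => Matrix.det_one_add_smul s ((H t)⁻¹ * H')]
    have h6 := (((hasDerivAt_id (0 : ℝ)).const_mul ((H t)⁻¹ * H').trace).const_add 1).add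
      (((Matrix.det (1 + (Polynomial.X : Polynomial ℝ) •
        ((H t)⁻¹ * H').map Polynomial.C)).divX.divX.hasDerivAt 0).mul
        ((hasDerivAt_id (0 : ℝ)).pow 2))
    refine HasDerivAt.congr_deriv h6 ?_
    simp
  rw [(h3.unique (h5.const_mul _)).symm]
  exact h2

/-- The infinitesimal form of volume preservation: for ψ^*g it says that the derivative is trace
free. -/
theorem trace_inv_mul_deriv_eq_zero {H : ℝ → Matrix (Fin m) (Fin m) ℝ}
    {H' : Matrix (Fin m) (Fin m) ℝ} {t d : ℝ}
    (hH : ∀ i j, HasDerivAt (fun s => H s i j) (H' i j) t) (hd : ∀ s, (H s).det = d) (h0 : d ≠ 0) :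
    ((H t)⁻¹ * H').trace = 0 := by
  have h1 := hasDerivAt_det hH (by rwa [hd])
  simp_rw [hd] at h1
  have := h1.unique (hasDerivAt_const t d)
  simpa [h0] using this

theorem hasDerivAt_matrix_mul {A B : ℝ → Matrix (Fin m) (Fin m) ℝ}
    {A' B' : Matrix (Fin m) (Fin m) ℝ} {t : ℝ}
    (hA : ∀ i j, HasDerivAt (fun s => A s i j) (A' i j) t)
    (hB : ∀ i j, HasDerivAt (fun s => B s i j) (B' i j) t) (i j : Fin m) :
    HasDerivAt (fun s => (A s * B s) i j) ((A' * B t + A t * B') i j) t := by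
  simp only [Matrix.mul_apply, Matrix.add_apply, ← Finset.sum_add_distrib]
  exact HasDerivAt.fun_sum fun k _ => (hA i k).mul (hB k j)

theorem hasDerivAt_trace {A : ℝ → Matrix (Fin m) (Fin m) ℝ}
    {A' : Matrix (Fin m) (Fin m) ℝ} {t : ℝ}
    (hA : ∀ i j, HasDerivAt (fun s => A s i j) (A' i j) t) :
    HasDerivAt (fun s => (A s).trace) A'.trace t := by
  simp only [Matrix.trace, Matrix.diag_apply]
  exact HasDerivAt.fun_sum fun k _ => hA k k

/-- Cramer's rule shows that the entries of the inverse are differentiable; differentiating H⁻¹ H =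
1 then identifies the derivative. -/
theorem hasDerivAt_matrix_inv {H : ℝ → Matrix (Fin m) (Fin m) ℝ}
    {H' : Matrix (Fin m) (Fin m) ℝ} {t : ℝ} (hu : ∀ s, IsUnit (H s).det)
    (hH : ∀ i j, HasDerivAt (fun s => H s i j) (H' i j) t) (i j : Fin m) :
    HasDerivAt (fun s => (H s)⁻¹ i j) ((-((H t)⁻¹ * H' * (H t)⁻¹)) i j) t := by
  have hdet := hasDerivAt_det hH (hu t).ne_zero
  have hadj : ∀ i j, DifferentiableAt ℝ (fun s => (H s).adjugate i j) t := by
    intro i j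
    simp only [Matrix.adjugate_apply]
    have h1 : DifferentiableAt ℝ (fun s => fun k l => (H s).updateRow j (Pi.single i 1) k l) t := by
      refine differentiableAt_pi.2 fun k => differentiableAt_pi.2 fun l => ?_
      by_cases hk : k = j
      · subst hk; simp
      · simpa [Matrix.updateRow_ne hk] using (hH k l).differentiableAt
    exact (contDiff_det_of.differentiable (by simp)).differentiableAt.comp t h1
  have hdiff : ∀ i j, DifferentiableAt ℝ (fun s => (H s)⁻¹ i j) t := by
    intro i j
    simp only [Matrix.inv_def, Matrix.smul_apply, Ring.inverse_eq_inv', smul_eq_mul]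
    exact (hdet.differentiableAt.inv (hu t).ne_zero).mul (hadj i j)
  let K' : Matrix (Fin m) (Fin m) ℝ := Matrix.of fun i j => deriv (fun s => (H s)⁻¹ i j) t
  have hK : ∀ i j, HasDerivAt (fun s => (H s)⁻¹ i j) (K' i j) t := fun i j => (hdiff i j).hasDerivAt
  have h1 := hasDerivAt_matrix_mul hK hH
  have h2 : K' * H t + (H t)⁻¹ * H' = 0 := by
    ext i j
    have h3 := h1 i j
    simp_rw [Matrix.nonsing_inv_mul _ (hu _)] at h3
    exact h3.unique (hasDerivAt_const t _)
  have h4 : K' = -((H t)⁻¹ * H' * (H t)⁻¹) := by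
    rw [← Matrix.mul_nonsing_inv_cancel_right (H t) K' (hu t), eq_neg_of_add_eq_zero_left h2, neg_mul]
  rw [← h4]
  exact hK i j

/-- The second variation of the trace of a two-parameter family of matrices with constant
determinant. -/
theorem hasDerivAt_trace_of_det_const {H : ℝ × ℝ → Matrix (Fin m) (Fin m) ℝ}
    {L : Matrix (Fin m) (Fin m) ℝ} {d : ℝ}
    (hH : ∀ i j, ContDiff ℝ ∞ fun p => H p i j) (hd : ∀ p, (H p).det = d) (h0 : d ≠ 0)
    (hs : ∀ i j, HasDerivAt (fun s => H (s, 0) i j) (L i j) 0)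
    (ht : ∀ i j, HasDerivAt (fun t => H (0, t) i j) (L i j) 0) :
    HasDerivAt (fun s => deriv (fun t => ((H 0)⁻¹ * H (s, t)).trace) 0)
      ((H 0)⁻¹ * L * (H 0)⁻¹ * L).trace 0 := by
  let T : ℝ → Matrix (Fin m) (Fin m) ℝ := fun s =>
    Matrix.of fun i j => deriv (fun t => H (s, t) i j) 0
  have hT : ∀ s i j, HasDerivAt (fun t => H (s, t) i j) (T s i j) 0 := fun s i j =>
    (DifferentiableAt.comp (g := fun p => H p i j) (0 : ℝ)
      ((hH i j).differentiable (by simp)).differentiableAt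
      (f := fun t : ℝ => (s, t)) (by fun_prop)).hasDerivAt
  have hT0 : T 0 = L := by
    ext i j
    exact (hT 0 i j).unique (ht i j)
  have hTd : ∀ i j, DifferentiableAt ℝ (fun s => T s i j) 0 := by
    intro i j
    have h1 : (fun s => T s i j) = fun s => fderiv ℝ (fun p => H p i j) (s, 0) (0, 1) := by
      ext s
      have h2 : HasDerivAt (fun t : ℝ => (s, t)) ((0 : ℝ), (1 : ℝ)) 0 :=
        (hasDerivAt_const (0 : ℝ) s).prodMk (hasDerivAt_id (0 : ℝ))
      exact (hT s i j).unique ((((hH i j).differentiable (by simp)) (s, 0)).hasFDerivAt.comp_hasDerivAt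
        (0 : ℝ) h2)
    rw [h1]
    have h3 : ContDiff ℝ ∞ (fun p => fderiv ℝ (fun p => H p i j) p (0, 1)) :=
      ((hH i j).fderiv_right (m := ∞) (by simp)).clm_apply contDiff_const
    exact DifferentiableAt.comp (g := fun p => fderiv ℝ (fun p => H p i j) p (0, 1)) (0 : ℝ)
      (h3.differentiable (by simp)).differentiableAt (f := fun s : ℝ => (s, (0 : ℝ))) (by fun_prop)
  let U : Matrix (Fin m) (Fin m) ℝ := Matrix.of fun i j => deriv (fun s => T s i j) 0
  have hU : ∀ i j, HasDerivAt (fun s => T s i j) (U i j) 0 := fun i j => (hTd i j).hasDerivAt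
  have hu : ∀ p, IsUnit (H p).det := fun p => by rw [hd]; exact isUnit_iff_ne_zero.2 h0
  have hconst : ∀ {V : ℝ → Matrix (Fin m) (Fin m) ℝ} {V' : Matrix (Fin m) (Fin m) ℝ} {t : ℝ},
      (∀ i j, HasDerivAt (fun s => V s i j) (V' i j) t) →
      HasDerivAt (fun s => ((H 0)⁻¹ * V s).trace) ((H 0)⁻¹ * V').trace t := by
    intro V V' t hV
    have := hasDerivAt_trace (hasDerivAt_matrix_mul (A := fun _ => (H 0)⁻¹) (A' := 0)
      (fun i j => hasDerivAt_const _ _) hV)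
    simpa using this
  have e1 : (fun s => deriv (fun t => ((H 0)⁻¹ * H (s, t)).trace) 0) =
      fun s => ((H 0)⁻¹ * T s).trace := by
    ext s
    exact (hconst (hT s)).deriv
  rw [e1]
  -- Jacobi's formula in t holds at every s. Differentiating it in s trades the unknown second
  -- derivative `U` for a term quadratic in `L`.
  have e2 : ∀ s, ((H (s, 0))⁻¹ * T s).trace = 0 := fun s =>
    trace_inv_mul_deriv_eq_zero (H := fun t => H (s, t)) (hT s) (fun t => hd _) h0
  have e3 := hasDerivAt_trace (hasDerivAt_matrix_mul
    (hasDerivAt_matrix_inv (H := fun s => H (s, 0)) (fun s => hu _) hs) hU)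
  simp_rw [e2] at e3
  have e4 := e3.unique (hasDerivAt_const (0 : ℝ) (0 : ℝ))
  rw [hT0] at e4
  have e5 : ((H 0)⁻¹ * L * (H 0)⁻¹ * L).trace = ((H 0)⁻¹ * U).trace := by
    rw [Matrix.trace_add, neg_mul, Matrix.trace_neg] at e4
    have : H (0, 0) = H 0 := rfl
    rw [this] at e4
    linarith
  rw [e5]
  exact hconst hU

end MatrixCalculus

/-! ### Mixed second derivatives of products -/

section MixedDerivative

/-- The mixed second derivative of a product one of whose factors vanishes to second order. -/
theorem deriv_deriv_mul_of_critical {a b : ℝ × ℝ → ℝ} {c : ℝ} (ha : ContDiff ℝ ∞ a)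
    (hb : ContDiff ℝ ∞ b) (h0 : b 0 = 0) (hs : HasDerivAt (fun s => b (s, 0)) 0 0)
    (ht : HasDerivAt (fun t => b (0, t)) 0 0)
    (hst : HasDerivAt (fun s => deriv (fun t => b (s, t)) 0) c 0) :
    deriv (fun s => deriv (fun t => a (s, t) * b (s, t)) 0) 0 = a 0 * c := by
  have hd : ∀ {a : ℝ × ℝ → ℝ}, ContDiff ℝ ∞ a → ∀ s,
      DifferentiableAt ℝ (fun t => a (s, t)) 0 := fun {a} ha s =>
    DifferentiableAt.comp (g := a) (0 : ℝ) (ha.differentiable (by simp)).differentiableAt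
      (f := fun t : ℝ => (s, t)) (by fun_prop)
  have e1 : ∀ s, deriv (fun t => a (s, t) * b (s, t)) 0 =
      deriv (fun t => a (s, t)) 0 * b (s, 0) + a (s, 0) * deriv (fun t => b (s, t)) 0 := fun s =>
    ((hd ha s).hasDerivAt.mul (hd hb s).hasDerivAt).deriv
  simp_rw [e1]
  have ha1 : DifferentiableAt ℝ (fun s => a (s, 0)) 0 :=
    DifferentiableAt.comp (g := a) (0 : ℝ) (ha.differentiable (by simp)).differentiableAt
      (f := fun s : ℝ => (s, (0 : ℝ))) (by fun_prop)
  have ha2 : DifferentiableAt ℝ (fun s => deriv (fun t => a (s, t)) 0) 0 := by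
    have h1 : (fun s => deriv (fun t => a (s, t)) 0) = fun s => fderiv ℝ a (s, 0) (0, 1) := by
      ext s
      have h2 : HasDerivAt (fun t : ℝ => (s, t)) ((0 : ℝ), (1 : ℝ)) 0 :=
        (hasDerivAt_const (0 : ℝ) s).prodMk (hasDerivAt_id (0 : ℝ))
      exact ((ha.differentiable (by simp) (s, 0)).hasFDerivAt.comp_hasDerivAt (0 : ℝ) h2).deriv
    rw [h1]
    have h3 : ContDiff ℝ ∞ (fun p => fderiv ℝ a p (0, 1)) :=
      (ha.fderiv_right (m := ∞) (by simp)).clm_apply contDiff_const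
    exact DifferentiableAt.comp (g := fun p => fderiv ℝ a p (0, 1)) (0 : ℝ)
      (h3.differentiable (by simp)).differentiableAt (f := fun s : ℝ => (s, (0 : ℝ))) (by fun_prop)
  -- Of the four Leibniz terms, those containing b, ∂_s b or ∂_t b at the origin vanish; only a
  -- ∂_s∂_t b survives.
  have h3 := ((ha2.hasDerivAt.mul hs).add (ha1.hasDerivAt.mul hst)).deriv
  have hb0 : b (0, 0) = 0 := h0
  rw [ht.deriv] at h3
  simp only [hb0, mul_zero, add_zero, zero_add] at h3
  exact h3

end MixedDerivative

/-! ### Differentiation under the integral sign -/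

section ParametricIntegral

variable {V : Type*} [NormedAddCommGroup V] [NormedSpace ℝ V] {H : Type*} [TopologicalSpace H]
  {I : ModelWithCorners ℝ V H} {Q : Type*} [TopologicalSpace Q] [ChartedSpace H Q]

theorem contMDiff_deriv_fst [IsManifold I ∞ Q] {w : ℝ × Q → ℝ}
    (hw : ContMDiff (𝓘(ℝ, ℝ).prod I) 𝓘(ℝ, ℝ) ∞ w) :
    ContMDiff (𝓘(ℝ, ℝ).prod I) 𝓘(ℝ, ℝ) ∞ fun q : ℝ × Q => deriv (fun t => w (t, q.2)) q.1 := by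
  intro q₀
  have h1 : ContMDiff ((𝓘(ℝ, ℝ).prod I).prod 𝓘(ℝ, ℝ)) 𝓘(ℝ, ℝ) ∞
      (Function.uncurry fun (q : ℝ × Q) (t : ℝ) => w (t, q.2)) :=
    hw.comp (contMDiff_snd.prodMk (contMDiff_snd.comp contMDiff_fst))
  have h2 := (h1 (q₀, q₀.1)).mfderiv (m := ∞) (fun (q : ℝ × Q) (t : ℝ) => w (t, q.2)) Prod.fst
    contMDiffAt_fst (by simp)
  -- Both sides of the map t ↦ w(t, x) are the vector space ℝ, where tangent coordinates are
  -- trivial, so the manifold derivative is the ordinary one.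
  have e := inTangentCoordinates_model_space (I := 𝓘(ℝ, ℝ)) (I' := 𝓘(ℝ, ℝ)) (Prod.fst : ℝ × Q → ℝ)
    (fun q => w (q.1, q.2)) (fun q => fderiv ℝ (fun t => w (t, q.2)) q.1) q₀
  simp only [mfderiv_eq_fderiv] at h2
  have h2' : ContMDiffAt (𝓘(ℝ, ℝ).prod I) 𝓘(ℝ, ℝ →L[ℝ] ℝ) ∞
    (fun q : ℝ × Q => fderiv ℝ (fun t => w (t, q.2)) q.1) q₀ := e ▸ h2
  have h3 := h2'.clm_apply (contMDiffAt_const (c := (1 : ℝ)))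
  exact h3

variable [MeasurableSpace Q] [BorelSpace Q] [T2Space Q]
  {μ : Measure Q} [IsFiniteMeasureOnCompacts μ]

theorem integrable_of_continuous_of_eq_zero_off {f : Q → ℝ} (hf : Continuous f) {K : Set Q}
    (hK : IsCompact K) (h0 : ∀ x ∉ K, f x = 0) : Integrable f μ :=
  hf.integrable_of_hasCompactSupport (HasCompactSupport.intro hK h0)

/-- Dominated convergence with bound C on K and 0 off K: C bounds the time derivative on the compact
set [−ε/2, ε/2] × K, and off K the integrand vanishes identically near each such time. -/
theorem hasDerivAt_integral_of_contMDiff [IsManifold I ∞ Q] {w : ℝ × Q → ℝ}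
    (hw : ContMDiff (𝓘(ℝ, ℝ).prod I) 𝓘(ℝ, ℝ) ∞ w) {K : Set Q} (hK : IsCompact K)
    (h0 : ∀ᶠ t in 𝓝 (0 : ℝ), ∀ x ∉ K, w (t, x) = 0) :
    HasDerivAt (fun t => ∫ x, w (t, x) ∂μ) (∫ x, deriv (fun t => w (t, x)) 0 ∂μ) 0 := by
  obtain ⟨ε, hε, hball⟩ := Metric.eventually_nhds_iff_ball.1 h0
  have hdc : Continuous fun q : ℝ × Q => deriv (fun t => w (t, q.2)) q.1 :=
    (contMDiff_deriv_fst hw).continuous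
  obtain ⟨C, hC⟩ := ((isCompact_closedBall (0 : ℝ) (ε / 2)).prod hK).exists_bound_of_continuousOn
    hdc.continuousOn
  have hsub : Metric.ball (0 : ℝ) (ε / 2) ⊆ Metric.ball 0 ε := Metric.ball_subset_ball (by linarith)
  have hslice : ∀ t, Continuous fun x => w (t, x) := fun t => hw.continuous.comp (by fun_prop)
  refine (hasDerivAt_integral_of_dominated_loc_of_deriv_le (μ := μ)
    (F := fun t x => w (t, x)) (F' := fun t x => deriv (fun t => w (t, x)) t)
    (bound := K.indicator fun _ => C)
    (Metric.ball_mem_nhds (0 : ℝ) (half_pos hε)) ?_ ?_ ?_ ?_ ?_ ?_).2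
  · exact Eventually.of_forall fun t => (hslice t).aestronglyMeasurable
  · exact integrable_of_continuous_of_eq_zero_off (hslice 0) hK
      (hball 0 (Metric.mem_ball_self hε))
  · exact (hdc.comp (f := fun x : Q => ((0 : ℝ), x)) (by fun_prop)).aestronglyMeasurable
  · refine Eventually.of_forall fun x t ht => ?_
    by_cases hx : x ∈ K
    · simpa [hx] using hC (t, x) ⟨Metric.ball_subset_closedBall ht, hx⟩
    · have : (fun t => w (t, x)) =ᶠ[𝓝 t] fun _ => 0 := by
        filter_upwards [Metric.isOpen_ball.mem_nhds (hsub ht)] with s hs using hball s hs x hx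
      simp [hx, this.deriv_eq]
  · exact (integrable_indicator_iff hK.measurableSet).2
      (integrableOn_const hK.measure_lt_top.ne)
  · refine Eventually.of_forall fun x t _ => ?_
    have h1 : ContMDiff 𝓘(ℝ, ℝ) 𝓘(ℝ, ℝ) ∞ fun t => w (t, x) :=
      hw.comp (contMDiff_id.prodMk contMDiff_const)
    exact (h1.contDiff.differentiable (by simp)).differentiableAt.hasDerivAt

/-- Two applications of the one-parameter case. The inner one is made at (s, 0) for every s, so
compact support is needed locally around every parameter and not only at the origin. -/
theorem hasMixedDerivAtZero_integral [IsManifold I ∞ Q] {u : (ℝ × ℝ) × Q → ℝ}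
    (hu : ContMDiff (𝓘(ℝ, ℝ × ℝ).prod I) 𝓘(ℝ, ℝ) ∞ u)
    (h0 : ∀ p₀ : ℝ × ℝ, ∃ K : Set Q, IsCompact K ∧ ∀ᶠ p in 𝓝 p₀, ∀ x ∉ K, u (p, x) = 0) :
    HasMixedDerivAtZero (fun p => ∫ x, u (p, x) ∂μ)
      (∫ x, deriv (fun s => deriv (fun t => u ((s, t), x)) 0) 0 ∂μ) := by
  -- The variables are reordered so that t comes first and (s, x) is a point of the manifold ℝ × Q.
  have hw : ContMDiff (𝓘(ℝ, ℝ).prod (𝓘(ℝ, ℝ).prod I)) 𝓘(ℝ, ℝ) ∞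
      fun q : ℝ × ℝ × Q => u ((q.2.1, q.1), q.2.2) :=
    hu.comp (((contMDiff_fst.comp contMDiff_snd).prodMk_space contMDiff_fst).prodMk
      (contMDiff_snd.comp contMDiff_snd))
  have hv : ContMDiff (𝓘(ℝ, ℝ).prod I) 𝓘(ℝ, ℝ) ∞
      fun q : ℝ × Q => deriv (fun t => u ((q.1, t), q.2)) 0 :=
    (contMDiff_deriv_fst (I := 𝓘(ℝ, ℝ).prod I) hw).comp (contMDiff_const (c := (0 : ℝ)).prodMk contMDiff_id)
  refine ⟨fun s => ∫ x, deriv (fun t => u ((s, t), x)) 0 ∂μ, Eventually.of_forall fun s => ?_, ?_⟩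
  · obtain ⟨K, hK, hKu⟩ := h0 (s, 0)
    refine hasDerivAt_integral_of_contMDiff (I := I) (w := fun q => u ((s, q.1), q.2)) ?_ hK ?_
    · exact hu.comp ((contMDiff_const.prodMk_space contMDiff_fst).prodMk contMDiff_snd)
    · exact (Continuous.tendsto' (by fun_prop) (0 : ℝ) (s, 0) rfl :
        Tendsto (fun t : ℝ => (s, t)) (𝓝 0) (𝓝 (s, 0))).eventually hKu
  · obtain ⟨K, hK, hKu⟩ := h0 (0, 0)
    refine hasDerivAt_integral_of_contMDiff (I := I) hv hK ?_
    -- For s near 0 the integrand vanishes off K for all t near 0, so its t-derivative at 0 vanishes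
    -- there too.
    rw [nhds_prod_eq] at hKu
    filter_upwards [hKu.curry] with s hs x hx
    have : (fun t => u ((s, t), x)) =ᶠ[𝓝 0] fun _ => 0 := hs.mono fun t ht => ht x hx
    simp [this.deriv_eq]

end ParametricIntegral

noncomputable section

/-! ### Matrices of bilinear forms -/

section FormMatrix

variable {m n : ℕ}

/-- The matrix of a bilinear form in the standard basis. -/
def formMatrix (b : EuclideanSpace ℝ (Fin m) →L[ℝ] EuclideanSpace ℝ (Fin m) →L[ℝ] ℝ) :
    Matrix (Fin m) (Fin m) ℝ :=
  Matrix.of fun i j => b (EuclideanSpace.single i (1 : ℝ)) (EuclideanSpace.single j (1 : ℝ))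

/-- The matrix of a linear map in the standard bases. -/
def mapMatrix (A : EuclideanSpace ℝ (Fin m) →L[ℝ] EuclideanSpace ℝ (Fin n)) :
    Matrix (Fin n) (Fin m) ℝ :=
  Matrix.of fun k i => A (EuclideanSpace.single i (1 : ℝ)) k

theorem euclidean_eq_sum_single (v : EuclideanSpace ℝ (Fin m)) :
    v = ∑ k, v k • EuclideanSpace.single k (1 : ℝ) := by
  ext i
  simp [Finset.sum_apply, Pi.single_apply]

theorem form_apply_eq_sum (b : EuclideanSpace ℝ (Fin m) →L[ℝ] EuclideanSpace ℝ (Fin m) →L[ℝ] ℝ)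
    (u v : EuclideanSpace ℝ (Fin m)) : b u v = ∑ i, ∑ j, u i * formMatrix b i j * v j := by
  conv_lhs => rw [euclidean_eq_sum_single u, euclidean_eq_sum_single v]
  simp only [map_sum, map_smul, sum_apply, smul_apply,
    smul_eq_mul, Finset.mul_sum, formMatrix, Matrix.of_apply]
  rw [Finset.sum_comm]
  refine Finset.sum_congr rfl fun i _ => Finset.sum_congr rfl fun j _ => by ring

theorem formMatrix_bilinearComp
    (b : EuclideanSpace ℝ (Fin n) →L[ℝ] EuclideanSpace ℝ (Fin n) →L[ℝ] ℝ)
    (A : EuclideanSpace ℝ (Fin m) →L[ℝ] EuclideanSpace ℝ (Fin n)) :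
    formMatrix (b.bilinearComp A A) = (mapMatrix A).transpose * formMatrix b * mapMatrix A := by
  ext i j
  have h1 : formMatrix (b.bilinearComp A A) i j =
      b (A (EuclideanSpace.single i 1)) (A (EuclideanSpace.single j 1)) := rfl
  rw [h1, form_apply_eq_sum, Finset.sum_comm]
  simp only [Matrix.mul_apply, Matrix.transpose_apply, Finset.sum_mul]
  rfl

theorem formMatrix_eq_zero_iff
    (b : EuclideanSpace ℝ (Fin m) →L[ℝ] EuclideanSpace ℝ (Fin m) →L[ℝ] ℝ) :
    formMatrix b = 0 ↔ ∀ u v, b u v = 0 := by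
  constructor
  · intro h u v
    simp [form_apply_eq_sum b u v, h]
  · intro h
    ext i j
    exact h _ _

theorem det_mapMatrix (A : EuclideanSpace ℝ (Fin m) →L[ℝ] EuclideanSpace ℝ (Fin m)) :
    (mapMatrix A).det = A.det := by
  have h1 : mapMatrix A = LinearMap.toMatrix (EuclideanSpace.basisFun (Fin m) ℝ).toBasis
      (EuclideanSpace.basisFun (Fin m) ℝ).toBasis (A : _ →ₗ[ℝ] _) := by
    ext k i
    simp [mapMatrix, LinearMap.toMatrix_apply]
  rw [h1, LinearMap.det_toMatrix]

theorem det_mapMatrix_ne_zero {A B : EuclideanSpace ℝ (Fin m) →L[ℝ] EuclideanSpace ℝ (Fin m)}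
    (h : B.comp A = ContinuousLinearMap.id ℝ _) : (mapMatrix A).det ≠ 0 := by
  intro h0
  have h1 : (mapMatrix (B.comp A)).det = 1 := by
    rw [h, det_mapMatrix]
    exact LinearMap.det_id
  have h2 : (B.comp A).det = B.det * A.det := LinearMap.det_comp _ _
  rw [det_mapMatrix, h2, ← det_mapMatrix A, h0, mul_zero] at h1
  exact zero_ne_one h1

theorem posDef_formMatrix {b : EuclideanSpace ℝ (Fin m) →L[ℝ] EuclideanSpace ℝ (Fin m) →L[ℝ] ℝ}
    (hs : ∀ u v, b u v = b v u) (hp : ∀ u, u ≠ 0 → 0 < b u u) : (formMatrix b).PosDef := by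
  refine Matrix.PosDef.of_dotProduct_mulVec_pos ?_ fun {x} hx => ?_
  · ext i j
    exact hs _ _
  · have h1 := hp (WithLp.toLp 2 x) fun h0 => hx (by simpa using congrArg WithLp.ofLp h0)
    rw [form_apply_eq_sum] at h1
    simpa [dotProduct, Matrix.mulVec, Finset.mul_sum, mul_assoc] using h1

end FormMatrix

/-! ### Invariance under congruence and positivity of the tensor norm -/

section TraceInvariance

variable {m : ℕ} {G A B S : Matrix (Fin m) (Fin m) ℝ}

/-- A change of basis S turns G and A into SᵀGS and SᵀAS, and S cancels by cyclicity of the trace.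
So metric traces can be computed in any frame. -/
theorem trace_inv_mul_congruence (hS : S.det ≠ 0) :
    ((S.transpose * G * S)⁻¹ * (S.transpose * A * S)).trace = (G⁻¹ * A).trace := by
  have hu : IsUnit S.det := isUnit_iff_ne_zero.2 hS
  have hu' : IsUnit S.transpose.det := by rwa [Matrix.det_transpose]
  rw [Matrix.mul_inv_rev, Matrix.mul_inv_rev,
    show S⁻¹ * (G⁻¹ * S.transpose⁻¹) * (S.transpose * A * S) =
      S⁻¹ * (G⁻¹ * (S.transpose⁻¹ * (S.transpose * A)) * S) by simp only [Matrix.mul_assoc],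
    Matrix.nonsing_inv_mul_cancel_left _ _ hu', Matrix.trace_mul_comm,
    Matrix.mul_nonsing_inv_cancel_right _ _ hu]

theorem trace_inv_mul_inv_mul_congruence (hS : S.det ≠ 0) :
    ((S.transpose * G * S)⁻¹ * (S.transpose * A * S) * (S.transpose * G * S)⁻¹ *
      (S.transpose * B * S).transpose).trace = (G⁻¹ * A * G⁻¹ * B.transpose).trace := by
  have hu : IsUnit S.det := isUnit_iff_ne_zero.2 hS
  have hu' : IsUnit S.transpose.det := by rwa [Matrix.det_transpose]
  rw [Matrix.mul_inv_rev, Matrix.mul_inv_rev, Matrix.transpose_mul, Matrix.transpose_mul,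
    Matrix.transpose_transpose,
    show S⁻¹ * (G⁻¹ * S.transpose⁻¹) * (S.transpose * A * S) * (S⁻¹ * (G⁻¹ * S.transpose⁻¹)) *
        (S.transpose * (B.transpose * S)) =
      S⁻¹ * (G⁻¹ * (S.transpose⁻¹ * (S.transpose * A)) * (S * (S⁻¹ * (G⁻¹ *
        (S.transpose⁻¹ * (S.transpose * B.transpose))))) * S) by simp only [Matrix.mul_assoc],
    Matrix.nonsing_inv_mul_cancel_left _ _ hu', Matrix.nonsing_inv_mul_cancel_left _ _ hu',
    Matrix.mul_nonsing_inv_cancel_left _ _ hu, Matrix.trace_mul_comm,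
    Matrix.mul_nonsing_inv_cancel_right _ _ hu, Matrix.mul_assoc (G⁻¹ * A)]

open scoped MatrixOrder Matrix.Norms.L2Operator in
theorem Matrix.PosDef.exists_inv_eq (hG : G.PosDef) :
    ∃ R : Matrix (Fin m) (Fin m) ℝ, R.det ≠ 0 ∧ G⁻¹ = R.transpose * R := by
  obtain ⟨R, hR⟩ := CStarAlgebra.nonneg_iff_eq_star_mul_self.mp
    (Matrix.nonneg_iff_posSemidef.2 hG.inv.posSemidef)
  have hR' : G⁻¹ = R.transpose * R := hR
  refine ⟨R, fun h0 => hG.inv.det_pos.ne' ?_, hR'⟩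
  rw [hR', Matrix.det_mul, h0, mul_zero]

/-- Writing G⁻¹ = RᵀR amounts to passing to a G-orthonormal frame, in which the tensor norm is the
Frobenius norm. Nonnegativity and definiteness both follow. -/
theorem trace_inv_mul_inv_mul_eq (hG : G.PosDef) :
    ∃ R : Matrix (Fin m) (Fin m) ℝ, R.det ≠ 0 ∧ ∀ A, (G⁻¹ * A * G⁻¹ * A.transpose).trace =
      ((R * A * R.transpose) * (R * A * R.transpose).conjTranspose).trace := by
  obtain ⟨R, hR, hGR⟩ := hG.exists_inv_eq
  refine ⟨R, hR, fun A => ?_⟩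
  rw [hGR, Matrix.conjTranspose_eq_transpose_of_trivial, Matrix.transpose_mul, Matrix.transpose_mul,
    Matrix.transpose_transpose,
    show R.transpose * R * A * (R.transpose * R) * A.transpose =
      R.transpose * (R * A * R.transpose * R * A.transpose) by simp only [Matrix.mul_assoc],
    Matrix.trace_mul_comm]
  simp only [Matrix.mul_assoc]

theorem trace_inv_mul_inv_mul_nonneg (hG : G.PosDef) :
    0 ≤ (G⁻¹ * A * G⁻¹ * A.transpose).trace := by
  obtain ⟨R, -, h⟩ := trace_inv_mul_inv_mul_eq hG
  rw [h]
  exact (Matrix.posSemidef_self_mul_conjTranspose _).trace_nonneg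

theorem trace_inv_mul_inv_mul_eq_zero_iff (hG : G.PosDef) :
    (G⁻¹ * A * G⁻¹ * A.transpose).trace = 0 ↔ A = 0 := by
  obtain ⟨R, hR, h⟩ := trace_inv_mul_inv_mul_eq hG
  have hu : IsUnit R.det := isUnit_iff_ne_zero.2 hR
  have hu' : IsUnit R.transpose.det := by rwa [Matrix.det_transpose]
  rw [h, Matrix.trace_mul_conjTranspose_self_eq_zero_iff]
  constructor
  · intro h0
    rw [← Matrix.nonsing_inv_mul_cancel_left R A hu,
      ← Matrix.mul_nonsing_inv_cancel_right R.transpose (R * A) hu', h0]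
    simp
  · rintro rfl
    simp

end TraceInvariance
end

noncomputable section

/-! ### Coordinate expressions -/

section Coordinates

variable {m : ℕ} {M : Type*} [TopologicalSpace M] [ChartedSpace (EuclideanSpace ℝ (Fin m)) M]
  {n : ℕ} {N : Type*} [TopologicalSpace N] [ChartedSpace (EuclideanSpace ℝ (Fin n)) N]

/-- The derivative of a map between manifolds, as a linear map between the model spaces. -/
def modelDeriv (f : M → N) (x : M) : EuclideanSpace ℝ (Fin m) →L[ℝ] EuclideanSpace ℝ (Fin n) :=
  mfderiv (𝓡 m) (𝓡 n) f x

/-- The coordinate frame of the chart centred at `x₀`, at the point with coordinates `z`. -/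
def chartFrame (x₀ : M) (z : EuclideanSpace ℝ (Fin m)) :
    EuclideanSpace ℝ (Fin m) →L[ℝ] EuclideanSpace ℝ (Fin m) :=
  mfderiv 𝓘(ℝ, EuclideanSpace ℝ (Fin m)) (𝓡 m) (extChartAt (𝓡 m) x₀).symm z

/-- The coordinate coframe of the chart centred at `x₀`, at the point `x`. -/
def chartCoframe (x₀ x : M) : EuclideanSpace ℝ (Fin m) →L[ℝ] EuclideanSpace ℝ (Fin m) :=
  mfderiv (𝓡 m) 𝓘(ℝ, EuclideanSpace ℝ (Fin m)) (extChartAt (𝓡 m) x₀) x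

/-- The coordinate expression of a map in the charts centred at `x₀` and `y₀`. -/
def chartMap (x₀ : M) (y₀ : N) (f : M → N) (z : EuclideanSpace ℝ (Fin m)) :
    EuclideanSpace ℝ (Fin n) :=
  extChartAt (𝓡 n) y₀ (f ((extChartAt (𝓡 m) x₀).symm z))

theorem chartMap_mem_target {x₀ : M} {y₀ : N} {f : M → N} {z : EuclideanSpace ℝ (Fin m)}
    (hy : f ((extChartAt (𝓡 m) x₀).symm z) ∈ (extChartAt (𝓡 n) y₀).source) :
    chartMap x₀ y₀ f z ∈ (extChartAt (𝓡 n) y₀).target :=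
  (extChartAt (𝓡 n) y₀).map_source hy

theorem symm_chartMap {x₀ : M} {y₀ : N} {f : M → N} {z : EuclideanSpace ℝ (Fin m)}
    (hy : f ((extChartAt (𝓡 m) x₀).symm z) ∈ (extChartAt (𝓡 n) y₀).source) :
    (extChartAt (𝓡 n) y₀).symm (chartMap x₀ y₀ f z) = f ((extChartAt (𝓡 m) x₀).symm z) :=
  (extChartAt (𝓡 n) y₀).left_inv hy

variable [IsManifold (𝓡 m) ∞ M] [IsManifold (𝓡 n) ∞ N]

theorem chartCoframe_comp_chartFrame {x₀ : M} {z : EuclideanSpace ℝ (Fin m)}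
    (hz : z ∈ (extChartAt (𝓡 m) x₀).target) :
    (chartCoframe x₀ ((extChartAt (𝓡 m) x₀).symm z)).comp (chartFrame x₀ z) =
      ContinuousLinearMap.id ℝ _ := by
  have h := mfderiv_extChartAt_comp_mfderivWithin_extChartAt_symm (I := 𝓡 m) hz
  rw [ModelWithCorners.range_eq_univ, mfderivWithin_univ] at h
  exact h

theorem chartFrame_comp_chartCoframe {x₀ : M} {z : EuclideanSpace ℝ (Fin m)}
    (hz : z ∈ (extChartAt (𝓡 m) x₀).target) :
    (chartFrame x₀ z).comp (chartCoframe x₀ ((extChartAt (𝓡 m) x₀).symm z)) =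
      ContinuousLinearMap.id ℝ _ := by
  have h := mfderivWithin_extChartAt_symm_comp_mfderiv_extChartAt (I := 𝓡 m) hz
  rw [ModelWithCorners.range_eq_univ, mfderivWithin_univ] at h
  exact h

theorem chartCoframe_self (x : M) : chartCoframe (m := m) x x = ContinuousLinearMap.id ℝ _ :=
  mfderiv_extChartAt_self

theorem chartFrame_self (x : M) :
    chartFrame x (extChartAt (𝓡 m) x x) = ContinuousLinearMap.id ℝ _ := by
  have h := mfderivWithin_range_extChartAt_symm (I := 𝓡 m) (x := x)
  rw [ModelWithCorners.range_eq_univ, mfderivWithin_univ] at h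
  exact h

theorem mdifferentiableAt_extChartAt_symm {x₀ : M} {z : EuclideanSpace ℝ (Fin m)}
    (hz : z ∈ (extChartAt (𝓡 m) x₀).target) :
    MDifferentiableAt 𝓘(ℝ, EuclideanSpace ℝ (Fin m)) (𝓡 m) (extChartAt (𝓡 m) x₀).symm z := by
  have h := mdifferentiableWithinAt_extChartAt_symm (I := 𝓡 m) hz
  rwa [ModelWithCorners.range_eq_univ, mdifferentiableWithinAt_univ] at h

theorem differentiableAt_chartMap {x₀ : M} {y₀ : N} {f : M → N} {z : EuclideanSpace ℝ (Fin m)}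
    (hz : z ∈ (extChartAt (𝓡 m) x₀).target)
    (hy : f ((extChartAt (𝓡 m) x₀).symm z) ∈ (extChartAt (𝓡 n) y₀).source)
    (hf : MDifferentiableAt (𝓡 m) (𝓡 n) f ((extChartAt (𝓡 m) x₀).symm z)) :
    DifferentiableAt ℝ (chartMap (n := n) x₀ y₀ f) z := by
  rw [← mdifferentiableAt_iff_differentiableAt]
  have h1 : MDifferentiableAt (𝓡 n) 𝓘(ℝ, EuclideanSpace ℝ (Fin n)) (extChartAt (𝓡 n) y₀)
      (f ((extChartAt (𝓡 m) x₀).symm z)) :=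
    mdifferentiableAt_extChartAt (by rwa [extChartAt_source] at hy)
  exact h1.comp z (hf.comp z (mdifferentiableAt_extChartAt_symm hz))

/-- The derivative of a map in coordinate frames. -/
theorem modelDeriv_chartFrame {x₀ : M} {y₀ : N} {f : M → N} {z : EuclideanSpace ℝ (Fin m)}
    (hz : z ∈ (extChartAt (𝓡 m) x₀).target)
    (hy : f ((extChartAt (𝓡 m) x₀).symm z) ∈ (extChartAt (𝓡 n) y₀).source)
    (hf : MDifferentiableAt (𝓡 m) (𝓡 n) f ((extChartAt (𝓡 m) x₀).symm z)) :
    (modelDeriv (n := n) f ((extChartAt (𝓡 m) x₀).symm z)).comp (chartFrame x₀ z) =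
      (chartFrame y₀ (chartMap x₀ y₀ f z)).comp (fderiv ℝ (chartMap x₀ y₀ f) z) := by
  -- Both sides are derivatives of f read in the chart of the source, once directly and once through
  -- the chart of the target.
  have h1 : HasMFDerivAt 𝓘(ℝ, EuclideanSpace ℝ (Fin m)) (𝓡 n)
      (f ∘ (extChartAt (𝓡 m) x₀).symm) z
      ((modelDeriv f ((extChartAt (𝓡 m) x₀).symm z)).comp (chartFrame x₀ z)) :=
    hf.hasMFDerivAt.comp z (mdifferentiableAt_extChartAt_symm hz).hasMFDerivAt
  have h2 : HasMFDerivAt 𝓘(ℝ, EuclideanSpace ℝ (Fin m)) (𝓡 n)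
      ((extChartAt (𝓡 n) y₀).symm ∘ chartMap x₀ y₀ f) z
      ((chartFrame y₀ (chartMap x₀ y₀ f z)).comp (fderiv ℝ (chartMap x₀ y₀ f) z)) :=
    (mdifferentiableAt_extChartAt_symm (chartMap_mem_target hy)).hasMFDerivAt.comp z
      (differentiableAt_chartMap hz hy hf).hasFDerivAt.hasMFDerivAt
  have h3 : (extChartAt (𝓡 n) y₀).symm ∘ chartMap x₀ y₀ f =ᶠ[𝓝 z]
      f ∘ (extChartAt (𝓡 m) x₀).symm := by
    have hc : ContinuousAt (f ∘ (extChartAt (𝓡 m) x₀).symm) z := h1.continuousAt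
    filter_upwards [hc.preimage_mem_nhds ((isOpen_extChartAt_source y₀).mem_nhds hy)] with z' hz'
    exact symm_chartMap hz'
  exact hasMFDerivAt_unique h1 (h2.congr_of_eventuallyEq h3.symm)

/-- The inner product at a point, as a bilinear form on the model space. -/
def metricForm (g : SmoothMetric m M) (x : M) :
    EuclideanSpace ℝ (Fin m) →L[ℝ] EuclideanSpace ℝ (Fin m) →L[ℝ] ℝ :=
  g.inner x

/-- The coordinate expression of the metric, as a bilinear form. -/
def chartForm (g : SmoothMetric m M) (x₀ : M) (z : EuclideanSpace ℝ (Fin m)) :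
    EuclideanSpace ℝ (Fin m) →L[ℝ] EuclideanSpace ℝ (Fin m) →L[ℝ] ℝ :=
  (metricForm g ((extChartAt (𝓡 m) x₀).symm z)).bilinearComp (chartFrame x₀ z) (chartFrame x₀ z)

/-- The pullback of a metric, as a bilinear form on the model space. -/
def pullbackForm (h : SmoothMetric n N) (f : M → N) (x : M) :
    EuclideanSpace ℝ (Fin m) →L[ℝ] EuclideanSpace ℝ (Fin m) →L[ℝ] ℝ :=
  (metricForm h (f x)).bilinearComp (modelDeriv f x) (modelDeriv f x)

variable (g : SmoothMetric m M) (h : SmoothMetric n N)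

theorem metricForm_symm (x : M) (u v : EuclideanSpace ℝ (Fin m)) :
    metricForm g x u v = metricForm g x v u :=
  g.symm x u v

theorem metricForm_pos (x : M) {u : EuclideanSpace ℝ (Fin m)} (hu : u ≠ 0) :
    0 < metricForm g x u u :=
  g.pos x u hu

theorem posDef_gramMatrix (x : M) : (gramMatrix g x).PosDef :=
  posDef_formMatrix (b := metricForm g x) (metricForm_symm g x) fun _ => metricForm_pos g x

theorem chartFrame_injective {x₀ : M} {z : EuclideanSpace ℝ (Fin m)}
    (hz : z ∈ (extChartAt (𝓡 m) x₀).target) {u : EuclideanSpace ℝ (Fin m)}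
    (hu : chartFrame x₀ z u = 0) : u = 0 := by
  have := congrArg (fun A => A u) (chartCoframe_comp_chartFrame hz)
  simpa [hu] using this.symm

theorem chartForm_symm (x₀ : M) (z u v : EuclideanSpace ℝ (Fin m)) :
    chartForm g x₀ z u v = chartForm g x₀ z v u :=
  metricForm_symm g _ _ _

theorem posDef_chartForm {x₀ : M} {z : EuclideanSpace ℝ (Fin m)}
    (hz : z ∈ (extChartAt (𝓡 m) x₀).target) : (formMatrix (chartForm g x₀ z)).PosDef :=
  posDef_formMatrix (chartForm_symm g x₀ z) fun _ hu =>
    metricForm_pos g _ fun h0 => hu (chartFrame_injective hz h0)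

theorem chartForm_self (x : M) : chartForm g x (extChartAt (𝓡 m) x x) = metricForm g x := by
  ext u v
  rw [chartForm, chartFrame_self, (extChartAt (𝓡 m) x).left_inv (mem_extChartAt_source x)]
  rfl

/-- The pullback of a metric in coordinates. -/
theorem pullbackForm_chartFrame {x₀ : M} {y₀ : N} {f : M → N} {z : EuclideanSpace ℝ (Fin m)}
    (hz : z ∈ (extChartAt (𝓡 m) x₀).target)
    (hy : f ((extChartAt (𝓡 m) x₀).symm z) ∈ (extChartAt (𝓡 n) y₀).source)
    (hf : MDifferentiableAt (𝓡 m) (𝓡 n) f ((extChartAt (𝓡 m) x₀).symm z)) :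
    (pullbackForm h f ((extChartAt (𝓡 m) x₀).symm z)).bilinearComp
        (chartFrame x₀ z) (chartFrame x₀ z) =
      (chartForm h y₀ (chartMap x₀ y₀ f z)).bilinearComp
        (fderiv ℝ (chartMap x₀ y₀ f) z) (fderiv ℝ (chartMap x₀ y₀ f) z) := by
  have h1 := modelDeriv_chartFrame hz hy hf
  ext u v
  have h2 := fun u => congrArg (fun A => A u) h1
  simp only [ContinuousLinearMap.comp_apply] at h2
  simp only [pullbackForm, chartForm, ContinuousLinearMap.bilinearComp_apply, h2, symm_chartMap hy]

/-- The standard basis of the tangent space at x belongs to the preferred chart at x and can jump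
with x. The frame of one fixed chart varies smoothly, so regularity of traces is read off this
expression. -/
theorem metricTrace_eq_of_chartFrame {x₀ : M} {z : EuclideanSpace ℝ (Fin m)}
    (hz : z ∈ (extChartAt (𝓡 m) x₀).target)
    (b : EuclideanSpace ℝ (Fin m) →L[ℝ] EuclideanSpace ℝ (Fin m) →L[ℝ] ℝ) :
    metricTrace g ((extChartAt (𝓡 m) x₀).symm z) (fun u v => b u v) =
      ((formMatrix (chartForm g x₀ z))⁻¹ *
        formMatrix (b.bilinearComp (chartFrame x₀ z) (chartFrame x₀ z))).trace := by
  rw [chartForm, formMatrix_bilinearComp, formMatrix_bilinearComp, trace_inv_mul_congruence]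
  · rfl
  · exact det_mapMatrix_ne_zero (chartCoframe_comp_chartFrame hz)

theorem tensorInner_eq_of_chartFrame {x₀ : M} {z : EuclideanSpace ℝ (Fin m)}
    (hz : z ∈ (extChartAt (𝓡 m) x₀).target)
    (b : EuclideanSpace ℝ (Fin m) →L[ℝ] EuclideanSpace ℝ (Fin m) →L[ℝ] ℝ) :
    tensorInner g ((extChartAt (𝓡 m) x₀).symm z) (fun u v => b u v) (fun u v => b u v) =
      ((formMatrix (chartForm g x₀ z))⁻¹ *
        formMatrix (b.bilinearComp (chartFrame x₀ z) (chartFrame x₀ z)) *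
        (formMatrix (chartForm g x₀ z))⁻¹ *
        (formMatrix (b.bilinearComp (chartFrame x₀ z) (chartFrame x₀ z))).transpose).trace := by
  rw [chartForm, formMatrix_bilinearComp, formMatrix_bilinearComp, trace_inv_mul_inv_mul_congruence]
  · rfl
  · exact det_mapMatrix_ne_zero (chartCoframe_comp_chartFrame hz)

set_option synthInstance.maxHeartbeats 200000 in
/-- The metric in coordinates is smooth. -/
theorem contDiffOn_chartForm (x₀ : M) :
    ContDiffOn ℝ ∞ (chartForm g x₀) (extChartAt (𝓡 m) x₀).target := by
  let e := trivializationAt (EuclideanSpace ℝ (Fin m) →L[ℝ] EuclideanSpace ℝ (Fin m) →L[ℝ] ℝ)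
    (fun x : M => TangentSpace (𝓡 m) x →L[ℝ] TangentSpace (𝓡 m) x →L[ℝ] ℝ) x₀
  have hmem : ∀ z ∈ (extChartAt (𝓡 m) x₀).target,
      (extChartAt (𝓡 m) x₀).symm z ∈ (trivializationAt (EuclideanSpace ℝ (Fin m))
        (fun x : M => TangentSpace (𝓡 m) x) x₀).baseSet := by
    intro z hz
    rw [TangentBundle.trivializationAt_baseSet, ← extChartAt_source (𝓡 m)]
    exact (extChartAt (𝓡 m) x₀).map_target hz
  have h1 := (e.contMDiffOn_section_baseSet_iff (IB := 𝓡 m) (n := ∞)).1 g.contMDiff.contMDiffOn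
  have h2 : ContMDiffOn 𝓘(ℝ, EuclideanSpace ℝ (Fin m)) 𝓘(ℝ, EuclideanSpace ℝ (Fin m) →L[ℝ]
      EuclideanSpace ℝ (Fin m) →L[ℝ] ℝ) ∞ _ (extChartAt (𝓡 m) x₀).target :=
    h1.comp (contMDiffOn_extChartAt_symm x₀) fun z hz => by
      have := hmem z hz
      simp only [e, hom_trivializationAt_baseSet, mem_preimage]
      simpa using this
  refine h2.contDiffOn.congr fun z hz => ?_
  have hb := hmem z hz
  ext u v
  simp only [Function.comp_apply, e]
  rw [hom_trivializationAt_apply]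
  refine Eq.trans ?_ (inCoordinates_apply_eq₂ hb hb (Set.mem_univ _)).symm
  -- The inverse of the tangent trivialization is the coordinate frame, so the bundle coordinates of
  -- the metric are the g_ij of the chart.
  have h3 : ∀ u, (trivializationAt (EuclideanSpace ℝ (Fin m)) (fun x : M => TangentSpace (𝓡 m) x)
      x₀).symm ((extChartAt (𝓡 m) x₀).symm z) u = chartFrame x₀ z u := by
    intro u
    have hs : (extChartAt (𝓡 m) x₀).symm z ∈ (chartAt (EuclideanSpace ℝ (Fin m)) x₀).source := by
      simpa using hb
    have h4 := TangentBundle.symmL_trivializationAt (I := 𝓡 m) hs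
    rw [(extChartAt (𝓡 m) x₀).right_inv hz, ModelWithCorners.range_eq_univ,
      mfderivWithin_univ] at h4
    refine (Bundle.Trivialization.symmL_apply (R := ℝ) _ hb u).symm.trans ?_
    rw [h4]
    rfl
  rw [h3, h3]
  simp
  rfl

/-- A smooth vector field is smooth in coordinates. -/
theorem contDiffOn_chartField {X : ∀ x : M, TangentSpace (𝓡 m) x}
    (hX : ContMDiff (𝓡 m) (𝓡 m).tangent ∞ (fun x => (⟨x, X x⟩ : TangentBundle (𝓡 m) M))) (x₀ : M) :
    ContDiffOn ℝ ∞ (chartField X x₀) (extChartAt (𝓡 m) x₀).target := by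
  let e := trivializationAt (EuclideanSpace ℝ (Fin m)) (fun x : M => TangentSpace (𝓡 m) x) x₀
  have h1 := (e.contMDiffOn_section_baseSet_iff (IB := 𝓡 m) (n := ∞)).1 hX.contMDiffOn
  have hmem : ∀ z ∈ (extChartAt (𝓡 m) x₀).target, (extChartAt (𝓡 m) x₀).symm z ∈ e.baseSet := by
    intro z hz
    rw [TangentBundle.trivializationAt_baseSet, ← extChartAt_source (𝓡 m)]
    exact (extChartAt (𝓡 m) x₀).map_target hz
  have h2 : ContMDiffOn 𝓘(ℝ, EuclideanSpace ℝ (Fin m)) 𝓘(ℝ, EuclideanSpace ℝ (Fin m)) ∞ _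
      (extChartAt (𝓡 m) x₀).target :=
    h1.comp (contMDiffOn_extChartAt_symm x₀) hmem
  refine h2.contDiffOn.congr fun z hz => ?_
  have hs : (extChartAt (𝓡 m) x₀).symm z ∈ (chartAt (EuclideanSpace ℝ (Fin m)) x₀).source := by
    simpa [e] using hmem z hz
  rw [chartField, ← TangentBundle.continuousLinearMapAt_trivializationAt hs]
  exact e.continuousLinearMapAt_apply_of_mem ℝ (hmem z hz) _

end Coordinates
end

noncomputable section

/-! ### The Riemannian volume measure -/

theorem ContinuousOn.measurableSet_inter_preimage_of_measurableSet {α β : Type*}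
    [TopologicalSpace α] [MeasurableSpace α] [OpensMeasurableSpace α] [TopologicalSpace β]
    [MeasurableSpace β] [BorelSpace β] {f : α → β} {s : Set α} {t : Set β}
    (hf : ContinuousOn f s) (hs : MeasurableSet s) (ht : MeasurableSet t) :
    MeasurableSet (s ∩ f ⁻¹' t) := by
  have h1 : MeasurableSet (s.domRestrict f ⁻¹' t) := hf.domRestrict.measurable ht
  have h2 := hs.subtype_image h1
  convert h2 using 1
  ext x
  simp [Set.domRestrict, and_comm]

section Volume

variable {m : ℕ} {M : Type*} [TopologicalSpace M] [ChartedSpace (EuclideanSpace ℝ (Fin m)) M]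
  [IsManifold (𝓡 m) ∞ M]
  {n : ℕ} {N : Type*} [TopologicalSpace N] [ChartedSpace (EuclideanSpace ℝ (Fin n)) N]
  [IsManifold (𝓡 n) ∞ N]

/-- The coordinates of the points at which the coordinate expression of a map is defined. -/
def chartMapDomain (x₀ : M) (y₀ : N) (f : M → N) : Set (EuclideanSpace ℝ (Fin m)) :=
  (extChartAt (𝓡 m) x₀).target ∩
    (extChartAt (𝓡 m) x₀).symm ⁻¹' (f ⁻¹' (extChartAt (𝓡 n) y₀).source)

omit [IsManifold (𝓡 m) ∞ M] [IsManifold (𝓡 n) ∞ N] in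
theorem isOpen_chartMapDomain (x₀ : M) (y₀ : N) {f : M → N} (hf : Continuous f) :
    IsOpen (chartMapDomain (m := m) (n := n) x₀ y₀ f) :=
  (continuousOn_extChartAt_symm x₀).isOpen_inter_preimage (isOpen_extChartAt_target x₀)
    ((isOpen_extChartAt_source y₀).preimage hf)

theorem contDiffOn_chartMap (x₀ : M) (y₀ : N) {f : M → N} (hf : ContMDiff (𝓡 m) (𝓡 n) ∞ f) :
    ContDiffOn ℝ ∞ (chartMap (m := m) (n := n) x₀ y₀ f) (chartMapDomain (n := n) x₀ y₀ f) := by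
  have h1 : ContMDiffOn 𝓘(ℝ, EuclideanSpace ℝ (Fin m)) (𝓡 n) ∞
      (f ∘ (extChartAt (𝓡 m) x₀).symm) (chartMapDomain (n := n) x₀ y₀ f) :=
    hf.comp_contMDiffOn ((contMDiffOn_extChartAt_symm x₀).mono inter_subset_left)
  have h2 : ContMDiffOn (𝓡 n) 𝓘(ℝ, EuclideanSpace ℝ (Fin n)) ∞ (extChartAt (𝓡 n) y₀)
      (chartAt (EuclideanSpace ℝ (Fin n)) y₀).source := contMDiffOn_extChartAt
  exact (h2.comp h1 fun z hz => by simpa [extChartAt_source] using hz.2).contDiffOn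

variable (g : SmoothMetric m M)

theorem chartDensity_eq (x₀ : M) (z : EuclideanSpace ℝ (Fin m)) :
    chartDensity g x₀ z = Real.sqrt (formMatrix (chartForm g x₀ z)).det := rfl

theorem chartDensity_pos {x₀ : M} {z : EuclideanSpace ℝ (Fin m)}
    (hz : z ∈ (extChartAt (𝓡 m) x₀).target) : 0 < chartDensity g x₀ z :=
  Real.sqrt_pos.2 (posDef_chartForm g hz).det_pos

theorem contDiffOn_formMatrix_chartForm (x₀ : M) (i j : Fin m) :
    ContDiffOn ℝ ∞ (fun z => formMatrix (chartForm g x₀ z) i j) (extChartAt (𝓡 m) x₀).target :=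
  ((contDiffOn_chartForm g x₀).clm_apply contDiffOn_const).clm_apply contDiffOn_const

theorem continuousOn_chartDensity (x₀ : M) :
    ContinuousOn (chartDensity g x₀) (extChartAt (𝓡 m) x₀).target :=
  Real.continuous_sqrt.comp_continuousOn
    (contDiff_det_matrix (contDiffOn_formMatrix_chartForm g x₀)).continuousOn

theorem sqrt_det_formMatrix_bilinearComp
    (b : EuclideanSpace ℝ (Fin m) →L[ℝ] EuclideanSpace ℝ (Fin m) →L[ℝ] ℝ)
    (A : EuclideanSpace ℝ (Fin m) →L[ℝ] EuclideanSpace ℝ (Fin m)) :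
    Real.sqrt (formMatrix (b.bilinearComp A A)).det = |A.det| * Real.sqrt (formMatrix b).det := by
  rw [formMatrix_bilinearComp, Matrix.det_mul, Matrix.det_mul, Matrix.det_transpose, det_mapMatrix,
    show A.det * (formMatrix b).det * A.det = A.det ^ 2 * (formMatrix b).det by ring,
    Real.sqrt_mul (sq_nonneg _), Real.sqrt_sq_eq_abs]

/-- This is the coordinate formula for pullbacks, applied to the identity map read in two charts. -/
theorem chartDensity_change {x₀ y₀ : M} {z : EuclideanSpace ℝ (Fin m)}
    (hz : z ∈ chartMapDomain (m := m) (n := m) x₀ y₀ (id : M → M)) :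
    |(fderiv ℝ (chartMap (n := m) x₀ y₀ (id : M → M)) z).det| *
      chartDensity g y₀ (chartMap x₀ y₀ (id : M → M) z) = chartDensity g x₀ z := by
  have h := pullbackForm_chartFrame (h := g) (f := (id : M → M)) hz.1 hz.2 mdifferentiableAt_id
  have h1 : pullbackForm (m := m) g (id : M → M) ((extChartAt (𝓡 m) x₀).symm z) =
      metricForm g ((extChartAt (𝓡 m) x₀).symm z) := by
    have h2 : modelDeriv (m := m) (n := m) (id : M → M) ((extChartAt (𝓡 m) x₀).symm z) =
      ContinuousLinearMap.id ℝ _ := mfderiv_id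
    rw [pullbackForm, h2]
    rfl
  rw [h1] at h
  rw [chartDensity_eq, chartDensity_eq, ← sqrt_det_formMatrix_bilinearComp, ← h]
  rfl

variable [MeasurableSpace M] [BorelSpace M]

theorem chartVolume_apply (x₀ : M) {A : Set M} (hA : MeasurableSet A) :
    chartVolume g x₀ A = ∫⁻ z in (extChartAt (𝓡 m) x₀).target ∩ (extChartAt (𝓡 m) x₀).symm ⁻¹' A,
      ENNReal.ofReal (chartDensity g x₀ z) := by
  have hT : MeasurableSet (extChartAt (𝓡 m) x₀).target := (isOpen_extChartAt_target x₀).measurableSet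
  have h1 : AEMeasurable (extChartAt (𝓡 m) x₀).symm
      ((volume : Measure (EuclideanSpace ℝ (Fin m))).restrict (extChartAt (𝓡 m) x₀).target) :=
    (continuousOn_extChartAt_symm x₀).aemeasurable hT
  rw [chartVolume, Measure.map_apply_of_aemeasurable
    (h1.mono_ac (withDensity_absolutelyContinuous _ _)) hA, withDensity_apply',
    Measure.restrict_restrict' hT, inter_comm]

theorem chartVolume_inter_source (x₀ : M) {A : Set M} (hA : MeasurableSet A) :
    chartVolume g x₀ (A ∩ (extChartAt (𝓡 m) x₀).source) = chartVolume g x₀ A := by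
  rw [chartVolume_apply g x₀ hA, chartVolume_apply g x₀
    (hA.inter (isOpen_extChartAt_source x₀).measurableSet)]
  congr 2
  ext z
  simp only [mem_inter_iff, mem_preimage, and_congr_right_iff, and_iff_left_iff_imp]
  exact fun hz _ => (extChartAt (𝓡 m) x₀).map_target hz

/-- Change of variables in charts. It is used with the identity, to show that the chart volumes
agree on overlaps, and with a volume preserving map, to extract its Jacobian. -/
theorem chartVolume_image (x₀ y₀ : M) (Φ : M ≃ₘ^∞⟮𝓡 m, 𝓡 m⟯ M) {A : Set M} (hA : MeasurableSet A)
    (hx : A ⊆ (extChartAt (𝓡 m) x₀).source) (hy : A ⊆ Φ ⁻¹' (extChartAt (𝓡 m) y₀).source) :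
    chartVolume g y₀ (Φ '' A) =
      ∫⁻ z in (extChartAt (𝓡 m) x₀).target ∩ (extChartAt (𝓡 m) x₀).symm ⁻¹' A,
        ENNReal.ofReal (|(fderiv ℝ (chartMap (n := m) x₀ y₀ Φ) z).det| *
          chartDensity g y₀ (chartMap x₀ y₀ Φ z)) := by
  have hΦA : MeasurableSet (Φ '' A) := Φ.toHomeomorph.measurableEmbedding.measurableSet_image.2 hA
  rw [chartVolume_apply g y₀ hΦA]
  set B := (extChartAt (𝓡 m) x₀).target ∩ (extChartAt (𝓡 m) x₀).symm ⁻¹' A with hB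
  have hBm : MeasurableSet B := (continuousOn_extChartAt_symm x₀)
    |>.measurableSet_inter_preimage_of_measurableSet (isOpen_extChartAt_target x₀).measurableSet hA
  have hBd : B ⊆ chartMapDomain (n := m) x₀ y₀ Φ := fun z hz => ⟨hz.1, hy hz.2⟩
  have himage : (extChartAt (𝓡 m) y₀).target ∩ (extChartAt (𝓡 m) y₀).symm ⁻¹' (Φ '' A) =
      chartMap x₀ y₀ Φ '' B := by
    ext w
    constructor
    · rintro ⟨hw, a, ha, haw⟩
      refine ⟨extChartAt (𝓡 m) x₀ a, ⟨(extChartAt (𝓡 m) x₀).map_source (hx ha), ?_⟩, ?_⟩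
      · rw [mem_preimage, (extChartAt (𝓡 m) x₀).left_inv (hx ha)]
        exact ha
      · rw [chartMap, (extChartAt (𝓡 m) x₀).left_inv (hx ha), haw,
          (extChartAt (𝓡 m) y₀).right_inv hw]
    · rintro ⟨z, hz, rfl⟩
      refine ⟨chartMap_mem_target (hBd hz).2, ?_⟩
      rw [mem_preimage, symm_chartMap (hBd hz).2]
      exact mem_image_of_mem _ hz.2
  rw [himage, lintegral_image_eq_lintegral_abs_det_fderiv_mul volume hBm
    (f' := fderiv ℝ (chartMap x₀ y₀ Φ))]
  · refine setLIntegral_congr_fun hBm fun z hz => ?_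
    exact (ENNReal.ofReal_mul (abs_nonneg _)).symm
  · intro z hz
    exact (differentiableAt_chartMap (hBd hz).1 (hBd hz).2
      ((Φ.contMDiff.mdifferentiable (by simp)) _)).hasFDerivAt.hasFDerivWithinAt
  · intro z hz z' hz' hzz'
    have h1 := congrArg (extChartAt (𝓡 m) y₀).symm hzz'
    rw [symm_chartMap (hBd hz).2, symm_chartMap (hBd hz').2] at h1
    have h2 := congrArg (extChartAt (𝓡 m) x₀) (Φ.injective h1)
    rwa [(extChartAt (𝓡 m) x₀).right_inv hz.1, (extChartAt (𝓡 m) x₀).right_inv hz'.1] at h2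

theorem chartVolume_eq_of_subset (x₀ y₀ : M) {A : Set M} (hA : MeasurableSet A)
    (hx : A ⊆ (extChartAt (𝓡 m) x₀).source) (hy : A ⊆ (extChartAt (𝓡 m) y₀).source) :
    chartVolume g y₀ A = chartVolume g x₀ A := by
  have h1 := chartVolume_image g x₀ y₀ (Diffeomorph.refl (𝓡 m) M ∞) hA hx hy
  have h2 : (Diffeomorph.refl (𝓡 m) M ∞ : M → M) = id := rfl
  rw [h2, image_id] at h1
  rw [h1, chartVolume_apply g x₀ hA]
  refine setLIntegral_congr_fun ((continuousOn_extChartAt_symm x₀)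
    |>.measurableSet_inter_preimage_of_measurableSet
      (isOpen_extChartAt_target x₀).measurableSet hA) fun z hz => ?_
  rw [chartDensity_change g ⟨hz.1, hy hz.2⟩]

/-- The Riemannian volume of a set contained in a chart domain. -/
theorem riemannianVolume_eq_chartVolume (x₀ : M) {A : Set M} (hA : MeasurableSet A)
    (hx : A ⊆ (extChartAt (𝓡 m) x₀).source) : riemannianVolume g A = chartVolume g x₀ A := by
  have hle : ∀ y₀, chartVolume g y₀ ≤ riemannianVolume g := fun y₀ =>
    le_iSup (fun y₀ => chartVolume g y₀) y₀
  have hS : ∀ y₀ : M, MeasurableSet (extChartAt (𝓡 m) y₀).source := fun y₀ =>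
    (isOpen_extChartAt_source y₀).measurableSet
  refine le_antisymm ?_ (hle x₀ A)
  -- The right side dominates every chart volume: on the domain of `x₀` the charts agree, and
  -- elsewhere the supremum itself is an upper bound. Hence it dominates the supremum.
  have h1 : riemannianVolume g ≤ chartVolume g x₀ +
      (riemannianVolume g).restrict (extChartAt (𝓡 m) x₀).sourceᶜ := by
    refine iSup_le fun y₀ => Measure.le_iff.2 fun s hs => ?_
    rw [← measure_inter_add_sdiff s (hS x₀), Measure.add_apply, Measure.restrict_apply hs]
    refine add_le_add ?_ (hle y₀ _)
    rw [← chartVolume_inter_source g y₀ (hs.inter (hS x₀)),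
      chartVolume_eq_of_subset g x₀ y₀ ((hs.inter (hS x₀)).inter (hS y₀))
        (fun z hz => hz.1.2) fun z hz => hz.2]
    exact measure_mono fun z hz => hz.1.1
  refine (h1 A).trans ?_
  rw [Measure.add_apply, Measure.restrict_apply hA, ← Set.sdiff_eq, Set.sdiff_eq_empty.2 hx]
  simp

theorem isFiniteMeasureOnCompacts_riemannianVolume :
    IsFiniteMeasureOnCompacts (riemannianVolume g) := by
  have h1 : IsLocallyFiniteMeasure (riemannianVolume g) := by
    refine ⟨fun x => ?_⟩
    let e := extChartAt (𝓡 m) x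
    have hT : IsOpen e.target := isOpen_extChartAt_target x
    obtain ⟨ε, hε, hb⟩ := Metric.nhds_basis_closedBall.mem_iff.1
      (hT.mem_nhds (mem_extChartAt_target x))
    have hcb : IsCompact (Metric.closedBall (e x) ε) := isCompact_closedBall _ _
    let A : Set M := e.source ∩ e ⁻¹' Metric.ball (e x) ε
    have hAo : IsOpen A := (continuousOn_extChartAt x).isOpen_inter_preimage
      (isOpen_extChartAt_source x) Metric.isOpen_ball
    refine ⟨A, hAo.mem_nhds ⟨mem_extChartAt_source x, Metric.mem_ball_self hε⟩, ?_⟩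
    rw [riemannianVolume_eq_chartVolume g x hAo.measurableSet inter_subset_left,
      chartVolume_apply g x hAo.measurableSet]
    have hint : IntegrableOn (chartDensity g x) (Metric.closedBall (e x) ε) :=
      ((continuousOn_chartDensity g x).mono hb).integrableOn_compact hcb
    refine lt_of_le_of_lt (lintegral_mono_set fun z hz => ?_) hint.lintegral_lt_top
    have h2 : e (e.symm z) ∈ Metric.ball (e x) ε := hz.2.2
    rw [e.right_inv hz.1] at h2
    exact Metric.ball_subset_closedBall h2
  infer_instance

/-- The chart density is strictly positive. This is what lets a continuous nonnegative integrand
with zero integral vanish everywhere in the equality case. -/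
theorem isOpenPosMeasure_riemannianVolume : (riemannianVolume g).IsOpenPosMeasure := by
  refine ⟨fun W hW ⟨x, hx⟩ h0 => ?_⟩
  have h1 : chartVolume g x W = 0 :=
    le_antisymm ((le_iSup (fun y₀ => chartVolume g y₀) x W).trans h0.le) zero_le
  rw [chartVolume_apply g x hW.measurableSet] at h1
  have hO : IsOpen ((extChartAt (𝓡 m) x).target ∩ (extChartAt (𝓡 m) x).symm ⁻¹' W) :=
    (continuousOn_extChartAt_symm x).isOpen_inter_preimage (isOpen_extChartAt_target x) hW
  have hne : ((extChartAt (𝓡 m) x).target ∩ (extChartAt (𝓡 m) x).symm ⁻¹' W).Nonempty :=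
    ⟨extChartAt (𝓡 m) x x, mem_extChartAt_target x, by
      rwa [mem_preimage, (extChartAt (𝓡 m) x).left_inv (mem_extChartAt_source x)]⟩
  have hc := ENNReal.continuous_ofReal.comp_continuousOn
    ((continuousOn_chartDensity g x).mono (inter_subset_left (t := (extChartAt (𝓡 m) x).symm ⁻¹' W)))
  have h1' := (lintegral_eq_zero_iff' (hc.aemeasurable hO.measurableSet)).1 h1
  obtain ⟨z, hz⟩ := hne
  have h2 := Measure.eqOn_open_of_ae_eq h1' hO hc continuousOn_const hz
  exact (ENNReal.ofReal_pos.2 (chartDensity_pos g hz.1)).ne' h2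

variable {g}

/-- A volume preserving diffeomorphism preserves the volume densities in charts. -/
theorem abs_det_mul_chartDensity_eq {Φ : M ≃ₘ^∞⟮𝓡 m, 𝓡 m⟯ M}
    (hΦ : MeasurePreserving Φ (riemannianVolume g) (riemannianVolume g)) (x₀ y₀ : M) :
    EqOn (fun z => |(fderiv ℝ (chartMap (n := m) x₀ y₀ Φ) z).det| *
      chartDensity g y₀ (chartMap x₀ y₀ Φ z)) (chartDensity g x₀)
      (chartMapDomain (n := m) x₀ y₀ Φ) := by
  set O := chartMapDomain (m := m) (n := m) x₀ y₀ Φ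
  have hO : IsOpen O := isOpen_chartMapDomain x₀ y₀ Φ.continuous
  have hc1 : ContinuousOn (fun z => |(fderiv ℝ (chartMap (n := m) x₀ y₀ Φ) z).det| *
      chartDensity g y₀ (chartMap x₀ y₀ Φ z)) O := by
    have h1 := contDiffOn_chartMap x₀ y₀ Φ.contMDiff
    refine (continuous_abs.comp_continuousOn (ContinuousLinearMap.continuous_det.comp_continuousOn
      (h1.continuousOn_fderiv_of_isOpen hO (by simp)))).mul ?_
    exact (continuousOn_chartDensity g y₀).comp h1.continuousOn fun z hz => chartMap_mem_target hz.2
  have hc2 : ContinuousOn (chartDensity g x₀) O :=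
    (continuousOn_chartDensity g x₀).mono inter_subset_left
  -- Each measurable part of O is the coordinate image of a set A, and the two integrals over it are
  -- the volumes of Φ(A) and of A.
  have hae : ((volume : Measure (EuclideanSpace ℝ (Fin m))).restrict O).withDensity
      (fun z => ENNReal.ofReal (|(fderiv ℝ (chartMap (n := m) x₀ y₀ Φ) z).det| *
        chartDensity g y₀ (chartMap x₀ y₀ Φ z))) =
      ((volume : Measure (EuclideanSpace ℝ (Fin m))).restrict O).withDensity
      (fun z => ENNReal.ofReal (chartDensity g x₀ z)) := by
    ext s hs
    rw [withDensity_apply _ hs, withDensity_apply _ hs, Measure.restrict_restrict hs]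
    have hsO : MeasurableSet (s ∩ O) := hs.inter hO.measurableSet
    let A : Set M := (extChartAt (𝓡 m) x₀).source ∩ extChartAt (𝓡 m) x₀ ⁻¹' (s ∩ O)
    have hA : MeasurableSet A := (continuousOn_extChartAt x₀)
      |>.measurableSet_inter_preimage_of_measurableSet (isOpen_extChartAt_source x₀).measurableSet hsO
    have hx : A ⊆ (extChartAt (𝓡 m) x₀).source := inter_subset_left
    have hy : A ⊆ Φ ⁻¹' (extChartAt (𝓡 m) y₀).source := by
      rintro a ⟨ha, -, -, ha2⟩
      rwa [mem_preimage, (extChartAt (𝓡 m) x₀).left_inv ha] at ha2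
    have hAs : (extChartAt (𝓡 m) x₀).target ∩ (extChartAt (𝓡 m) x₀).symm ⁻¹' A = s ∩ O := by
      ext z
      constructor
      · rintro ⟨hz, -, hz2⟩
        rwa [mem_preimage, (extChartAt (𝓡 m) x₀).right_inv hz] at hz2
      · intro hz
        refine ⟨hz.2.1, (extChartAt (𝓡 m) x₀).map_target hz.2.1, ?_⟩
        rwa [mem_preimage, (extChartAt (𝓡 m) x₀).right_inv hz.2.1]
    have hΦA : MeasurableSet (Φ '' A) :=
      Φ.toHomeomorph.measurableEmbedding.measurableSet_image.2 hA
    have h1 := hΦ.measure_preimage hΦA.nullMeasurableSet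
    have hpre : Φ ⁻¹' (Φ '' A) = A := preimage_image_eq _ Φ.injective
    rw [hpre, riemannianVolume_eq_chartVolume g x₀ hA hx,
      riemannianVolume_eq_chartVolume g y₀ hΦA (image_subset_iff.2 hy), chartVolume_apply g x₀ hA,
      chartVolume_image g x₀ y₀ Φ hA hx hy, hAs] at h1
    exact h1.symm
  rw [withDensity_eq_iff_of_sigmaFinite] at hae
  -- Equal measures have densities equal almost everywhere; continuity upgrades this to every point
  -- of the open set O.
  · have heq := Measure.eqOn_open_of_ae_eq hae hO (ENNReal.continuous_ofReal.comp_continuousOn hc1)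
      (ENNReal.continuous_ofReal.comp_continuousOn hc2)
    intro z hz
    exact (ENNReal.ofReal_eq_ofReal_iff
      (mul_nonneg (abs_nonneg _) (Real.sqrt_nonneg _)) (Real.sqrt_nonneg _)).1 (heq hz)
  · exact (ENNReal.continuous_ofReal.comp_continuousOn hc1).aemeasurable hO.measurableSet
  · exact (ENNReal.continuous_ofReal.comp_continuousOn hc2).aemeasurable hO.measurableSet

/-- A volume preserving diffeomorphism preserves the determinant of the metric. -/
theorem IsSDiff.det_pullbackForm {ψ : M → M} (hψ : IsSDiff g ψ) (x : M) :
    (formMatrix (pullbackForm (m := m) g ψ x)).det = (formMatrix (metricForm g x)).det := by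
  obtain ⟨Φ, rfl⟩ := hψ.diffeo
  have hleft : (extChartAt (𝓡 m) x).symm (extChartAt (𝓡 m) x x) = x :=
    (extChartAt (𝓡 m) x).left_inv (mem_extChartAt_source x)
  have hz : extChartAt (𝓡 m) x x ∈ chartMapDomain (n := m) x (Φ x) Φ :=
    ⟨mem_extChartAt_target x, by
      rw [mem_preimage, mem_preimage, hleft]; exact mem_extChartAt_source _⟩
  have h1 := abs_det_mul_chartDensity_eq hψ.volume_preserving x (Φ x) hz
  simp only at h1
  rw [chartDensity_eq, chartDensity_eq, ← sqrt_det_formMatrix_bilinearComp,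
    ← pullbackForm_chartFrame (h := g) hz.1 hz.2 ((Φ.contMDiff.mdifferentiable (by simp)) _),
    chartFrame_self, hleft, chartForm_self] at h1
  have h2 : (pullbackForm (m := m) g Φ x).bilinearComp (ContinuousLinearMap.id ℝ _)
    (ContinuousLinearMap.id ℝ _) = pullbackForm g Φ x := rfl
  rw [h2] at h1
  have h3 : 0 < (formMatrix (metricForm g x)).det := (posDef_gramMatrix g x).det_pos
  -- Positivity is read off the identity of square roots itself: a nonpositive determinant would
  -- have root 0.
  have h4 : 0 < (formMatrix (pullbackForm (m := m) g Φ x)).det := by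
    rw [← Real.sqrt_pos, h1]
    exact Real.sqrt_pos.2 h3
  exact (Real.sqrt_inj h4.le h3.le).1 h1

end Volume
end

noncomputable section

/-! ### Smoothness of pullbacks and traces -/

section MatrixSmooth

variable {m : ℕ} {V : Type*} [NormedAddCommGroup V] [NormedSpace ℝ V] {s : Set V}
  {A B : V → Matrix (Fin m) (Fin m) ℝ}

theorem contDiffOn_matrix_mul (hA : ∀ i j, ContDiffOn ℝ ∞ (fun p => A p i j) s)
    (hB : ∀ i j, ContDiffOn ℝ ∞ (fun p => B p i j) s) (i j : Fin m) :
    ContDiffOn ℝ ∞ (fun p => (A p * B p) i j) s := by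
  simp only [Matrix.mul_apply]
  exact ContDiffOn.sum fun k _ => (hA i k).mul (hB k j)

theorem contDiffOn_trace (hA : ∀ i j, ContDiffOn ℝ ∞ (fun p => A p i j) s) :
    ContDiffOn ℝ ∞ (fun p => (A p).trace) s := by
  simp only [Matrix.trace, Matrix.diag_apply]
  exact ContDiffOn.sum fun k _ => hA k k

theorem contDiffOn_matrix_inv (hA : ∀ i j, ContDiffOn ℝ ∞ (fun p => A p i j) s)
    (h0 : ∀ p ∈ s, (A p).det ≠ 0) (i j : Fin m) : ContDiffOn ℝ ∞ (fun p => (A p)⁻¹ i j) s := by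
  simp only [Matrix.inv_def, Matrix.smul_apply, Ring.inverse_eq_inv', smul_eq_mul,
    Matrix.adjugate_apply]
  refine ((contDiff_det_matrix hA).inv h0).mul (contDiff_det_matrix fun k l => ?_)
  by_cases hk : k = j
  · subst hk
    simpa using contDiffOn_const
  · simpa [Matrix.updateRow_ne hk] using hA k l

end MatrixSmooth

section Families

variable {m : ℕ} {M : Type*} [TopologicalSpace M] [ChartedSpace (EuclideanSpace ℝ (Fin m)) M]
  [IsManifold (𝓡 m) ∞ M]
  {n : ℕ} {N : Type*} [TopologicalSpace N] [ChartedSpace (EuclideanSpace ℝ (Fin n)) N]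
  [IsManifold (𝓡 n) ∞ N] {P : Type*} [NormedAddCommGroup P] [NormedSpace ℝ P]

/-- The parameters and coordinates at which the coordinate expression of a family is defined. -/
def chartFamilyDomain (x₀ : M) (y₀ : N) (ψ : P → M → N) : Set (P × EuclideanSpace ℝ (Fin m)) :=
  {q | q.2 ∈ chartMapDomain (m := m) (n := n) x₀ y₀ (ψ q.1)}

/-- The coordinate expression of a family of maps. -/
def chartFamily (x₀ : M) (y₀ : N) (ψ : P → M → N) (q : P × EuclideanSpace ℝ (Fin m)) :
    EuclideanSpace ℝ (Fin n) :=
  chartMap x₀ y₀ (ψ q.1) q.2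

variable {ψ : P → M → N}

omit [IsManifold (𝓡 n) ∞ N] in
theorem contMDiffOn_family_symm
    (hψ : ContMDiff (𝓘(ℝ, P).prod (𝓡 m)) (𝓡 n) ∞ fun q : P × M => ψ q.1 q.2) (x₀ : M) :
    ContMDiffOn 𝓘(ℝ, P × EuclideanSpace ℝ (Fin m)) (𝓡 n) ∞
      (fun q : P × EuclideanSpace ℝ (Fin m) => ψ q.1 ((extChartAt (𝓡 m) x₀).symm q.2))
      (univ ×ˢ (extChartAt (𝓡 m) x₀).target) := by
  have h1 : ContMDiffOn 𝓘(ℝ, P × EuclideanSpace ℝ (Fin m)) (𝓘(ℝ, P).prod (𝓡 m)) ∞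
      (fun q : P × EuclideanSpace ℝ (Fin m) => (q.1, (extChartAt (𝓡 m) x₀).symm q.2))
      (univ ×ˢ (extChartAt (𝓡 m) x₀).target) :=
    (contDiff_fst.contMDiff.contMDiffOn).prodMk
      ((contMDiffOn_extChartAt_symm x₀).comp contDiff_snd.contMDiff.contMDiffOn fun q hq => hq.2)
  exact hψ.comp_contMDiffOn h1

omit [IsManifold (𝓡 n) ∞ N] in
theorem isOpen_chartFamilyDomain
    (hψ : ContMDiff (𝓘(ℝ, P).prod (𝓡 m)) (𝓡 n) ∞ fun q : P × M => ψ q.1 q.2) (x₀ : M) (y₀ : N) :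
    IsOpen (chartFamilyDomain (m := m) (n := n) x₀ y₀ ψ) := by
  have h1 := (contMDiffOn_family_symm hψ x₀).continuousOn.isOpen_inter_preimage
    (isOpen_univ.prod (isOpen_extChartAt_target x₀)) (isOpen_extChartAt_source (I := 𝓡 n) y₀)
  convert h1 using 1
  ext q
  simp [chartFamilyDomain, chartMapDomain]

theorem contDiffOn_chartFamily
    (hψ : ContMDiff (𝓘(ℝ, P).prod (𝓡 m)) (𝓡 n) ∞ fun q : P × M => ψ q.1 q.2) (x₀ : M) (y₀ : N) :
    ContDiffOn ℝ ∞ (chartFamily (m := m) (n := n) x₀ y₀ ψ)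
      (chartFamilyDomain (m := m) (n := n) x₀ y₀ ψ) := by
  have h2 : ContMDiffOn (𝓡 n) 𝓘(ℝ, EuclideanSpace ℝ (Fin n)) ∞ (extChartAt (𝓡 n) y₀)
      (chartAt (EuclideanSpace ℝ (Fin n)) y₀).source := contMDiffOn_extChartAt
  exact (h2.comp ((contMDiffOn_family_symm hψ x₀).mono fun q hq => ⟨mem_univ _, hq.1⟩)
    fun q hq => by simpa [extChartAt_source] using hq.2).contDiffOn

omit [IsManifold (𝓡 m) ∞ M] [IsManifold (𝓡 n) ∞ N] in
theorem contMDiff_of_family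
    (hψ : ContMDiff (𝓘(ℝ, P).prod (𝓡 m)) (𝓡 n) ∞ fun q : P × M => ψ q.1 q.2) (p : P) :
    ContMDiff (𝓡 m) (𝓡 n) ∞ (ψ p) :=
  hψ.comp (contMDiff_const.prodMk contMDiff_id)

/-- The space derivative of one member of the family is a restriction of the joint derivative, hence
smooth in parameter and point together. -/
theorem fderiv_chartMap_family
    (hψ : ContMDiff (𝓘(ℝ, P).prod (𝓡 m)) (𝓡 n) ∞ fun q : P × M => ψ q.1 q.2) {x₀ : M} {y₀ : N}
    {q : P × EuclideanSpace ℝ (Fin m)} (hq : q ∈ chartFamilyDomain (m := m) (n := n) x₀ y₀ ψ) :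
    fderiv ℝ (chartMap (n := n) x₀ y₀ (ψ q.1)) q.2 =
      (fderiv ℝ (chartFamily (n := n) x₀ y₀ ψ) q).comp (ContinuousLinearMap.inr ℝ P _) := by
  have h1 : HasFDerivAt (chartFamily (n := n) x₀ y₀ ψ)
      (fderiv ℝ (chartFamily (n := n) x₀ y₀ ψ) q) (q.1, q.2) :=
    (((contDiffOn_chartFamily hψ x₀ y₀).contDiffAt
      ((isOpen_chartFamilyDomain hψ x₀ y₀).mem_nhds hq)).differentiableAt (by simp)).hasFDerivAt
  exact (h1.comp q.2 (hasFDerivAt_prodMk_right q.1 q.2)).fderiv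

variable (h : SmoothMetric n N)

theorem pullbackForm_family
    (hψ : ContMDiff (𝓘(ℝ, P).prod (𝓡 m)) (𝓡 n) ∞ fun q : P × M => ψ q.1 q.2) {x₀ : M} {y₀ : N}
    {q : P × EuclideanSpace ℝ (Fin m)} (hq : q ∈ chartFamilyDomain (m := m) (n := n) x₀ y₀ ψ)
    (u v : EuclideanSpace ℝ (Fin m)) :
    pullbackForm h (ψ q.1) ((extChartAt (𝓡 m) x₀).symm q.2) (chartFrame x₀ q.2 u)
      (chartFrame x₀ q.2 v) =
    chartForm h y₀ (chartFamily x₀ y₀ ψ q)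
      (fderiv ℝ (chartFamily (n := n) x₀ y₀ ψ) q (0, u))
      (fderiv ℝ (chartFamily (n := n) x₀ y₀ ψ) q (0, v)) := by
  have h1 := pullbackForm_chartFrame (h := h) hq.1 hq.2
    ((contMDiff_of_family hψ q.1).mdifferentiable (by simp) _)
  rw [fderiv_chartMap_family hψ hq] at h1
  exact congrArg (fun b => b u v) h1

/-- The pullback of a metric under a smooth family of maps is smooth in coordinates. -/
theorem contDiffOn_pullbackForm_family
    (hψ : ContMDiff (𝓘(ℝ, P).prod (𝓡 m)) (𝓡 n) ∞ fun q : P × M => ψ q.1 q.2) (x₀ : M)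
    (u v : EuclideanSpace ℝ (Fin m)) :
    ContDiffOn ℝ ∞ (fun q : P × EuclideanSpace ℝ (Fin m) =>
      pullbackForm h (ψ q.1) ((extChartAt (𝓡 m) x₀).symm q.2) (chartFrame x₀ q.2 u)
        (chartFrame x₀ q.2 v)) (univ ×ˢ (extChartAt (𝓡 m) x₀).target) := by
  rintro q₀ ⟨-, hq₀⟩
  -- Smoothness is local, so the target chart may be chosen afresh at the image of each point.
  let y₀ : N := ψ q₀.1 ((extChartAt (𝓡 m) x₀).symm q₀.2)
  have hD : IsOpen (chartFamilyDomain (m := m) (n := n) x₀ y₀ ψ) :=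
    isOpen_chartFamilyDomain hψ x₀ y₀
  have hmem : q₀ ∈ chartFamilyDomain (m := m) (n := n) x₀ y₀ ψ := ⟨hq₀, mem_extChartAt_source y₀⟩
  have h1 := contDiffOn_chartFamily hψ x₀ y₀
  have h2 : ContDiffOn ℝ ∞ (fderiv ℝ (chartFamily (n := n) x₀ y₀ ψ))
      (chartFamilyDomain (m := m) (n := n) x₀ y₀ ψ) := h1.fderiv_of_isOpen hD (by simp)
  have h3 : ContDiffOn ℝ ∞ (fun q => chartForm h y₀ (chartFamily x₀ y₀ ψ q))
      (chartFamilyDomain (m := m) (n := n) x₀ y₀ ψ) :=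
    (contDiffOn_chartForm h y₀).comp h1 fun q hq => chartMap_mem_target hq.2
  have h4 : ContDiffOn ℝ ∞ (fun q => chartForm h y₀ (chartFamily x₀ y₀ ψ q)
      (fderiv ℝ (chartFamily (n := n) x₀ y₀ ψ) q (0, u))
      (fderiv ℝ (chartFamily (n := n) x₀ y₀ ψ) q (0, v)))
      (chartFamilyDomain (m := m) (n := n) x₀ y₀ ψ) :=
    (h3.clm_apply (h2.clm_apply contDiffOn_const)).clm_apply (h2.clm_apply contDiffOn_const)
  exact ((h4.congr fun q hq => pullbackForm_family h hψ hq u v).contDiffAt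
    (hD.mem_nhds hmem)).contDiffWithinAt

theorem contDiff_pullbackForm_param
    (hψ : ContMDiff (𝓘(ℝ, P).prod (𝓡 m)) (𝓡 n) ∞ fun q : P × M => ψ q.1 q.2) (x : M)
    (u v : EuclideanSpace ℝ (Fin m)) : ContDiff ℝ ∞ fun p => pullbackForm h (ψ p) x u v := by
  have h1 := (contDiffOn_pullbackForm_family h hψ x u v).comp (s := univ)
    (f := fun p : P => (p, extChartAt (𝓡 m) x x)) (by fun_prop)
    fun p _ => ⟨mem_univ _, mem_extChartAt_target x⟩
  rw [contDiffOn_univ] at h1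
  convert h1 using 1
  ext p
  simp only [Function.comp_apply]
  rw [chartFrame_self, (extChartAt (𝓡 m) x).left_inv (mem_extChartAt_source x)]
  rfl

variable (g : SmoothMetric m M)

theorem contMDiff_metricTrace_pullback
    (hψ : ContMDiff (𝓘(ℝ, P).prod (𝓡 m)) (𝓡 n) ∞ fun q : P × M => ψ q.1 q.2) :
    ContMDiff (𝓘(ℝ, P).prod (𝓡 m)) 𝓘(ℝ, ℝ) ∞
      fun q : P × M => metricTrace g q.2 (pullbackMetric h (ψ q.1) q.2) := by
  rintro ⟨p₀, x₀⟩
  have hT : IsOpen (extChartAt (𝓡 m) x₀).target := isOpen_extChartAt_target x₀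
  have h1 : ContDiffOn ℝ ∞ (fun q : P × EuclideanSpace ℝ (Fin m) =>
      ((formMatrix (chartForm g x₀ q.2))⁻¹ *
        formMatrix ((pullbackForm h (ψ q.1) ((extChartAt (𝓡 m) x₀).symm q.2)).bilinearComp
          (chartFrame x₀ q.2) (chartFrame x₀ q.2))).trace)
      (univ ×ˢ (extChartAt (𝓡 m) x₀).target) :=
    contDiffOn_trace (contDiffOn_matrix_mul (contDiffOn_matrix_inv
      (fun i j => (contDiffOn_formMatrix_chartForm g x₀ i j).comp contDiffOn_snd fun q hq => hq.2)
      fun q hq => (posDef_chartForm g hq.2).det_pos.ne')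
      fun i j => contDiffOn_pullbackForm_family h hψ x₀ _ _)
  have h2 : ContMDiffAt (𝓘(ℝ, P).prod (𝓡 m)) 𝓘(ℝ, P × EuclideanSpace ℝ (Fin m)) ∞
      (fun q : P × M => (q.1, extChartAt (𝓡 m) x₀ q.2)) (p₀, x₀) :=
    contMDiffAt_fst.prodMk_space (contMDiffAt_extChartAt.comp (p₀, x₀) contMDiffAt_snd)
  have h3 := (h1.contDiffAt (x := (p₀, extChartAt (𝓡 m) x₀ x₀)) ((isOpen_univ.prod hT).mem_nhds
    ⟨mem_univ _, mem_extChartAt_target x₀⟩)).contMDiffAt.comp (p₀, x₀) h2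
  refine h3.congr_of_eventuallyEq ?_
  have h4 : ∀ᶠ q : P × M in 𝓝 (p₀, x₀), q.2 ∈ (extChartAt (𝓡 m) x₀).source :=
    continuousAt_snd.eventually ((isOpen_extChartAt_source x₀).mem_nhds (mem_extChartAt_source x₀))
  filter_upwards [h4] with q hq
  have h5 := metricTrace_eq_of_chartFrame g ((extChartAt (𝓡 m) x₀).map_source hq)
    (pullbackForm h (ψ q.1) q.2)
  rw [(extChartAt (𝓡 m) x₀).left_inv hq] at h5
  simp only [Function.comp_apply, (extChartAt (𝓡 m) x₀).left_inv hq]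
  exact h5

omit [IsManifold (𝓡 m) ∞ M] in
theorem contMDiff_of_comp_snd {f : M → ℝ} (hf : ContMDiff (𝓘(ℝ, ℝ).prod (𝓡 m)) 𝓘(ℝ, ℝ) ∞
    fun q : ℝ × M => f q.2) : ContMDiff (𝓡 m) 𝓘(ℝ, ℝ) ∞ f := by
  have h1 : ContMDiff (𝓡 m) (𝓘(ℝ, ℝ).prod (𝓡 m)) ∞ fun x : M => ((0 : ℝ), x) :=
    contMDiff_const.prodMk contMDiff_id
  exact hf.comp h1

omit [IsManifold (𝓡 m) ∞ M] [IsManifold (𝓡 n) ∞ N] in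
theorem contMDiff_comp_snd {φ : M → N} (hφ : ContMDiff (𝓡 m) (𝓡 n) ∞ φ) :
    ContMDiff (𝓘(ℝ, ℝ).prod (𝓡 m)) (𝓡 n) ∞ fun q : ℝ × M => φ q.2 :=
  hφ.comp contMDiff_snd

theorem contMDiff_normSqDeriv {φ : M → N} (hφ : ContMDiff (𝓡 m) (𝓡 n) ∞ φ) :
    ContMDiff (𝓡 m) 𝓘(ℝ, ℝ) ∞ (normSqDeriv g h φ) :=
  contMDiff_of_comp_snd
    (contMDiff_metricTrace_pullback (ψ := fun _ : ℝ => φ) h g (contMDiff_comp_snd hφ))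

end Families
end

noncomputable section

/-! ### The Lie derivative of the metric -/

/-- The product rule behind the three terms of the Lie derivative. It serves both for chart
independence and for the derivative of ψ_s^*g. -/
theorem hasDerivAt_form_apply {E F : Type*} [NormedAddCommGroup E] [NormedSpace ℝ E]
    [NormedAddCommGroup F] [NormedSpace ℝ F] {B : E → F →L[ℝ] F →L[ℝ] ℝ} {a : ℝ → E} {a' : E}
    {b c : ℝ → F} {b' c' : F} (hB : DifferentiableAt ℝ B (a 0)) (ha : HasDerivAt a a' 0)
    (hb : HasDerivAt b b' 0) (hc : HasDerivAt c c' 0) :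
    HasDerivAt (fun s => B (a s) (b s) (c s))
      (fderiv ℝ B (a 0) a' (b 0) (c 0) + B (a 0) b' (c 0) + B (a 0) (b 0) c') 0 := by
  have h1 : HasDerivAt (fun s => B (a s)) (fderiv ℝ B (a 0) a') 0 :=
    HasFDerivAt.comp_hasDerivAt (l := B) 0 hB.hasFDerivAt ha
  have h2 := (h1.clm_apply hb).clm_apply hc
  simpa using h2

section LieDerivative

variable {m : ℕ} {M : Type*} [TopologicalSpace M] [ChartedSpace (EuclideanSpace ℝ (Fin m)) M]
  [IsManifold (𝓡 m) ∞ M] (g : SmoothMetric m M) (X : ∀ x : M, TangentSpace (𝓡 m) x)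

/-- The Lie derivative of the metric in the chart centred at `x₀`, as a bilinear form. -/
def chartLieForm (x₀ : M) (z : EuclideanSpace ℝ (Fin m)) :
    EuclideanSpace ℝ (Fin m) →L[ℝ] EuclideanSpace ℝ (Fin m) →L[ℝ] ℝ :=
  fderiv ℝ (chartForm g x₀) z (chartField X x₀ z)
    + (chartForm g x₀ z).bilinearComp (fderiv ℝ (chartField X x₀) z) (ContinuousLinearMap.id ℝ _)
    + (chartForm g x₀ z).bilinearComp (ContinuousLinearMap.id ℝ _) (fderiv ℝ (chartField X x₀) z)

/-- The Lie derivative of the metric, as a bilinear form on the model space. -/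
def lieForm (x : M) : EuclideanSpace ℝ (Fin m) →L[ℝ] EuclideanSpace ℝ (Fin m) →L[ℝ] ℝ :=
  chartLieForm g X x (extChartAt (𝓡 m) x x)

theorem chartLieForm_apply (x₀ : M) (z u v : EuclideanSpace ℝ (Fin m)) :
    chartLieForm g X x₀ z u v = fderiv ℝ (chartForm g x₀) z (chartField X x₀ z) u v
      + chartForm g x₀ z (fderiv ℝ (chartField X x₀) z u) v
      + chartForm g x₀ z u (fderiv ℝ (chartField X x₀) z v) := rfl

theorem differentiableAt_chartForm {x₀ : M} {z : EuclideanSpace ℝ (Fin m)}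
    (hz : z ∈ (extChartAt (𝓡 m) x₀).target) : DifferentiableAt ℝ (chartForm g x₀) z :=
  ((contDiffOn_chartForm g x₀).contDiffAt ((isOpen_extChartAt_target x₀).mem_nhds hz)
    ).differentiableAt (by simp)

theorem lieDerivMetric_eq (x : M) (u v : EuclideanSpace ℝ (Fin m)) :
    lieDerivMetric g X x u v = lieForm g X x u v := by
  have hid : ∀ w : EuclideanSpace ℝ (Fin m), (mfderiv (𝓡 m) 𝓘(ℝ, EuclideanSpace ℝ (Fin m))
      (extChartAt (𝓡 m) x) x w : EuclideanSpace ℝ (Fin m)) = w := fun w =>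
    congrArg (fun A => A w) (chartCoframe_self x)
  have h1 : HasFDerivAt (fun z => chartMetric g x z u v)
      ((fderiv ℝ (chartForm g x) (extChartAt (𝓡 m) x x)).flip u |>.flip v)
      (extChartAt (𝓡 m) x x) := by
    have h2 := (differentiableAt_chartForm g (mem_extChartAt_target x)).hasFDerivAt
    have h3 := (h2.clm_apply (hasFDerivAt_const u _)).clm_apply (hasFDerivAt_const v _)
    refine HasFDerivAt.congr_fderiv h3 ?_
    ext w
    simp
  simp only [lieDerivMetric]
  rw [hid u, hid v, h1.fderiv]
  rfl

theorem lieForm_symm (x : M) (u v : EuclideanSpace ℝ (Fin m)) :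
    lieForm g X x u v = lieForm g X x v u := by
  have h1 : fderiv ℝ (chartForm g x) (extChartAt (𝓡 m) x x) (chartField X x (extChartAt (𝓡 m) x x))
      u v = fderiv ℝ (chartForm g x) (extChartAt (𝓡 m) x x)
        (chartField X x (extChartAt (𝓡 m) x x)) v u := by
    have h2 := (differentiableAt_chartForm g (mem_extChartAt_target x)).hasFDerivAt
    have h3 := fun u v => (h2.clm_apply (hasFDerivAt_const u _)).clm_apply (hasFDerivAt_const v _)
    have h4 := h3 u v
    simp_rw [chartForm_symm g x _ u v] at h4
    have h5 := congrArg (fun A => A (chartField X x (extChartAt (𝓡 m) x x))) (h4.unique (h3 v u))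
    simpa using h5
  rw [lieForm, chartLieForm_apply, chartLieForm_apply, h1, chartForm_symm g x _ _ v,
    chartForm_symm g x _ u _]
  ring

variable {X}

/-- The Lie derivative of the metric does not depend on the chart. -/
theorem chartLieForm_change
    (hX : ContMDiff (𝓡 m) (𝓡 m).tangent ∞ (fun x => (⟨x, X x⟩ : TangentBundle (𝓡 m) M)))
    {x₀ y₀ : M} {z : EuclideanSpace ℝ (Fin m)}
    (hz : z ∈ chartMapDomain (m := m) (n := m) x₀ y₀ (id : M → M)) :
    chartLieForm g X x₀ z =
      (chartLieForm g X y₀ (chartMap x₀ y₀ (id : M → M) z)).bilinearComp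
        (fderiv ℝ (chartMap x₀ y₀ (id : M → M)) z) (fderiv ℝ (chartMap x₀ y₀ (id : M → M)) z) := by
  set τ : EuclideanSpace ℝ (Fin m) → EuclideanSpace ℝ (Fin m) :=
    chartMap (m := m) (n := m) x₀ y₀ (id : M → M) with hτ
  have hO : IsOpen (chartMapDomain (m := m) (n := m) x₀ y₀ (id : M → M)) :=
    isOpen_chartMapDomain x₀ y₀ continuous_id
  have hOz := hO.mem_nhds hz
  have hτd : ContDiffAt ℝ ∞ τ z := (contDiffOn_chartMap x₀ y₀ contMDiff_id).contDiffAt hOz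
  have hDτ : DifferentiableAt ℝ (fderiv ℝ τ) z :=
    (hτd.fderiv_right (m := ∞) (by simp)).differentiableAt (by simp)
  -- The second derivative of the transition map appears as D²τ(w, u) when the metric is
  -- differentiated along the field, and as D²τ(u, w) when the field is differentiated. Symmetry
  -- makes the two sides agree.
  have hsymm : ∀ a b, fderiv ℝ (fderiv ℝ τ) z a b = fderiv ℝ (fderiv ℝ τ) z b a := fun a b =>
    (hτd.isSymmSndFDerivAt (by simp; exact WithTop.coe_le_coe.2 le_top)) a b
  have hid : ∀ x : M, modelDeriv (m := m) (n := m) (id : M → M) x = ContinuousLinearMap.id ℝ _ :=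
    fun x => mfderiv_id
  have hframe : ∀ z' ∈ chartMapDomain (m := m) (n := m) x₀ y₀ (id : M → M),
      chartFrame x₀ z' = (chartFrame y₀ (τ z')).comp (fderiv ℝ τ z') := fun z' hz' => by
    have := modelDeriv_chartFrame hz'.1 hz'.2 mdifferentiableAt_id
    rwa [hid, ContinuousLinearMap.id_comp] at this
  have hsymm' : ∀ z' ∈ chartMapDomain (m := m) (n := m) x₀ y₀ (id : M → M),
      (extChartAt (𝓡 m) y₀).symm (τ z') = (extChartAt (𝓡 m) x₀).symm z' := fun z' hz' =>
    symm_chartMap hz'.2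
  have hform : ∀ z' ∈ chartMapDomain (m := m) (n := m) x₀ y₀ (id : M → M), ∀ u v,
      chartForm g x₀ z' u v = chartForm g y₀ (τ z') (fderiv ℝ τ z' u) (fderiv ℝ τ z' v) := by
    intro z' hz' u v
    simp only [chartForm, hframe z' hz', hsymm' z' hz']
    rfl
  have hfield : ∀ z' ∈ chartMapDomain (m := m) (n := m) x₀ y₀ (id : M → M),
      chartField X y₀ (τ z') = fderiv ℝ τ z' (chartField X x₀ z') := by
    intro z' hz'
    let x := (extChartAt (𝓡 m) x₀).symm z'
    have e1 : chartField X x₀ z' = chartCoframe x₀ x (X x) := rfl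
    have e2 : chartField X y₀ (τ z') = chartCoframe y₀ x (X x) := by
      have : chartField X y₀ (τ z') = (fun x' : M => chartCoframe y₀ x' (X x'))
        ((extChartAt (𝓡 m) y₀).symm (τ z')) := rfl
      rw [this, hsymm' z' hz']
    have e3 : (X x : EuclideanSpace ℝ (Fin m)) = chartFrame x₀ z' (chartCoframe x₀ x (X x)) :=
      (congrArg (fun A => A (X x)) (chartFrame_comp_chartCoframe hz'.1)).symm
    have e4 := chartCoframe_comp_chartFrame (chartMap_mem_target (n := m) hz'.2)
    rw [hsymm' z' hz'] at e4
    have e5 : ∀ w, chartCoframe y₀ x (chartFrame y₀ (τ z') w) = w := fun w =>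
      congrArg (fun A => A w) e4
    have e6 : (X x : EuclideanSpace ℝ (Fin m)) =
        chartFrame y₀ (τ z') (fderiv ℝ τ z' (chartCoframe x₀ x (X x))) := by
      rw [hframe z' hz'] at e3
      exact e3
    rw [e2, e1]
    exact (congrArg (chartCoframe y₀ x) e6).trans (e5 _)
  have hτz : τ z ∈ (extChartAt (𝓡 m) y₀).target := chartMap_mem_target hz.2
  have hX1 : DifferentiableAt ℝ (chartField X x₀) z := ((contDiffOn_chartField hX x₀).contDiffAt
    ((isOpen_extChartAt_target x₀).mem_nhds hz.1)).differentiableAt (by simp)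
  have hX2 : DifferentiableAt ℝ (chartField X y₀) (τ z) := ((contDiffOn_chartField hX y₀).contDiffAt
    ((isOpen_extChartAt_target y₀).mem_nhds hτz)).differentiableAt (by simp)
  have hτ1 : HasFDerivAt τ (fderiv ℝ τ z) z := (hτd.differentiableAt (by simp)).hasFDerivAt
  -- the derivative of the transformation law of the field
  have hDfield : ∀ u, fderiv ℝ (chartField X y₀) (τ z) (fderiv ℝ τ z u) =
      fderiv ℝ (fderiv ℝ τ) z u (chartField X x₀ z) +
        fderiv ℝ τ z (fderiv ℝ (chartField X x₀) z u) := by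
    intro u
    have h1 : HasFDerivAt (fun z' => chartField X y₀ (τ z')) _ z := hX2.hasFDerivAt.comp z hτ1
    have h2 := hDτ.hasFDerivAt.clm_apply hX1.hasFDerivAt
    have h3 : (fun z' => chartField X y₀ (τ z')) =ᶠ[𝓝 z]
        fun z' => fderiv ℝ τ z' (chartField X x₀ z') := by
      filter_upwards [hOz] with z' hz' using hfield z' hz'
    have h4 := congrArg (fun A => A u) (h1.unique (h2.congr_of_eventuallyEq h3))
    simp only [ContinuousLinearMap.comp_apply, add_apply, ContinuousLinearMap.flip_apply] at h4
    rw [h4, add_comm]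
  ext u v
  -- the derivative of the transformation law of the metric along the field
  set w := chartField X x₀ z with hw
  have hline : HasDerivAt (fun s : ℝ => z + s • w) w 0 := by
    simpa using ((hasDerivAt_id (0 : ℝ)).smul_const w).const_add z
  have hz0 : z + (0 : ℝ) • w = z := by simp
  have h1 := hasDerivAt_form_apply (B := chartForm g x₀) (a := fun s : ℝ => z + s • w)
    (by simpa using differentiableAt_chartForm g hz.1) hline (hasDerivAt_const (0 : ℝ) u)
    (hasDerivAt_const (0 : ℝ) v)
  have hτl : HasDerivAt (fun s : ℝ => τ (z + s • w)) (fderiv ℝ τ z w) 0 :=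
    HasFDerivAt.comp_hasDerivAt (l := τ) (0 : ℝ) (by simpa using hτ1) hline
  have hDτl : ∀ u, HasDerivAt (fun s : ℝ => fderiv ℝ τ (z + s • w) u)
      (fderiv ℝ (fderiv ℝ τ) z w u) 0 := by
    intro u
    have h2 : HasDerivAt (fun s : ℝ => fderiv ℝ τ (z + s • w)) (fderiv ℝ (fderiv ℝ τ) z w) 0 :=
      HasFDerivAt.comp_hasDerivAt (l := fderiv ℝ τ) (0 : ℝ) (by simpa using hDτ.hasFDerivAt) hline
    simpa using h2.clm_apply (hasDerivAt_const (0 : ℝ) u)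
  have h2 := hasDerivAt_form_apply (B := chartForm g y₀) (a := fun s : ℝ => τ (z + s • w))
    (by simpa using differentiableAt_chartForm g hτz) hτl (hDτl u) (hDτl v)
  have h3 : (fun s : ℝ => chartForm g x₀ (z + s • w) u v) =ᶠ[𝓝 0]
      fun s => chartForm g y₀ (τ (z + s • w)) (fderiv ℝ τ (z + s • w) u)
        (fderiv ℝ τ (z + s • w) v) := by
    have h4 : ∀ᶠ s : ℝ in 𝓝 0, z + s • w ∈ chartMapDomain (m := m) (n := m) x₀ y₀ (id : M → M) :=
      hline.continuousAt.eventually (by simpa using hOz)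
    filter_upwards [h4] with s hs using hform _ hs u v
  have h5 := h1.unique (h2.congr_of_eventuallyEq h3)
  simp only [hz0, map_zero, zero_apply, add_zero] at h5
  rw [ContinuousLinearMap.bilinearComp_apply, chartLieForm_apply, chartLieForm_apply, ← hw, h5,
    hDfield, hDfield, hform z hz, hform z hz, hfield z hz, ← hw, hsymm u w, hsymm v w]
  simp only [map_add, add_apply]
  ring

/-- `lieForm` uses a different chart at each point; this moves it to a fixed one. It is the change
of charts into the chart centred at the point itself, where the frame is the identity and the
transition derivative becomes `chartFrame`. -/
theorem lieForm_chartFrame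
    (hX : ContMDiff (𝓡 m) (𝓡 m).tangent ∞ (fun x => (⟨x, X x⟩ : TangentBundle (𝓡 m) M)))
    {x₀ : M} {z : EuclideanSpace ℝ (Fin m)} (hz : z ∈ (extChartAt (𝓡 m) x₀).target) :
    (lieForm g X ((extChartAt (𝓡 m) x₀).symm z)).bilinearComp (chartFrame x₀ z) (chartFrame x₀ z) =
      chartLieForm g X x₀ z := by
  set x := (extChartAt (𝓡 m) x₀).symm z with hx
  have hmem : z ∈ chartMapDomain (m := m) (n := m) x₀ x (id : M → M) :=
    ⟨hz, mem_extChartAt_source x⟩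
  rw [chartLieForm_change g hX hmem]
  have h1 := modelDeriv_chartFrame hmem.1 hmem.2 mdifferentiableAt_id
  have hid : modelDeriv (m := m) (n := m) (id : M → M) ((extChartAt (𝓡 m) x₀).symm z) =
    ContinuousLinearMap.id ℝ _ := mfderiv_id
  have h2 : chartMap (m := m) (n := m) x₀ x (id : M → M) z = extChartAt (𝓡 m) x x := rfl
  rw [hid, ContinuousLinearMap.id_comp, h2, chartFrame_self, ContinuousLinearMap.id_comp] at h1
  rw [h1, h2]
  rfl

/-- The squared norm of the Lie derivative of the metric is continuous. -/
theorem continuous_tensorInner_lieForm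
    (hX : ContMDiff (𝓡 m) (𝓡 m).tangent ∞ (fun x => (⟨x, X x⟩ : TangentBundle (𝓡 m) M))) :
    Continuous fun x => tensorInner g x (fun u v => lieForm g X x u v)
      fun u v => lieForm g X x u v := by
  rw [continuous_iff_continuousAt]
  intro x₀
  have hT : IsOpen (extChartAt (𝓡 m) x₀).target := isOpen_extChartAt_target x₀
  have hF := contDiffOn_chartForm g x₀
  have hXf := contDiffOn_chartField hX x₀
  have hL : ∀ i j, ContDiffOn ℝ ∞ (fun z => formMatrix (chartLieForm g X x₀ z) i j)
      (extChartAt (𝓡 m) x₀).target := by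
    intro i j
    have hDX := hXf.fderiv_of_isOpen (m := ∞) hT (by simp)
    have hDF := hF.fderiv_of_isOpen (m := ∞) hT (by simp)
    exact (((hDF.clm_apply hXf).clm_apply contDiffOn_const).clm_apply contDiffOn_const).add
      ((hF.clm_apply (hDX.clm_apply contDiffOn_const)).clm_apply contDiffOn_const) |>.add
      ((hF.clm_apply contDiffOn_const).clm_apply (hDX.clm_apply contDiffOn_const))
  have hG := contDiffOn_matrix_inv (contDiffOn_formMatrix_chartForm g x₀)
    fun z hz => (posDef_chartForm g hz).det_pos.ne'
  have h1 := contDiffOn_trace (contDiffOn_matrix_mul (contDiffOn_matrix_mul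
    (contDiffOn_matrix_mul hG hL) hG)
    (B := fun z => (formMatrix (chartLieForm g X x₀ z)).transpose) fun i j => hL j i)
  have h2 : ContinuousAt (extChartAt (𝓡 m) x₀) x₀ := continuousAt_extChartAt x₀
  have h3 := (h1.continuousOn.continuousAt (hT.mem_nhds (mem_extChartAt_target x₀))).comp h2
  refine h3.congr ?_
  filter_upwards [(isOpen_extChartAt_source x₀).mem_nhds (mem_extChartAt_source (I := 𝓡 m) x₀)]
    with x hx
  have h5 := tensorInner_eq_of_chartFrame g ((extChartAt (𝓡 m) x₀).map_source hx) (lieForm g X x)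
  have h6 := lieForm_chartFrame g hX ((extChartAt (𝓡 m) x₀).map_source hx)
  rw [(extChartAt (𝓡 m) x₀).left_inv hx] at h5 h6
  rw [h6] at h5
  exact h5.symm

/-- The derivative of the pullback of the metric along a family of maps through the identity is the
Lie derivative along the velocity field. -/
theorem hasDerivAt_pullbackForm {ψ : ℝ → M → M}
    (hψ : ContMDiff (𝓘(ℝ, ℝ).prod (𝓡 m)) (𝓡 m) ∞ fun q : ℝ × M => ψ q.1 q.2)
    (h0 : ∀ x, ψ 0 x = x)
    (hv : ∀ x, mfderiv 𝓘(ℝ, ℝ) (𝓡 m) (fun s : ℝ => ψ s x) 0 (1 : ℝ) = X (ψ 0 x))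
    (x : M) (u v : EuclideanSpace ℝ (Fin m)) :
    HasDerivAt (fun s => pullbackForm (m := m) g (ψ s) x u v) (lieForm g X x u v) 0 := by
  set D := chartFamilyDomain (m := m) (n := m) x x ψ
  have hD : IsOpen D := isOpen_chartFamilyDomain hψ x x
  set z := extChartAt (𝓡 m) x x with hz
  set Ψ := chartFamily (m := m) (n := m) x x ψ with hΨ
  have hsrc : ∀ z' ∈ (extChartAt (𝓡 m) x).target, ((0 : ℝ), z') ∈ D := fun z' hz' => by
    refine ⟨hz', ?_⟩
    rw [mem_preimage, mem_preimage]
    simp only [h0]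
    exact (extChartAt (𝓡 m) x).map_target hz'
  have hmem : ((0 : ℝ), z) ∈ D := hsrc z (mem_extChartAt_target x)
  have hDn := hD.mem_nhds hmem
  have hΨd : ContDiffAt ℝ ∞ Ψ (0, z) := (contDiffOn_chartFamily hψ x x).contDiffAt hDn
  have hleft : (extChartAt (𝓡 m) x).symm z = x := (extChartAt (𝓡 m) x).left_inv
    (mem_extChartAt_source x)
  have hΨ0 : ∀ z' ∈ (extChartAt (𝓡 m) x).target, Ψ (0, z') = z' := fun z' hz' => by
    simp [hΨ, chartFamily, chartMap, h0]
    simpa using (extChartAt (𝓡 m) x).right_inv hz'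
  have hΨz : ∀ u, fderiv ℝ Ψ (0, z) (0, u) = u := by
    intro u
    have h1 : HasFDerivAt (fun z' => Ψ (0, z'))
        ((fderiv ℝ Ψ (0, z)).comp (ContinuousLinearMap.inr ℝ ℝ _)) z :=
      (hΨd.differentiableAt (by simp)).hasFDerivAt.comp z (hasFDerivAt_prodMk_right 0 z)
    have h2 : (fun z' => Ψ (0, z')) =ᶠ[𝓝 z] fun z' => z' := by
      filter_upwards [(isOpen_extChartAt_target x).mem_nhds (mem_extChartAt_target x)] with z' hz'
        using hΨ0 z' hz'
    exact congrArg (fun A => A u) (h1.unique ((hasFDerivAt_id z).congr_of_eventuallyEq h2))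
  -- The velocity is needed on the whole chart domain and not only at the centre, because it is
  -- differentiated in space below.
  have hvel : ∀ z' ∈ (extChartAt (𝓡 m) x).target,
      fderiv ℝ Ψ (0, z') (1, 0) = chartField X x z' := by
    intro z' hz'
    set x' := (extChartAt (𝓡 m) x).symm z' with hx'
    have hΨd' : DifferentiableAt ℝ Ψ (0, z') := ((contDiffOn_chartFamily hψ x x).contDiffAt
      (hD.mem_nhds (hsrc z' hz'))).differentiableAt (by simp)
    have h1 : HasFDerivAt (fun s => Ψ (s, z'))
        ((fderiv ℝ Ψ (0, z')).comp (ContinuousLinearMap.inl ℝ ℝ _)) (0 : ℝ) :=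
      HasFDerivAt.comp (g := Ψ) (0 : ℝ) hΨd'.hasFDerivAt (hasFDerivAt_prodMk_left (0 : ℝ) z')
    have h2 : MDifferentiableAt 𝓘(ℝ, ℝ) (𝓡 m) (fun s : ℝ => ψ s x') 0 :=
      (hψ.comp (contMDiff_id.prodMk contMDiff_const)).mdifferentiable (by simp) 0
    have h3 : MDifferentiableAt (𝓡 m) 𝓘(ℝ, EuclideanSpace ℝ (Fin m)) (extChartAt (𝓡 m) x)
        (ψ 0 x') := by
      refine mdifferentiableAt_extChartAt ?_
      rw [h0, ← extChartAt_source (𝓡 m)]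
      exact (extChartAt (𝓡 m) x).map_target hz'
    have h4 := (h3.hasMFDerivAt.comp (0 : ℝ) h2.hasMFDerivAt).hasFDerivAt
    have h5 := congrArg (fun A => A (1 : ℝ)) (h1.unique h4)
    have h6 : fderiv ℝ Ψ (0, z') (1, 0) = chartCoframe x (ψ 0 x')
      (mfderiv 𝓘(ℝ, ℝ) (𝓡 m) (fun s : ℝ => ψ s x') 0 (1 : ℝ)) := h5
    rw [h6, hv]
    have h7 : chartField X x z' = (fun x'' : M => chartCoframe x x'' (X x'')) x' := rfl
    rw [h7]
    exact congrArg (fun y : M => chartCoframe x y (X y)) (h0 x')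
  have hD2 : DifferentiableAt ℝ (fderiv ℝ Ψ) (0, z) :=
    (hΨd.fderiv_right (m := ∞) (by simp)).differentiableAt (by simp)
  have hsymm : ∀ a b, fderiv ℝ (fderiv ℝ Ψ) (0, z) a b = fderiv ℝ (fderiv ℝ Ψ) (0, z) b a :=
    fun a b => (hΨd.isSymmSndFDerivAt (by simp; exact WithTop.coe_le_coe.2 le_top)) a b
  -- By symmetry of second derivatives, the time derivative of the Jacobian of ψ_s is the space
  -- derivative of its velocity. This produces the two terms with ∂X in the Lie derivative.
  have hmixed : ∀ u, fderiv ℝ (fderiv ℝ Ψ) (0, z) (1, 0) (0, u) = fderiv ℝ (chartField X x) z u := by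
    intro u
    rw [hsymm]
    have h1 : HasFDerivAt (fun z' => fderiv ℝ Ψ (0, z'))
        ((fderiv ℝ (fderiv ℝ Ψ) (0, z)).comp (ContinuousLinearMap.inr ℝ ℝ _)) z :=
      hD2.hasFDerivAt.comp z (hasFDerivAt_prodMk_right 0 z)
    have h2 := h1.clm_apply (hasFDerivAt_const ((1 : ℝ), (0 : EuclideanSpace ℝ (Fin m))) z)
    have h3 : chartField X x =ᶠ[𝓝 z] fun z' => fderiv ℝ Ψ (0, z') (1, 0) := by
      filter_upwards [(isOpen_extChartAt_target x).mem_nhds (mem_extChartAt_target x)] with z' hz'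
        using (hvel z' hz').symm
    rw [(h2.congr_of_eventuallyEq h3).fderiv]
    simp
  have hs : HasDerivAt (fun s : ℝ => (s, z)) ((1 : ℝ), (0 : EuclideanSpace ℝ (Fin m))) 0 :=
    (hasDerivAt_id (0 : ℝ)).prodMk (hasDerivAt_const (0 : ℝ) z)
  have ha : HasDerivAt (fun s : ℝ => Ψ (s, z)) (chartField X x z) 0 := by
    rw [← hvel z (mem_extChartAt_target x)]
    exact (hΨd.differentiableAt (by simp)).hasFDerivAt.comp_hasDerivAt (0 : ℝ) hs
  have hb : ∀ u, HasDerivAt (fun s : ℝ => fderiv ℝ Ψ (s, z) (0, u))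
      (fderiv ℝ (chartField X x) z u) 0 := by
    intro u
    have h1 : HasDerivAt (fun s : ℝ => fderiv ℝ Ψ (s, z)) (fderiv ℝ (fderiv ℝ Ψ) (0, z) (1, 0)) 0 :=
      hD2.hasFDerivAt.comp_hasDerivAt (0 : ℝ) hs
    rw [← hmixed u]
    simpa using h1.clm_apply (hasDerivAt_const (0 : ℝ) ((0 : ℝ), u))
  have hΨ00 : Ψ (0, z) = z := hΨ0 z (mem_extChartAt_target x)
  have h1 := hasDerivAt_form_apply (B := chartForm g x) (a := fun s : ℝ => Ψ (s, z))
    (by rw [hΨ00]; exact differentiableAt_chartForm g (mem_extChartAt_target x)) ha (hb u) (hb v)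
  simp only [hΨ00, hΨz] at h1
  refine h1.congr_of_eventuallyEq ?_
  have h2 : ∀ᶠ s : ℝ in 𝓝 0, (s, z) ∈ D := hs.continuousAt.eventually hDn
  filter_upwards [h2] with s hs'
  have h3 := pullbackForm_family g hψ hs' u v
  simp only [hleft] at h3
  rw [← h3, hz, chartFrame_self]
  rfl

end LieDerivative
end

noncomputable section

/-! ### The energy along volume preserving variations -/

section Energy

variable {m : ℕ} {M : Type*} [TopologicalSpace M] [ChartedSpace (EuclideanSpace ℝ (Fin m)) M]
  [IsManifold (𝓡 m) ∞ M]
  {n : ℕ} {N : Type*} [TopologicalSpace N] [ChartedSpace (EuclideanSpace ℝ (Fin n)) N]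
  [IsManifold (𝓡 n) ∞ N] {g : SmoothMetric m M} {h : SmoothMetric n N}

theorem metricTrace_const_mul (x : M) (c : ℝ) (A : Tensor02 m x) :
    metricTrace g x (fun u v => c * A u v) = c * metricTrace g x A := by
  have h1 : tensorMatrix (fun u v => c * A u v) = c • tensorMatrix A := by
    ext i j
    rfl
  rw [metricTrace, h1, mul_smul_comm, Matrix.trace_smul]
  rfl

theorem tensorInner_const_mul (x : M) (c : ℝ) (A : Tensor02 m x) :
    tensorInner g x (fun u v => c * A u v) (fun u v => c * A u v) = c ^ 2 * tensorInner g x A A := by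
  have h1 : tensorMatrix (fun u v => c * A u v) = c • tensorMatrix A := by
    ext i j
    rfl
  rw [tensorInner, h1, Matrix.transpose_smul, mul_smul_comm, mul_smul_comm, smul_mul_assoc,
    smul_mul_assoc, Matrix.trace_smul, Matrix.trace_smul, smul_eq_mul, smul_eq_mul, ← mul_assoc,
    ← sq]
  rfl

theorem metricTrace_self (x : M) : metricTrace g x (fun u v => g.inner x u v) = m := by
  have h1 : IsUnit (gramMatrix g x).det := isUnit_iff_ne_zero.2 (posDef_gramMatrix g x).det_pos.ne'
  have h2 : metricTrace g x (fun u v => g.inner x u v) =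
    ((gramMatrix g x)⁻¹ * gramMatrix g x).trace := rfl
  rw [h2, Matrix.nonsing_inv_mul _ h1]
  simp

theorem normSqDeriv_of_conformal {φ : M → N} {l : M → ℝ} {x : M}
    (hl : ∀ u v : TangentSpace (𝓡 m) x, pullbackMetric h φ x u v = l x * g.inner x u v) :
    normSqDeriv g h φ x = m * l x := by
  have h1 : pullbackMetric h φ x = fun u v => l x * g.inner x u v := by
    ext u v
    exact hl u v
  rw [normSqDeriv, h1, metricTrace_const_mul, metricTrace_self, mul_comm]

/-- Tracing φ^*h = l g gives m l = |dφ|², which is smooth. In dimension 0 the trace carries no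
information, but there every factor works and 0 is taken. -/
theorem exists_smooth_conformalFactor {φ : M → N} (hφ : ContMDiff (𝓡 m) (𝓡 n) ∞ φ)
    (hc : IsWeaklyConformal g h φ) : ∃ l : M → ℝ, ContMDiff (𝓡 m) 𝓘(ℝ, ℝ) ∞ l ∧
      ∀ (x : M) (u v : TangentSpace (𝓡 m) x), pullbackMetric h φ x u v = l x * g.inner x u v := by
  obtain ⟨l, hl⟩ := hc
  rcases Nat.eq_zero_or_pos m with rfl | hm
  · refine ⟨fun _ => 0, contMDiff_const, fun x u v => ?_⟩
    have hu : u = 0 := Subsingleton.elim (α := EuclideanSpace ℝ (Fin 0)) u 0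
    rw [hl, hu, map_zero]
    simp
  · refine ⟨l, ?_, hl⟩
    have h1 : l = fun x => (m : ℝ)⁻¹ * normSqDeriv g h φ x := by
      ext x
      rw [normSqDeriv_of_conformal (hl x)]
      field_simp
    rw [h1]
    exact contMDiff_const.mul (contMDiff_normSqDeriv h g hφ)

/-- The trace of the pullback of the metric under a map, minus the dimension. -/
def strainTrace (g : SmoothMetric m M) (ψ : M → M) (x : M) : ℝ :=
  metricTrace g x (pullbackMetric g ψ x) - m

theorem strainTrace_eq (ψ : M → M) (x : M) : strainTrace g ψ x =
    ((formMatrix (metricForm g x))⁻¹ * formMatrix (pullbackForm (m := m) g ψ x)).trace - m := rfl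

theorem pullbackForm_of_eventually_id {ψ : M → M} {x : M} (hψ : ∀ᶠ y in 𝓝 x, ψ y = y) :
    pullbackForm (m := m) g ψ x = metricForm g x := by
  have h1 : modelDeriv (m := m) (n := m) ψ x = ContinuousLinearMap.id ℝ _ := by
    have h2 : ψ =ᶠ[𝓝 x] id := hψ
    have h3 : mfderiv (𝓡 m) (𝓡 m) ψ x = mfderiv (𝓡 m) (𝓡 m) id x := h2.mfderiv_eq
    exact h3.trans mfderiv_id
  rw [pullbackForm, h1, hψ.self_of_nhds]
  rfl

theorem strainTrace_of_eventually_id {ψ : M → M} {x : M} (hψ : ∀ᶠ y in 𝓝 x, ψ y = y) :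
    strainTrace g ψ x = 0 := by
  have h1 : metricTrace g x (pullbackMetric g ψ x) = metricTrace g x fun u v => g.inner x u v := by
    have h2 : pullbackMetric g ψ x = fun u v => g.inner x u v := by
      ext u v
      exact congrArg (fun b => b u v) (pullbackForm_of_eventually_id (g := g) hψ)
    rw [h2]
  rw [strainTrace, h1, metricTrace_self, sub_self]

/-- The chain rule gives (φ∘ψ)^*h = (l∘ψ) ψ^*g. Subtracting m from the trace splits off |dφ|²∘ψ,
whose integral a volume preserving ψ does not change. -/
theorem normSqDeriv_comp_of_conformal {φ : M → N} (hφ : ContMDiff (𝓡 m) (𝓡 n) ∞ φ) {l : M → ℝ}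
    (hl : ∀ (x : M) (u v : TangentSpace (𝓡 m) x), pullbackMetric h φ x u v = l x * g.inner x u v)
    {ψ : M → M} (hψ : ContMDiff (𝓡 m) (𝓡 m) ∞ ψ) (x : M) :
    normSqDeriv (m := m) g h (φ ∘ ψ) x = l (ψ x) * strainTrace g ψ x + normSqDeriv g h φ (ψ x) := by
  have h1 : pullbackMetric (m := m) h (φ ∘ ψ) x =
      fun u v => l (ψ x) * pullbackMetric (m := m) g ψ x u v := by
    ext u v
    have h2 : mfderiv (𝓡 m) (𝓡 n) (φ ∘ ψ) x =
        (mfderiv (𝓡 m) (𝓡 n) φ (ψ x)).comp (mfderiv (𝓡 m) (𝓡 m) ψ x) :=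
      mfderiv_comp x (hφ.mdifferentiable (by simp) (ψ x)) (hψ.mdifferentiable (by simp) x)
    have h3 := hl (ψ x) (mfderiv (𝓡 m) (𝓡 m) ψ x u) (mfderiv (𝓡 m) (𝓡 m) ψ x v)
    rw [pullbackMetric, h2]
    exact h3
  rw [normSqDeriv_of_conformal (hl (ψ x)), normSqDeriv, h1, metricTrace_const_mul, strainTrace]
  ring

omit [IsManifold (𝓡 m) ∞ M] in
theorem contDiff_slice_param {P : Type*} [NormedAddCommGroup P] [NormedSpace ℝ P] {u : P × M → ℝ}
    (hu : ContMDiff (𝓘(ℝ, P).prod (𝓡 m)) 𝓘(ℝ, ℝ) ∞ u) (x : M) :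
    ContDiff ℝ ∞ fun p => u (p, x) := by
  have h1 : ContMDiff 𝓘(ℝ, P) 𝓘(ℝ, ℝ) ∞ fun p => u (p, x) :=
    hu.comp (contMDiff_id.prodMk contMDiff_const)
  exact h1.contDiff

theorem continuous_slice {α β : Type*} [TopologicalSpace α] [TopologicalSpace β] {u : α × β → ℝ}
    (hu : Continuous u) (p : α) : Continuous fun x => u (p, x) :=
  hu.comp (by fun_prop)

theorem MeasureTheory.MeasurePreserving.half_integral_eq {α : Type*} [MeasurableSpace α]
    {μ : Measure α} {ψ : α → α} (hψ : MeasurePreserving ψ μ μ) (hemb : MeasurableEmbedding ψ)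
    {F G w : α → ℝ} (hF : Integrable F μ) (hw : Integrable w μ)
    (hG : ∀ x, G x = w x + F (ψ x)) :
    (1 / 2) * ∫ x, G x ∂μ = (1 / 2) * ∫ x, w x ∂μ + (1 / 2) * ∫ x, F x ∂μ := by
  simp_rw [hG]
  have h1 : Integrable (fun x => F (ψ x)) μ := hψ.integrable_comp_of_integrable hF
  rw [integral_add hw h1, hψ.integral_comp hemb, mul_add]

/-! ### First and second variation -/

section Variation

variable [T2Space M] [MeasurableSpace M] [BorelSpace M]
  {P : Type*} [NormedAddCommGroup P] [NormedSpace ℝ P] {ψ : P → M → M}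

omit [T2Space M] [MeasurableSpace M] [BorelSpace M] in
theorem contMDiff_strainTrace
    (hψ : ContMDiff (𝓘(ℝ, P).prod (𝓡 m)) (𝓡 m) ∞ fun q : P × M => ψ q.1 q.2) :
    ContMDiff (𝓘(ℝ, P).prod (𝓡 m)) 𝓘(ℝ, ℝ) ∞ fun q : P × M => strainTrace g (ψ q.1) q.2 :=
  (contMDiff_metricTrace_pullback g g hψ).sub contMDiff_const

omit [BorelSpace M] in
theorem IsSDiffVariation.strainTrace_support (hψ : IsSDiffVariation g ψ) (p₀ : P) :
    ∃ K : Set M, IsCompact K ∧ ∀ᶠ p in 𝓝 p₀, ∀ x ∉ K, strainTrace g (ψ p) x = 0 := by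
  obtain ⟨K, hK, hp⟩ := hψ.locally_compact_support p₀
  refine ⟨K, hK, hp.mono fun p hp x hx => strainTrace_of_eventually_id ?_⟩
  -- The strain at x involves the derivative of ψ, so ψ must be the identity near x. It is, since K
  -- is closed in the Hausdorff space M.
  filter_upwards [hK.isClosed.isOpen_compl.mem_nhds hx] with y hy using hp y hy

/-- All dependence on p is moved into the integral of a compactly supported function; finiteness of
the energy takes care of the constant term. -/
theorem IsSDiffVariation.dirichletEnergy_comp (hψ : IsSDiffVariation g ψ) {φ : M → N}
    (hφ : ContMDiff (𝓡 m) (𝓡 n) ∞ φ) (hE : HasFiniteEnergy g h φ) {l : M → ℝ}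
    (hlc : Continuous l)
    (hl : ∀ (x : M) (u v : TangentSpace (𝓡 m) x), pullbackMetric h φ x u v = l x * g.inner x u v)
    (p : P) :
    dirichletEnergy g h (φ ∘ ψ p) =
      (1 / 2) * ∫ x, l (ψ p x) * strainTrace g (ψ p) x ∂(riemannianVolume g)
        + dirichletEnergy g h φ := by
  have := isFiniteMeasureOnCompacts_riemannianVolume g
  have hψp : ContMDiff (𝓡 m) (𝓡 m) ∞ (ψ p) := contMDiff_of_family hψ.smooth p
  obtain ⟨K, hK, hp⟩ := hψ.strainTrace_support p
  have hst : Continuous fun x => strainTrace g (ψ p) x :=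
    continuous_slice (contMDiff_strainTrace hψ.smooth).continuous p
  have h1 : Integrable (fun x => l (ψ p x) * strainTrace g (ψ p) x) (riemannianVolume g) :=
    integrable_of_continuous_of_eq_zero_off ((hlc.comp hψp.continuous).mul hst) hK fun x hx => by
      rw [hp.self_of_nhds x hx, mul_zero]
  have hemb : MeasurableEmbedding (ψ p) := by
    obtain ⟨Φ, hΦ⟩ := (hψ.mem_sdiff p).diffeo
    rw [← hΦ]
    exact Φ.toHomeomorph.measurableEmbedding
  exact (hψ.mem_sdiff p).volume_preserving.half_integral_eq hemb hE h1
    (normSqDeriv_comp_of_conformal hφ hl hψp)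

omit [T2Space M] [BorelSpace M] in
theorem IsSDiffVariation.pullbackForm_zero (hψ : IsSDiffVariation g ψ) (x : M) :
    pullbackForm (m := m) g (ψ 0) x = metricForm g x :=
  pullbackForm_of_eventually_id (Eventually.of_forall hψ.at_zero)

omit [T2Space M] [BorelSpace M] in
theorem IsSDiffVariation.strainTrace_zero (hψ : IsSDiffVariation g ψ) (x : M) :
    strainTrace g (ψ 0) x = 0 :=
  strainTrace_of_eventually_id (Eventually.of_forall hψ.at_zero)

omit [T2Space M] in
/-- Along volume preserving variations of the identity, the trace of the pullback of the metric is
critical at the identity. -/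
theorem IsSDiffVariation.hasDerivAt_strainTrace {ψ : ℝ → M → M} (hψ : IsSDiffVariation g ψ)
    (x : M) : HasDerivAt (fun t => strainTrace g (ψ t) x) 0 0 := by
  have h1 : ∀ i j, HasDerivAt (fun t => formMatrix (pullbackForm (m := m) g (ψ t) x) i j)
      ((Matrix.of fun i j => deriv (fun t => formMatrix (pullbackForm (m := m) g (ψ t) x) i j) 0 :
        Matrix (Fin m) (Fin m) ℝ) i j) 0 := fun i j =>
    ((contDiff_pullbackForm_param g hψ.smooth x _ _).differentiable (by simp)
      ).differentiableAt.hasDerivAt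
  have h2 := trace_inv_mul_deriv_eq_zero h1 (fun s => (hψ.mem_sdiff s).det_pullbackForm x)
    (posDef_gramMatrix g x).det_pos.ne'
  rw [hψ.pullbackForm_zero] at h2
  have h3 := hasDerivAt_trace (hasDerivAt_matrix_mul
    (A := fun _ => (formMatrix (metricForm g x))⁻¹) (A' := 0) (fun i j => hasDerivAt_const _ _) h1)
  rw [zero_mul, zero_add, h2] at h3
  simpa only [strainTrace_eq] using h3.sub_const (m : ℝ)

/-- The strain trace vanishes to first order at the identity, so the derivative of the integrand
vanishes at each point, whatever the derivative of l∘ψ is. -/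
theorem isRestrictedHarmonic_of_conformal {φ : M → N} (hφ : ContMDiff (𝓡 m) (𝓡 n) ∞ φ)
    (hE : HasFiniteEnergy g h φ) (hc : IsWeaklyConformal g h φ) : IsRestrictedHarmonic g h φ := by
  have := isFiniteMeasureOnCompacts_riemannianVolume g
  obtain ⟨l, hls, hl⟩ := exists_smooth_conformalFactor hφ hc
  refine ⟨hφ, hE, fun ψ hψ => ?_⟩
  simp_rw [hψ.dirichletEnergy_comp hφ hE hls.continuous hl]
  obtain ⟨K, hK, hp⟩ := hψ.strainTrace_support 0
  have hw : ContMDiff (𝓘(ℝ, ℝ).prod (𝓡 m)) 𝓘(ℝ, ℝ) ∞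
      fun q : ℝ × M => l (ψ q.1 q.2) * strainTrace g (ψ q.1) q.2 :=
    (hls.comp hψ.smooth).mul (contMDiff_strainTrace hψ.smooth)
  have h1 := hasDerivAt_integral_of_contMDiff (I := 𝓡 m) (μ := riemannianVolume g) hw hK
    (hp.mono fun t ht x hx => by rw [ht x hx, mul_zero])
  have h2 : ∀ x, deriv (fun t => l (ψ t x) * strainTrace g (ψ t) x) 0 = 0 := by
    intro x
    have h3 : DifferentiableAt ℝ (fun t => l (ψ t x)) 0 :=
      ((contDiff_slice_param (hls.comp hψ.smooth) x).differentiable (by simp)).differentiableAt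
    have h5 := h3.hasDerivAt.mul (hψ.hasDerivAt_strainTrace x)
    rw [hψ.strainTrace_zero, mul_zero, mul_zero, add_zero] at h5
    exact h5.deriv
  simp only [h2, integral_zero] at h1
  have h3 := (h1.const_mul (1 / 2)).add_const (dirichletEnergy g h φ)
  rwa [mul_zero] at h3

-- Used to restrict a two-parameter variation to its coordinate axes.
omit [T2Space M] [BorelSpace M] in
theorem IsSDiffVariation.comp_linear {Q : Type*} [NormedAddCommGroup Q] [NormedSpace ℝ Q]
    (hψ : IsSDiffVariation g ψ) (A : Q →L[ℝ] P) : IsSDiffVariation g fun q => ψ (A q) where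
  mem_sdiff q := hψ.mem_sdiff _
  at_zero x := by rw [map_zero]; exact hψ.at_zero x
  smooth := hψ.smooth.comp ((A.contMDiff.comp contMDiff_fst).prodMk contMDiff_snd)
  locally_compact_support q := by
    obtain ⟨K, hK, hp⟩ := hψ.locally_compact_support (A q)
    exact ⟨K, hK, A.continuous.continuousAt.eventually hp⟩

theorem HasMixedDerivAtZero.const_mul_add {F : ℝ × ℝ → ℝ} {c : ℝ} (hF : HasMixedDerivAtZero F c)
    (a b : ℝ) : HasMixedDerivAtZero (fun p => a * F p + b) (a * c) := by
  obtain ⟨G, hG, hGc⟩ := hF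
  exact ⟨fun s => a * G s, hG.mono fun s hs => (hs.const_mul a).add_const b, hGc.const_mul a⟩

omit [T2Space M] [MeasurableSpace M] [BorelSpace M] in
theorem tensorInner_lieForm_eq (X : ∀ x : M, TangentSpace (𝓡 m) x) (x : M) :
    tensorInner g x (fun u v => lieForm g X x u v) (fun u v => lieForm g X x u v) =
      ((formMatrix (metricForm g x))⁻¹ * formMatrix (lieForm g X x) *
        (formMatrix (metricForm g x))⁻¹ * formMatrix (lieForm g X x)).trace := by
  have h1 : (formMatrix (lieForm g X x)).transpose = formMatrix (lieForm g X x) := by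
    ext i j
    exact lieForm_symm g X x _ _
  conv_rhs => rw [← h1]
  conv_rhs => rw [h1]
  have h2 : tensorInner g x (fun u v => lieForm g X x u v) (fun u v => lieForm g X x u v) =
      ((formMatrix (metricForm g x))⁻¹ * formMatrix (lieForm g X x) *
        (formMatrix (metricForm g x))⁻¹ * (formMatrix (lieForm g X x)).transpose).trace := rfl
  rw [h2, h1]

omit [T2Space M] in
/-- The second variation of the trace of the pullback of the metric. -/
theorem IsSDiffVariation.deriv_deriv_strainTrace {ψ : ℝ × ℝ → M → M} (hψ : IsSDiffVariation g ψ)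
    {X : ∀ x : M, TangentSpace (𝓡 m) x}
    (ht : IsTangentTo ψ X X) {l : M → ℝ} (hls : ContMDiff (𝓡 m) 𝓘(ℝ, ℝ) ∞ l) (x : M) :
    deriv (fun s => deriv (fun t => l (ψ (s, t) x) * strainTrace g (ψ (s, t)) x) 0) 0 =
      l x * tensorInner g x (fun u v => lieForm g X x u v) fun u v => lieForm g X x u v := by
  have hψ1 : IsSDiffVariation g fun s : ℝ => ψ (s, 0) :=
    hψ.comp_linear (ContinuousLinearMap.inl ℝ ℝ ℝ)
  have hψ2 : IsSDiffVariation g fun t : ℝ => ψ (0, t) :=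
    hψ.comp_linear (ContinuousLinearMap.inr ℝ ℝ ℝ)
  have hs : ∀ i j, HasDerivAt (fun s : ℝ => formMatrix (pullbackForm (m := m) g (ψ (s, 0)) x) i j)
      (formMatrix (lieForm g X x) i j) 0 := fun i j =>
    hasDerivAt_pullbackForm g hψ1.smooth hψ1.at_zero (fun x => (ht x).1) x _ _
  have ht' : ∀ i j, HasDerivAt (fun t : ℝ => formMatrix (pullbackForm (m := m) g (ψ (0, t)) x) i j)
      (formMatrix (lieForm g X x) i j) 0 := fun i j =>
    hasDerivAt_pullbackForm g hψ2.smooth hψ2.at_zero (fun x => (ht x).2) x _ _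
  have hH : ∀ i j, ContDiff ℝ ∞ fun p => formMatrix (pullbackForm (m := m) g (ψ p) x) i j :=
    fun i j => contDiff_pullbackForm_param g hψ.smooth x _ _
  -- The matrices are those of ψ_{s,t}^*g at x, with first derivative L_X g along both axes.
  have h1 := hasDerivAt_trace_of_det_const hH (fun p => (hψ.mem_sdiff p).det_pullbackForm x)
    (posDef_gramMatrix g x).det_pos.ne' hs ht'
  rw [hψ.pullbackForm_zero, ← tensorInner_lieForm_eq] at h1
  have hst : HasDerivAt (fun s : ℝ => deriv (fun t : ℝ => strainTrace g (ψ (s, t)) x) 0)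
      (tensorInner g x (fun u v => lieForm g X x u v) fun u v => lieForm g X x u v) 0 := by
    simp only [strainTrace_eq, deriv_sub_const]
    exact h1
  have hb : ContDiff ℝ ∞ fun p => strainTrace g (ψ p) x :=
    contDiff_slice_param (contMDiff_strainTrace hψ.smooth) x
  have ha : ContDiff ℝ ∞ fun p => l (ψ p x) := contDiff_slice_param (hls.comp hψ.smooth) x
  have h3 := deriv_deriv_mul_of_critical ha hb (hψ.strainTrace_zero x)
    (hψ1.hasDerivAt_strainTrace x) (hψ2.hasDerivAt_strainTrace x) hst
  rw [h3]
  simp only [hψ.at_zero]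

theorem hasHessian_of_conformal {φ : M → N} (hφ : ContMDiff (𝓡 m) (𝓡 n) ∞ φ)
    (hE : HasFiniteEnergy g h φ) {l : M → ℝ} (hls : ContMDiff (𝓡 m) 𝓘(ℝ, ℝ) ∞ l)
    (hl : ∀ (x : M) (u v : TangentSpace (𝓡 m) x), pullbackMetric h φ x u v = l x * g.inner x u v)
    (X : ∀ x : M, TangentSpace (𝓡 m) x) :
    HasHessian g h φ X X ((1 / 2) * ∫ x, l x * tensorInner g x (fun u v => lieForm g X x u v)
      (fun u v => lieForm g X x u v) ∂(riemannianVolume g)) := by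
  have := isFiniteMeasureOnCompacts_riemannianVolume g
  intro ψ hψ ht
  simp_rw [hψ.dirichletEnergy_comp hφ hE hls.continuous hl]
  have hw : ContMDiff (𝓘(ℝ, ℝ × ℝ).prod (𝓡 m)) 𝓘(ℝ, ℝ) ∞
      fun q : (ℝ × ℝ) × M => l (ψ q.1 q.2) * strainTrace g (ψ q.1) q.2 :=
    (hls.comp hψ.smooth).mul (contMDiff_strainTrace hψ.smooth)
  have h1 := hasMixedDerivAtZero_integral (I := 𝓡 m) (μ := riemannianVolume g) hw fun p₀ => by
    obtain ⟨K, hK, hp⟩ := hψ.strainTrace_support p₀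
    exact ⟨K, hK, hp.mono fun t ht x hx => by simp only [ht x hx, mul_zero]⟩
  simp only [hψ.deriv_deriv_strainTrace ht hls] at h1
  exact h1.const_mul_add _ _

end Variation

/-! ### Positivity of the hessian and the equality case -/

section Stability

theorem lieForm_eq_zero_of_notMem {X : ∀ x : M, TangentSpace (𝓡 m) x} {x : M}
    (hx : x ∉ closure {x | X x ≠ 0}) : lieForm g X x = 0 := by
  have hn : ∀ᶠ y in 𝓝 x, X y = 0 := by
    filter_upwards [isClosed_closure.isOpen_compl.mem_nhds hx] with y hy
    by_contra h0
    exact hy (subset_closure h0)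
  have hc : ContinuousAt (extChartAt (𝓡 m) x).symm (extChartAt (𝓡 m) x x) :=
    continuousAt_extChartAt_symm x
  have h1 : chartField X x =ᶠ[𝓝 (extChartAt (𝓡 m) x x)] fun _ => 0 := by
    have h2 : ∀ᶠ y in 𝓝 ((extChartAt (𝓡 m) x).symm (extChartAt (𝓡 m) x x)), X y = 0 := by
      rwa [(extChartAt (𝓡 m) x).left_inv (mem_extChartAt_source x)]
    filter_upwards [hc.eventually h2] with z hz
    rw [chartField, hz]
    exact map_zero _
  ext u v
  rw [lieForm, chartLieForm_apply, h1.fderiv_eq, h1.self_of_nhds]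
  simp

theorem tensorInner_form_nonneg (x : M)
    (b : EuclideanSpace ℝ (Fin m) →L[ℝ] EuclideanSpace ℝ (Fin m) →L[ℝ] ℝ) :
    0 ≤ tensorInner g x (fun u v => b u v) fun u v => b u v :=
  trace_inv_mul_inv_mul_nonneg (A := formMatrix b) (posDef_gramMatrix g x)

theorem tensorInner_form_eq_zero_iff (x : M)
    (b : EuclideanSpace ℝ (Fin m) →L[ℝ] EuclideanSpace ℝ (Fin m) →L[ℝ] ℝ) :
    tensorInner g x (fun u v => b u v) (fun u v => b u v) = 0 ↔ ∀ u v, b u v = 0 := by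
  rw [← formMatrix_eq_zero_iff]
  exact trace_inv_mul_inv_mul_eq_zero_iff (A := formMatrix b) (posDef_gramMatrix g x)

/-- Both φ^*h and g are nonnegative on the diagonal, so l ≥ 0 wherever the tangent space is nonzero
and √l serves. A negative value of l forces the tangent space to be zero, and then any value does.
-/
theorem exists_sq_conformalFactor {φ : M → N} {l : M → ℝ}
    (hl : ∀ (x : M) (u v : TangentSpace (𝓡 m) x), pullbackMetric h φ x u v = l x * g.inner x u v) :
    ∃ f : M → ℝ, ∀ (x : M) (u v : TangentSpace (𝓡 m) x),
      pullbackMetric h φ x u v = f x ^ 2 * g.inner x u v := by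
  refine ⟨fun x => Real.sqrt (l x), fun x u v => ?_⟩
  rcases le_or_gt 0 (l x) with h0 | h0
  · rw [Real.sq_sqrt h0, hl]
  · have hu : u = 0 := by
      by_contra hu
      have h1 : 0 ≤ pullbackMetric h φ x u u := by
        rcases eq_or_ne (mfderiv (𝓡 m) (𝓡 n) φ x u) 0 with h2 | h2
        · rw [pullbackMetric, h2, map_zero]
        · exact (h.pos _ _ h2).le
      rw [hl] at h1
      exact absurd h1 (not_le.2 (mul_neg_of_neg_of_pos h0 (g.pos x u hu)))
    rw [hl, hu, map_zero]
    simp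

variable {X : ∀ x : M, TangentSpace (𝓡 m) x}

theorem tensorInner_lieDerivMetric (f : M → ℝ) (x : M) :
    tensorInner g x (fun u v => f x * lieDerivMetric g X x u v)
      (fun u v => f x * lieDerivMetric g X x u v) =
    f x ^ 2 * tensorInner g x (fun u v => lieForm g X x u v) fun u v => lieForm g X x u v := by
  have h1 : (fun u v => lieDerivMetric g X x u v) =
      fun u v : TangentSpace (𝓡 m) x => (lieForm g X x u v : ℝ) := by
    ext u v
    exact lieDerivMetric_eq g X x u v
  rw [← h1, tensorInner_const_mul]

/-- A conformal factor is determined unless the tangent space is zero, and there tensor norms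
vanish. So the arbitrary, possibly irregular f² can be exchanged for the smooth l inside the
integrals. -/
theorem conformalFactor_mul_tensorInner {a b : ℝ} {x : M}
    (hab : ∀ u v : TangentSpace (𝓡 m) x, a * g.inner x u v = b * g.inner x u v)
    (B : EuclideanSpace ℝ (Fin m) →L[ℝ] EuclideanSpace ℝ (Fin m) →L[ℝ] ℝ) :
    a * tensorInner g x (fun u v => B u v) (fun u v => B u v) =
      b * tensorInner g x (fun u v => B u v) (fun u v => B u v) := by
  by_cases hB : ∀ u v, B u v = 0
  · rw [(tensorInner_form_eq_zero_iff x B).2 hB, mul_zero, mul_zero]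
  · push Not at hB
    obtain ⟨u, v, huv⟩ := hB
    have hu : u ≠ 0 := by
      rintro rfl
      exact huv (by simp)
    rw [mul_right_cancel₀ (metricForm_pos g x hu).ne' (hab u u)]

variable [T2Space M] [MeasurableSpace M] [BorelSpace M]

theorem stability_of_conformal {φ : M → N} (hφ : ContMDiff (𝓡 m) (𝓡 n) ∞ φ)
    (hE : HasFiniteEnergy g h φ) (hc : IsWeaklyConformal g h φ) {f : M → ℝ}
    (hf : ∀ (x : M) (u v : TangentSpace (𝓡 m) x),
      pullbackMetric h φ x u v = f x ^ 2 * g.inner x u v) (hX : IsSolenoidal g X) :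
    let fLg : ∀ x : M, Tensor02 m x := fun x u v => f x * lieDerivMetric g X x u v
    Integrable (fun x => tensorInner g x (fLg x) (fLg x)) (riemannianVolume g) ∧
    HasHessian g h φ X X ((1 / 2) * tensorNormSq g fLg) ∧
    0 ≤ tensorNormSq g fLg ∧
    (tensorNormSq g fLg = 0 ↔
      ∀ x ∉ criticalSet (m := m) (n := n) φ, ∀ u v, lieDerivMetric g X x u v = 0) ∧
    (interior (criticalSet (m := m) (n := n) φ) = ∅ → ¬ IsKilling g X →
      0 < tensorNormSq g fLg) := by
  have := isFiniteMeasureOnCompacts_riemannianVolume g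
  have := isOpenPosMeasure_riemannianVolume g
  intro fLg
  obtain ⟨l, hls, hl⟩ := exists_smooth_conformalFactor hφ hc
  let T : M → ℝ := fun x => tensorInner g x (fun u v => lieForm g X x u v)
    fun u v => lieForm g X x u v
  have hTc : Continuous T := continuous_tensorInner_lieForm g hX.smooth
  have hT0 : ∀ x, T x = 0 ↔ ∀ u v, lieDerivMetric g X x u v = 0 := fun x => by
    rw [tensorInner_form_eq_zero_iff]
    exact forall_congr' fun u => forall_congr' fun v => by rw [lieDerivMetric_eq]
  have hfT : ∀ x, tensorInner g x (fLg x) (fLg x) = f x ^ 2 * T x := tensorInner_lieDerivMetric f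
  have hflT : ∀ x, f x ^ 2 * T x = l x * T x := fun x =>
    conformalFactor_mul_tensorInner (fun u v => by rw [← hf, hl]) _
  have hlT : ∀ x, tensorInner g x (fLg x) (fLg x) = l x * T x := fun x => by rw [hfT, hflT]
  have hlTc : Continuous fun x => l x * T x := hls.continuous.mul hTc
  have hint : Integrable (fun x => l x * T x) (riemannianVolume g) :=
    integrable_of_continuous_of_eq_zero_off hlTc hX.compact_support fun x hx => by
      have h1 : T x = 0 := (tensorInner_form_eq_zero_iff x _).2 fun u v => by
        rw [lieForm_eq_zero_of_notMem hx]
        rfl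
      rw [h1, mul_zero]
  have hnorm : tensorNormSq g fLg = ∫ x, l x * T x ∂(riemannianVolume g) :=
    integral_congr_ae (Eventually.of_forall hlT)
  have hnonneg : ∀ x, 0 ≤ l x * T x := fun x => by
    rw [← hflT]
    exact mul_nonneg (sq_nonneg _) (tensorInner_form_nonneg x _)
  have hzero : tensorNormSq g fLg = 0 ↔
      ∀ x ∉ criticalSet (m := m) (n := n) φ, ∀ u v, lieDerivMetric g X x u v = 0 := by
    rw [hnorm, integral_eq_zero_iff_of_nonneg hnonneg hint,
      Continuous.ae_eq_iff_eq (g := 0) _ hlTc continuous_const, funext_iff]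
    refine forall_congr' fun x => ?_
    rw [← hT0]
    constructor
    · intro h1 hx
      -- If l(x) = 0, then h(dφ u, dφ u) = 0 for every u, so x is critical.
      refine (mul_eq_zero.1 h1).resolve_left fun hl0 => hx fun u => ?_
      by_contra hu
      have h2 : 0 < pullbackMetric h φ x u u := h.pos _ _ hu
      rw [hl, hl0, zero_mul] at h2
      exact lt_irrefl _ h2
    · intro h1
      by_cases hx : x ∈ criticalSet (m := m) (n := n) φ
      -- At a critical point φ^*h = 0 · g, so l may be replaced by 0. Concluding l(x) = 0 would be
      -- wrong in dimension 0.
      · have h2 := conformalFactor_mul_tensorInner (g := g) (a := l x) (b := 0) (x := x)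
          (fun u v => by rw [← hl, pullbackMetric, hx u, map_zero]; simp) (lieForm g X x)
        rw [zero_mul] at h2
        exact h2
      · rw [h1 hx, mul_zero]
        rfl
  have hpos : 0 ≤ tensorNormSq g fLg := by
    rw [hnorm]
    exact integral_nonneg hnonneg
  refine ⟨hint.congr (Eventually.of_forall fun x => (hlT x).symm), ?_, hpos, hzero,
    fun hcrit hK => hpos.lt_of_ne' fun h0 => hK ?_⟩
  · rw [hnorm]
    exact hasHessian_of_conformal hφ hE hls hl X
  · have h1 := hzero.1 h0
    have h2 : Dense (criticalSet (m := m) (n := n) φ)ᶜ := interior_eq_empty_iff_dense_compl.1 hcrit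
    -- |L_X g|² is continuous and vanishes on the dense set of noncritical points.
    have h3 : T = fun _ => 0 :=
      hTc.ext_on h2 continuous_const fun x hx => (hT0 x).2 (h1 x hx)
    exact fun x => (hT0 x).1 (congrFun h3 x)

theorem isStableRestrictedHarmonic_of_conformal {φ : M → N} (hφ : ContMDiff (𝓡 m) (𝓡 n) ∞ φ)
    (hE : HasFiniteEnergy g h φ) (hc : IsWeaklyConformal g h φ) :
    IsStableRestrictedHarmonic g h φ := by
  refine ⟨isRestrictedHarmonic_of_conformal hφ hE hc, fun X hX => ?_⟩
  obtain ⟨l, -, hl⟩ := exists_smooth_conformalFactor hφ hc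
  obtain ⟨f, hf⟩ := exists_sq_conformalFactor hl
  obtain ⟨-, h1, h2, -⟩ := stability_of_conformal hφ hE hc hf hX
  exact ⟨_, by positivity, h1⟩

end Stability

end Energy
end

noncomputable section

/-! ### Inverse stereographic projection is conformal of finite energy -/

section Euclidean

variable {m : ℕ}

theorem euclideanMetric_inner (x : EuclideanSpace ℝ (Fin m)) (u v : EuclideanSpace ℝ (Fin m)) :
    (euclideanMetric m).inner x u v = inner ℝ u v := by
  have h1 : derivInto (m := m) (fun x : EuclideanSpace ℝ (Fin m) => x) x =
      ContinuousLinearMap.id ℝ _ := mfderiv_id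
  have h2 : (euclideanMetric m).inner x u v =
    inner ℝ (derivInto (m := m) (fun x : EuclideanSpace ℝ (Fin m) => x) x u)
      (derivInto (m := m) (fun x : EuclideanSpace ℝ (Fin m) => x) x v) := rfl
  rw [h2, h1]
  rfl

theorem chartMetric_euclideanMetric (x₀ z u v : EuclideanSpace ℝ (Fin m)) :
    chartMetric (euclideanMetric m) x₀ z u v = inner ℝ u v := by
  have h1 : ⇑(extChartAt (𝓡 m) x₀).symm = id := by
    rw [extChartAt_model_space_eq_id]
    rfl
  have h2 : mfderiv 𝓘(ℝ, EuclideanSpace ℝ (Fin m)) (𝓡 m) (extChartAt (𝓡 m) x₀).symm z =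
      ContinuousLinearMap.id ℝ (EuclideanSpace ℝ (Fin m)) := by
    rw [h1]
    exact mfderiv_id
  rw [chartMetric, h2]
  exact euclideanMetric_inner _ u v

theorem chartDensity_euclideanMetric (x₀ z : EuclideanSpace ℝ (Fin m)) :
    chartDensity (euclideanMetric m) x₀ z = 1 := by
  have h1 : (Matrix.of fun i j => chartMetric (euclideanMetric m) x₀ z
      (EuclideanSpace.single i (1 : ℝ)) (EuclideanSpace.single j (1 : ℝ))) = 1 := by
    ext i j
    rw [Matrix.of_apply, chartMetric_euclideanMetric, EuclideanSpace.inner_single_left]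
    simp [Matrix.one_apply]
  rw [chartDensity, h1, Matrix.det_one, Real.sqrt_one]

theorem riemannianVolume_euclideanMetric : riemannianVolume (euclideanMetric m) = volume := by
  ext A hA
  have h1 : A ⊆ (extChartAt (𝓡 m) (0 : EuclideanSpace ℝ (Fin m))).source := by
    rw [extChartAt_model_space_eq_id]
    exact subset_univ A
  rw [riemannianVolume_eq_chartVolume _ 0 hA h1, chartVolume_apply _ _ hA]
  simp_rw [chartDensity_euclideanMetric]
  rw [extChartAt_model_space_eq_id]
  simp

end Euclidean

/-! ### The derivative and the energy of inverse stereographic projection -/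

section Stereographic

/-- Inverse stereographic projection, as a map into the ambient space. -/
def ambientInverseStereographic (x : EuclideanSpace ℝ (Fin 3)) : EuclideanSpace ℝ (Fin (3 + 1)) :=
  (‖x‖ ^ 2 + 1)⁻¹ • !₂[‖x‖ ^ 2 - 1, 2 * x 0, 2 * x 1, 2 * x 2]

theorem contDiff_ambientInverseStereographic : ContDiff ℝ ∞ ambientInverseStereographic := by
  have h1 : ContDiff ℝ ∞ fun x : EuclideanSpace ℝ (Fin 3) => ‖x‖ ^ 2 := contDiff_norm_sq ℝ
  have h2 : ∀ i, ContDiff ℝ ∞ fun x : EuclideanSpace ℝ (Fin 3) => 2 * x i := fun i =>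
    contDiff_const.mul (EuclideanSpace.proj (𝕜 := ℝ) i).contDiff
  refine ((h1.add contDiff_const).inv fun x => by positivity).smul (contDiff_euclidean.2 fun i => ?_)
  fin_cases i
  · exact h1.sub contDiff_const
  · exact h2 0
  · exact h2 1
  · exact h2 2

theorem hasDerivAt_line_apply (x u : EuclideanSpace ℝ (Fin 3)) (i : Fin 3) :
    HasDerivAt (fun t : ℝ => (x + t • u) i) (u i) 0 := by
  simpa using ((hasDerivAt_id (0 : ℝ)).mul_const (u i)).const_add (x i)

theorem hasDerivAt_line_norm_sq (x u : EuclideanSpace ℝ (Fin 3)) :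
    HasDerivAt (fun t : ℝ => ‖x + t • u‖ ^ 2) (2 * inner ℝ x u) 0 := by
  have h1 : HasDerivAt (fun t : ℝ => x + t • u) u 0 := by
    simpa using ((hasDerivAt_id (0 : ℝ)).smul_const u).const_add x
  simpa using h1.norm_sq

/-- Reduces each component of the derivative to calculus in one variable along the line x + tu. -/
theorem fderiv_ambientInverseStereographic_apply (x u : EuclideanSpace ℝ (Fin 3))
    (i : Fin (3 + 1)) {d : ℝ}
    (hd : HasDerivAt (fun t : ℝ => ambientInverseStereographic (x + t • u) i) d 0) :
    fderiv ℝ ambientInverseStereographic x u i = d := by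
  have h1 : HasDerivAt (fun t : ℝ => x + t • u) u 0 := by
    simpa using ((hasDerivAt_id (0 : ℝ)).smul_const u).const_add x
  have h2 : HasFDerivAt ambientInverseStereographic (fderiv ℝ ambientInverseStereographic x)
      (x + (0 : ℝ) • u) := by
    rw [zero_smul, add_zero]
    exact (contDiff_ambientInverseStereographic.differentiable (by simp) x).hasFDerivAt
  have h3 := (EuclideanSpace.proj (𝕜 := ℝ) i).hasFDerivAt.comp_hasDerivAt (0 : ℝ)
    (h2.comp_hasDerivAt (0 : ℝ) h1)
  exact h3.unique hd

theorem fderiv_ambientInverseStereographic_zero (x u : EuclideanSpace ℝ (Fin 3)) :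
    fderiv ℝ ambientInverseStereographic x u 0 = 4 * inner ℝ x u / (‖x‖ ^ 2 + 1) ^ 2 := by
  refine fderiv_ambientInverseStereographic_apply x u 0 ?_
  have h1 := hasDerivAt_line_norm_sq x u
  have h0 : ‖x + (0 : ℝ) • u‖ ^ 2 + 1 ≠ 0 := by positivity
  have h2 := ((h1.add_const 1).inv h0).mul (h1.sub_const 1)
  refine h2.congr_deriv ?_
  simp only [zero_smul, add_zero, Pi.inv_apply]
  have h0 : ‖x‖ ^ 2 + 1 ≠ 0 := by positivity
  field_simp
  ring

theorem fderiv_ambientInverseStereographic_succ (x u : EuclideanSpace ℝ (Fin 3)) (i : Fin 3) :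
    fderiv ℝ ambientInverseStereographic x u i.succ =
      2 * u i / (‖x‖ ^ 2 + 1) - 4 * x i * inner ℝ x u / (‖x‖ ^ 2 + 1) ^ 2 := by
  refine fderiv_ambientInverseStereographic_apply x u i.succ ?_
  have h1 := hasDerivAt_line_norm_sq x u
  have h0 : ‖x + (0 : ℝ) • u‖ ^ 2 + 1 ≠ 0 := by positivity
  have h2 := ((h1.add_const 1).inv h0).mul ((hasDerivAt_line_apply x u i).const_mul 2)
  have h3 : (fun t : ℝ => ambientInverseStereographic (x + t • u) i.succ) =
      fun t : ℝ => (‖x + t • u‖ ^ 2 + 1)⁻¹ * (2 * (x + t • u) i) := by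
    ext t
    fin_cases i <;> rfl
  rw [h3]
  refine h2.congr_deriv ?_
  simp only [zero_smul, add_zero, Pi.inv_apply]
  have h0 : ‖x‖ ^ 2 + 1 ≠ 0 := by positivity
  field_simp
  ring

/-- Put a = |x|² + 1, p = ⟨x,u⟩, q = ⟨x,v⟩. The first component contributes 16pq/a⁴, the others
4⟨u,v⟩/a² − 16pq/a³ + 16|x|²pq/a⁴, and the terms in pq cancel because 1 + |x|² = a. -/
theorem inner_fderiv_ambientInverseStereographic (x u v : EuclideanSpace ℝ (Fin 3)) :
    inner ℝ (fderiv ℝ ambientInverseStereographic x u) (fderiv ℝ ambientInverseStereographic x v) =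
      4 / (‖x‖ ^ 2 + 1) ^ 2 * inner ℝ u v := by
  have h0 : ‖x‖ ^ 2 + 1 ≠ 0 := by positivity
  have h1 : ∀ a b : EuclideanSpace ℝ (Fin 3), inner ℝ a b = ∑ i, a i * b i := fun a b => by
    simp [PiLp.inner_apply, mul_comm]
  have h2 : ∀ a b : EuclideanSpace ℝ (Fin (3 + 1)), inner ℝ a b = ∑ i, a i * b i := fun a b => by
    simp [PiLp.inner_apply, mul_comm]
  have h3 : ‖x‖ ^ 2 = x 0 * x 0 + x 1 * x 1 + x 2 * x 2 := by
    rw [← real_inner_self_eq_norm_sq, h1, Fin.sum_univ_three]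
  rw [h2, Fin.sum_univ_succ]
  simp only [fderiv_ambientInverseStereographic_zero, fderiv_ambientInverseStereographic_succ]
  rw [Fin.sum_univ_three]
  have h4 : inner ℝ u v = u 0 * v 0 + u 1 * v 1 + u 2 * v 2 := by rw [h1, Fin.sum_univ_three]
  have h5 : inner ℝ x u = x 0 * u 0 + x 1 * u 1 + x 2 * u 2 := by rw [h1, Fin.sum_univ_three]
  have h6 : inner ℝ x v = x 0 * v 0 + x 1 * v 1 + x 2 * v 2 := by rw [h1, Fin.sum_univ_three]
  field_simp
  rw [h4, h5, h6, h3]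
  ring

theorem contMDiff_inverseStereographic : ContMDiff (𝓡 3) (𝓡 3) ∞ inverseStereographic :=
  have : Fact (Module.finrank ℝ (EuclideanSpace ℝ (Fin (3 + 1))) = 3 + 1) := ⟨by simp⟩
  ContMDiff.codRestrict_sphere (f := ambientInverseStereographic)
    contDiff_ambientInverseStereographic.contMDiff fun x => (inverseStereographic x).2

/-- The round metric is induced by the inclusion, so by the chain rule its pullback is that of the
ambient inner product under the ambient map. -/
theorem pullbackMetric_inverseStereographic (x : EuclideanSpace ℝ (Fin 3))
    (u v : TangentSpace (𝓡 3) x) :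
    pullbackMetric (roundMetric 3) inverseStereographic x u v =
      4 / (‖x‖ ^ 2 + 1) ^ 2 * (euclideanMetric 3).inner x u v := by
  have : Fact (Module.finrank ℝ (EuclideanSpace ℝ (Fin (3 + 1))) = 3 + 1) := ⟨by simp⟩
  let ι : Metric.sphere (0 : EuclideanSpace ℝ (Fin (3 + 1))) 1 → EuclideanSpace ℝ (Fin (3 + 1)) :=
    fun y => y
  have hι : ContMDiff (𝓡 3) 𝓘(ℝ, EuclideanSpace ℝ (Fin (3 + 1))) ∞ ι := contMDiff_coe_sphere
  have h1 : ∀ w : EuclideanSpace ℝ (Fin 3),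
      derivInto (m := 3) ι (inverseStereographic x)
        (mfderiv (𝓡 3) (𝓡 3) inverseStereographic x w) =
      fderiv ℝ ambientInverseStereographic x w := by
    intro w
    have h2 : mfderiv (𝓡 3) 𝓘(ℝ, EuclideanSpace ℝ (Fin (3 + 1))) (ι ∘ inverseStereographic) x =
        (mfderiv (𝓡 3) 𝓘(ℝ, EuclideanSpace ℝ (Fin (3 + 1))) ι (inverseStereographic x)).comp
          (mfderiv (𝓡 3) (𝓡 3) inverseStereographic x) :=
      mfderiv_comp x (hι.mdifferentiable (by simp) _)
        (contMDiff_inverseStereographic.mdifferentiable (by simp) _)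
    have h3 : mfderiv (𝓡 3) 𝓘(ℝ, EuclideanSpace ℝ (Fin (3 + 1))) (ι ∘ inverseStereographic) x =
        fderiv ℝ ambientInverseStereographic x := mfderiv_eq_fderiv
    rw [← h3, h2]
    rfl
  have h4 : pullbackMetric (roundMetric 3) inverseStereographic x u v =
      inner ℝ (derivInto (m := 3) ι (inverseStereographic x)
        (mfderiv (𝓡 3) (𝓡 3) inverseStereographic x u))
      (derivInto (m := 3) ι (inverseStereographic x)
        (mfderiv (𝓡 3) (𝓡 3) inverseStereographic x v)) := rfl
  rw [h4]
  refine (congrArg₂ (inner ℝ) (h1 u) (h1 v)).trans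
    ((inner_fderiv_ambientInverseStereographic x u v).trans ?_)
  exact congrArg _ (euclideanMetric_inner x u v).symm

/-- The energy density is three times the conformal factor, 12 (1 + |x|²)^(−4/2), and it is
integrable because the exponent 4 exceeds the dimension 3. -/
theorem hasFiniteEnergy_inverseStereographic :
    HasFiniteEnergy (euclideanMetric 3) (roundMetric 3) inverseStereographic := by
  have h1 : normSqDeriv (euclideanMetric 3) (roundMetric 3) inverseStereographic =
      fun x => 12 * (1 + ‖x‖ ^ 2) ^ (-(4 : ℝ) / 2) := by
    ext x
    rw [normSqDeriv_of_conformal (l := fun x => 4 / (‖x‖ ^ 2 + 1) ^ 2)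
      (pullbackMetric_inverseStereographic x)]
    have h2 : (-(4 : ℝ) / 2) = -((2 : ℕ) : ℝ) := by norm_num
    rw [h2, Real.rpow_neg (by positivity), Real.rpow_natCast]
    push_cast
    ring
  rw [HasFiniteEnergy, h1, riemannianVolume_euclideanMetric]
  exact (integrable_rpow_neg_one_add_norm_sq (by simp; norm_num)).const_mul _

theorem isWeaklyConformal_inverseStereographic :
    IsWeaklyConformal (euclideanMetric 3) (roundMetric 3) inverseStereographic :=
  ⟨_, pullbackMetric_inverseStereographic⟩

end Stereographic
end

theorem corollary3p3 :
    (∀ (m n : ℕ)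
      (M : Type*) [TopologicalSpace M] [T2Space M] [SecondCountableTopology M]
      [ChartedSpace (EuclideanSpace ℝ (Fin m)) M] [IsManifold (𝓡 m) ∞ M]
      [MeasurableSpace M] [BorelSpace M]
      (N : Type*) [TopologicalSpace N] [ChartedSpace (EuclideanSpace ℝ (Fin n)) N]
      [IsManifold (𝓡 n) ∞ N]
      (g : SmoothMetric m M) (h : SmoothMetric n N) (φ : M → N),
      ContMDiff (𝓡 m) (𝓡 n) ∞ φ → HasFiniteEnergy g h φ → IsWeaklyConformal g h φ →
        IsStableRestrictedHarmonic g h φ ∧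
        (∃ f : M → ℝ, ∀ x u v, pullbackMetric h φ x u v = f x ^ 2 * g.inner x u v) ∧
        ∀ f : M → ℝ, (∀ x u v, pullbackMetric h φ x u v = f x ^ 2 * g.inner x u v) →
        ∀ X : (∀ x : M, TangentSpace (𝓡 m) x), IsSolenoidal g X →
          let fLg : ∀ x : M, Tensor02 m x := fun x u v => f x * lieDerivMetric g X x u v
          Integrable (fun x => tensorInner g x (fLg x) (fLg x)) (riemannianVolume g) ∧
          HasHessian g h φ X X ((1 / 2) * tensorNormSq g fLg) ∧
          0 ≤ tensorNormSq g fLg ∧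
          (tensorNormSq g fLg = 0 ↔
            ∀ x ∉ criticalSet (m := m) (n := n) φ, ∀ u v, lieDerivMetric g X x u v = 0) ∧
          (interior (criticalSet (m := m) (n := n) φ) = ∅ → ¬ IsKilling g X →
            0 < tensorNormSq g fLg)) ∧
    IsStableRestrictedHarmonic (euclideanMetric 3) (roundMetric 3) inverseStereographic := by
  refine ⟨?_, isStableRestrictedHarmonic_of_conformal contMDiff_inverseStereographic
    hasFiniteEnergy_inverseStereographic isWeaklyConformal_inverseStereographic⟩
  intro m n M _ _ _ _ _ _ _ N _ _ _ g h φ hφ hE hc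
  refine ⟨isStableRestrictedHarmonic_of_conformal hφ hE hc, ?_,
    fun f hf X hX => stability_of_conformal hφ hE hc hf hX⟩
  obtain ⟨l, hl⟩ := hc
  exact exists_sq_conformalFactor hl
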